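/- **Setting.** Let $N\ge 1$. Fix an even real-valued Schwartz function $\phi_0$ on $\mathbb{R}^N$ with support $\{3/4\le|\xi|\le 8/3\}$ and $\phi_0>0$ in the interior of this annulus. Put $\phi_q(\xi)=\phi_0(2^{-q}\xi)$ for $q\in\mathbb{Z}$, $\widehat{\Phi_q}=\phi_q/\sum_{k\in\mathbb{Z}}\phi_k$ (with value $0$ at $\xi=0$) and $\widehat{\Psi}=1-\sum_{q\ge 0}\widehat{\Phi_q}$. For a tempered distribution $f\in\mathcal{S}'(\mathbb{R}^N)$ let $\Delta_qf=0$ for $q\le -2$, $\Delta_{-1}f=\Psi*f$, and $\Delta_qf=\Phi_q*f$ for $q\ge 0$. For $s\in\mathbb{R}$, $1\le p,r,\theta\le\infty$ and $0<T<\infty$ let $$\|f\|_{B^s_{p,r}}=\Big\|\big(2^{qs}\|\Delta_qf\|_{L^p}\big)_{q\ge -1}\Big\|_{\ell^r},\qquad \|f\|_{\widetilde L^\theta_T(B^s_{p,r})}=\Big\|\big(2^{qs}\|\Delta_qf\|_{L^\theta_T(L^p)}\big)_{q\ge -1}\Big\|_{\ell^r},$$ where $f\in\mathcal{S}'$ in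 the first case and $f\in L^\theta(0,T;\mathcal{S}')$ in the second, and $\|f\|_{L^\theta_T(L^p)}$ is the $L^\theta(0,T)$ norm of $t\mapsto\|f(t)\|_{L^p}$. Write $[f,\Delta_q]g=f\,\Delta_qg-\Delta_q(fg)$. **Statement.** Let $s>-1$, $1\le p\le\infty$ and $1\le r\le\infty$. There is a constant $C>0$ such that the following two assertions hold for all $p_1,p_2\in[1,\infty]$ with $1/p=1/p_1+1/p_2$. 1. Let $f\in B^{s+1}_{p_2,r}$ with $\nabla f\in L^\infty$, and let $g\in L^{p_1}\cap B^s_{p,r}$. Then the products $fg$ and $f\,\Delta_q g$ are well defined as products of functions, and there is a nonnegative sequence $(c_q)$ with $\|(c_q)\|_{\ell^r}\le 1$ such that for all $q$ $$\|[f,\Delta_q]g\|_{L^p}\le C\,c_q\,2^{-q(s+1)}\Big(\|\nabla f\|_{L^\infty}\|g\|_{B^s_{p,r}}+\|g\|_{L^{p_1}}\|f\|_{B^{s+1}_{p_2,r}}\Big).$$ 2. Let $T>0$ and let $\theta,\theta_1,\theta_2,\theta_3,\theta_4\in[1,\infty]$ with $1/\theta=1/\theta_1+1/\theta_2=1/\theta_3+1/\theta_4$.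 Let $f\in\widetilde L^{\theta_4}_T(B^{s+1}_{p_2,r})$ with $\nabla f\in L^{\theta_1}_T(L^\infty)$, and let $g\in L^{\theta_3}_T(L^{p_1})\cap\widetilde L^{\theta_2}_T(B^s_{p,r})$. Then, for each $q$, $[f(t),\Delta_q]g(t)$ is well defined for almost every $t\in(0,T)$ and $[f,\Delta_q]g\in L^\theta_T(L^p)$, and there is a nonnegative sequence $(c_q)$ with $\|(c_q)\|_{\ell^r}\le 1$ such that for all $q$ $$\|[f,\Delta_q]g\|_{L^\theta_T(L^p)}\le C\,c_q\,2^{-q(s+1)}\Big(\|\nabla f\|_{L^{\theta_1}_T(L^\infty)}\|g\|_{\widetilde L^{\theta_2}_T(B^s_{p,r})}+\|g\|_{L^{\theta_3}_T(L^{p_1})}\|f\|_{\widetilde L^{\theta_4}_T(B^{s+1}_{p_2,r})}\Big).$$ The constant $C$ does not depend on $p_1,p_2,\theta,\theta_1,\dots,\theta_4,T,f,g,q$; the sequence $(c_q)$ may depend on everything except $q$. -/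

import Mathlib

open MeasureTheory SchwartzMap
open scoped ENNReal NNReal

noncomputable section

namespace LittlewoodPaley

/-- The space `ℝ^N` with its Euclidean norm. -/
abbrev Space (N : ℕ) := EuclideanSpace ℝ (Fin N)

/-- The function from which the dyadic partition of unity is built: an even real Schwartz function
whose support is the closed annulus `3/4 ≤ |ξ| ≤ 8/3` and which is positive inside the annulus. -/
structure Cutoff (N : ℕ) where
  toSchwartz : 𝓢(Space N, ℝ)
  even : ∀ ξ, toSchwartz (-ξ) = toSchwartz ξ
  tsupport_eq : tsupport toSchwartz = {ξ : Space N | 3 / 4 ≤ ‖ξ‖ ∧ ‖ξ‖ ≤ 8 / 3}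
  pos : ∀ ξ : Space N, 3 / 4 < ‖ξ‖ → ‖ξ‖ < 8 / 3 → 0 < toSchwartz ξ

variable {N : ℕ}

/-- The dilate `φ_q(ξ) = φ₀(2^{-q} ξ)`. -/
def Cutoff.dilate (φ : Cutoff N) (q : ℤ) (ξ : Space N) : ℝ :=
  φ.toSchwartz ((2 : ℝ) ^ (-q) • ξ)

/-- The Fourier transform of `Φ_q`, that is `φ_q(ξ) / ∑_k φ_k(ξ)`. For each `ξ` only finitely many
terms of the sum are nonzero, and the sum is positive for `ξ ≠ 0`; at `ξ = 0` the value is `0`. -/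
def Cutoff.annulusSymbol (φ : Cutoff N) (q : ℤ) (ξ : Space N) : ℝ :=
  φ.dilate q ξ / ∑' k : ℤ, φ.dilate k ξ

/-- The Fourier transform of `Ψ`, that is `1 - ∑_{q ≥ 0} FΦ_q`. -/
def Cutoff.ballSymbol (φ : Cutoff N) (ξ : Space N) : ℝ :=
  1 - ∑' q : ℕ, φ.annulusSymbol (q : ℤ) ξ

/-- The symbol of the inhomogeneous dyadic block `Δ_q`: zero for `q ≤ -2`, the Fourier transform
of `Ψ` for `q = -1` and of `Φ_q` for `q ≥ 0`. -/
def Cutoff.symbol (φ : Cutoff N) (q : ℤ) (ξ : Space N) : ℂ :=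
  if q ≤ -2 then 0 else if q = -1 then (φ.ballSymbol ξ : ℂ) else (φ.annulusSymbol q ξ : ℂ)

/-- The inhomogeneous dyadic block `Δ_q f = F⁻¹ (symbol_q · F f)`, i.e. `Ψ * f` for `q = -1` and
`Φ_q * f` for `q ≥ 0`, on tempered distributions. -/
def block (φ : Cutoff N) (q : ℤ) : 𝓢'(Space N, ℂ) →L[ℂ] 𝓢'(Space N, ℂ) :=
  TemperedDistribution.fourierMultiplierCLM ℂ (φ.symbol q)

/-- The tempered distribution `f` is (integration against) the function `u`. -/
def IsFun (f : 𝓢'(Space N, ℂ)) (u : Space N → ℂ) : Prop :=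
  ∀ η : 𝓢(Space N, ℂ), Integrable (fun x => η x * u x) ∧ f η = ∫ x, η x * u x

/-- The `L^p` norm of a tempered distribution; it is `∞` if the distribution is not an `L^p`
function (the representing function is unique up to a null set). -/
def normLp (p : ℝ≥0∞) (f : 𝓢'(Space N, ℂ)) : ℝ≥0∞ :=
  ⨅ (u : Space N → ℂ) (_ : MemLp u p volume) (_ : IsFun f u), eLpNorm u p volume

/-- The partial derivative in the `j`-th coordinate, in the sense of distributions. -/
def partialDeriv (j : Fin N) (f : 𝓢'(Space N, ℂ)) : 𝓢'(Space N, ℂ) :=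
  LineDeriv.lineDerivOp (EuclideanSpace.single j (1 : ℝ) : Space N) f

/-- The `L^p` norm of the distributional gradient, `∞` if `∇f` is not an `L^p` function. -/
def normGradLp (p : ℝ≥0∞) (f : 𝓢'(Space N, ℂ)) : ℝ≥0∞ :=
  ⨅ (u : Space N → EuclideanSpace ℂ (Fin N)) (_ : MemLp u p volume)
    (_ : ∀ j, IsFun (partialDeriv j f) (fun x => u x j)), eLpNorm u p volume

/-- The `ℓ^r` norm of a family of nonnegative extended reals. -/
def normSeq {ι : Type*} (r : ℝ≥0∞) (a : ι → ℝ≥0∞) : ℝ≥0∞ :=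
  if r = ∞ then ⨆ i, a i else (∑' i, a i ^ r.toReal) ^ (1 / r.toReal)

/-- The norm of the inhomogeneous Besov space `B^s_{p,r}`. -/
def normBesov (φ : Cutoff N) (s : ℝ) (p r : ℝ≥0∞) (f : 𝓢'(Space N, ℂ)) : ℝ≥0∞ :=
  normSeq r fun q : {q : ℤ // -1 ≤ q} =>
    (2 : ℝ≥0∞) ^ ((q : ℤ) * s : ℝ) * normLp p (block φ q f)

/-- `P` is the product of the tempered distributions `f` and `g`, which are functions. -/
def IsProduct (f g P : 𝓢'(Space N, ℂ)) : Prop :=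
  ∃ u v : Space N → ℂ, IsFun f u ∧ IsFun g v ∧ IsFun P (fun x => u x * v x)

/-- `K` is the commutator `[f, Δ_q] g = f Δ_q g - Δ_q (f g)`; both products are required to exist
as products of functions, and then `K` is unique. -/
def IsCommutator (φ : Cutoff N) (f : 𝓢'(Space N, ℂ)) (q : ℤ) (g K : 𝓢'(Space N, ℂ)) : Prop :=
  ∃ P Q : 𝓢'(Space N, ℂ),
    IsProduct f g P ∧ IsProduct f (block φ q g) Q ∧ K = Q - block φ q P

/-- Lebesgue measure on the time interval `(0, T)`. -/
def timeMeasure (T : ℝ) : Measure ℝ := volume.restrict (Set.Ioo 0 T)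

/-- `f ∈ L^θ(0,T;𝓢')`: every pairing with a Schwartz function is in `L^θ(0,T)`. -/
def MemTimeDist (θ : ℝ≥0∞) (T : ℝ) (f : ℝ → 𝓢'(Space N, ℂ)) : Prop :=
  ∀ η : 𝓢(Space N, ℂ), MemLp (fun t => f t η) θ (timeMeasure T)

/-- The norm of `L^θ_T(L^p)`. -/
def normTimeLp (θ p : ℝ≥0∞) (T : ℝ) (f : ℝ → 𝓢'(Space N, ℂ)) : ℝ≥0∞ :=
  eLpNorm (fun t => normLp p (f t)) θ (timeMeasure T)

/-- `f ∈ L^θ_T(L^p)`; in particular `t ↦ ‖f(t)‖_{L^p}` is measurable with finite `L^θ` norm. -/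
def MemTimeLp (θ p : ℝ≥0∞) (T : ℝ) (f : ℝ → 𝓢'(Space N, ℂ)) : Prop :=
  MemTimeDist θ T f ∧ MemLp (fun t => normLp p (f t)) θ (timeMeasure T)

/-- The `L^θ_T(L^p)` norm of the spatial gradient. -/
def normTimeGradLp (θ p : ℝ≥0∞) (T : ℝ) (f : ℝ → 𝓢'(Space N, ℂ)) : ℝ≥0∞ :=
  eLpNorm (fun t => normGradLp p (f t)) θ (timeMeasure T)

/-- `∇f ∈ L^θ_T(L^p)`. -/
def MemTimeGradLp (θ p : ℝ≥0∞) (T : ℝ) (f : ℝ → 𝓢'(Space N, ℂ)) : Prop :=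
  (∀ j, MemTimeDist θ T fun t => partialDeriv j (f t)) ∧
    MemLp (fun t => normGradLp p (f t)) θ (timeMeasure T)

/-- The norm of the inhomogeneous Chemin–Lerner space `L̃^θ_T(B^s_{p,r})`: the time norm is taken
before the sum over the dyadic blocks. -/
def normCheminLerner (φ : Cutoff N) (θ : ℝ≥0∞) (T : ℝ) (s : ℝ) (p r : ℝ≥0∞)
    (f : ℝ → 𝓢'(Space N, ℂ)) : ℝ≥0∞ :=
  normSeq r fun q : {q : ℤ // -1 ≤ q} =>
    (2 : ℝ≥0∞) ^ ((q : ℤ) * s : ℝ) * normTimeLp θ p T fun t => block φ q (f t)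

/-- Membership in the inhomogeneous Chemin–Lerner space `L̃^θ_T(B^s_{p,r})`. -/
def MemCheminLerner (φ : Cutoff N) (θ : ℝ≥0∞) (T : ℝ) (s : ℝ) (p r : ℝ≥0∞)
    (f : ℝ → 𝓢'(Space N, ℂ)) : Prop :=
  MemTimeDist θ T f ∧ normCheminLerner φ θ T s p r f < ∞

end LittlewoodPaley

end

/-! # Commutators of dyadic blocks with multiplication

Write `S_m = ∑_{q < m} Δ_q` for the low-frequency cut-offs (`low`) and `[f, T] g = f T g - T (f g)`.
The estimate rests on three facts, all at fixed time.

* A kernel `κ` commutes with a Lipschitz function up to its first moment: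
  `[f, T] w (x) = ∫ κ(z) (f(x) - f(x + z)) w(x + z) dz`. The kernels of `S_m` are dilates of one
  Schwartz function, so `‖[f, S_m] w‖_p ≤ C 2^{-m} ‖∇f‖_∞ ‖w‖_p` for every `p`
  (`normLp_commutator_le`, `exists_kernel_bound`, `IsGoodFactor.normLp_commLow_le`). That a function
  with bounded distributional gradient is almost everywhere Lipschitz is `ae_lipschitz`.
* Low frequencies of `g`: with `m = q - 2`, both `Δ_q S_m g` and `Δ_q ((S_m f) (S_m g))` vanish by
  the location of the frequencies, so `[f, Δ_q] S_m g = -Δ_q ((f - S_m f) (S_m g))` is controlled by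
  `‖g‖_{p₁} ∑_{k ≥ m} ‖Δ_k f‖_{p₂}` (`block_low_mul_low`, `IsGoodFactor.normLp_comm_low_le`).
* The other blocks of `g`: for `q - 2 ≤ j ≤ q + 2` the kernel estimate applies directly, because
  `Δ_q = S_{q+1} - S_q`. For `j ≥ q + 3` the block `Δ_q` only sees `S_{j-1}` of a product while
  `S_{j-1} Δ_j g = 0`, so that `[f, Δ_q] Δ_j g = Δ_q [f, S_{j-1}] Δ_j g` again gains `2^{-j}`
  (`IsGoodFactor.normLp_comm_block_le`).

Hence (`IsGoodFactor.normLp_comm_le`)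
`‖[f, Δ_q] g‖_p ≤ C (‖∇f‖_∞ ∑_{k ≥ q-2} 2^{-k} ‖Δ_k g‖_p + ‖g‖_{p₁} ∑_{k ≥ q-2} ‖Δ_k f‖_{p₂})`.
No paraproduct decomposition of `f` is used, and the constant depends on neither `p₁` nor `p₂`. After
multiplication by `2^{q(s+1)}` both sums are convolutions with the weight `2^{(2-n)(s+1)}`, `n ≥ 0`,
which is summable exactly because `s > -1`; Young's inequality in `ℓ¹ * ℓ^r` produces the sequence
`(c_q)` (`exists_sequence_bound`). The decomposition of `g` converges only weakly
(`IsGoodFactor.tendsto_sum_comm_block`), which suffices since absolute convergence in `L^p` identifies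
the weak limit (`normLp_le_tsum`).

In the time-dependent case the fixed-time bound holds for almost every `t`, and the inequalities of
Minkowski and Hölder in `t` give the Chemin–Lerner norms. What has to be added is measurability: the
commutator is a limit, weakly and in norm, of expressions in `f(t)` and `g(t)` tested against
translates of fixed Schwartz functions, which are continuous in `x` and measurable in `t`
(`aestronglyMeasurable_product`, `aemeasurable_normLp_comm`).

The analytic tool behind the concrete description of multipliers is `apply_eq_integral_translate`: a
tempered distribution commutes with integrals of translates of a Schwartz function. It is proved by
factoring the distribution through a Banach space of weighted derivatives.
-/

noncomputable section

namespace LittlewoodPaley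

/-! ### Inequalities for `L^p` norms of extended nonnegative functions -/

section

/-- Averaging over translates does not increase an `L^p` norm by more than the mass of the averaging
measure; this is Young's inequality `L¹ * L^p ⊆ L^p` with the `L¹` function seen as a measure. -/
lemma eLpNorm_lintegral_translate_le {G : Type*} [AddCommGroup G] [MeasurableSpace G]
    [MeasurableAdd₂ G] [MeasurableNeg G] (μ ν : Measure G) [SFinite μ] [SFinite ν]
    [μ.IsAddLeftInvariant] (hν : ν ≪ μ) {w : G → ℝ≥0∞} (hw : AEMeasurable w μ)
    {p : ℝ≥0∞} (hp : 1 ≤ p) :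
    eLpNorm (fun x => ∫⁻ z, w (x + z) ∂ν) p μ ≤ ν Set.univ * eLpNorm w p μ := by
  wlog hwm : Measurable w generalizing w
  · have hcongr : ∀ x, ∫⁻ z, w (x + z) ∂ν = ∫⁻ z, hw.mk w (x + z) ∂ν := fun x =>
      lintegral_congr_ae (hν.ae_le
        ((quasiMeasurePreserving_add_left μ x).ae_eq_comp hw.ae_eq_mk))
    simp_rw [hcongr, eLpNorm_congr_ae hw.ae_eq_mk]
    exact this hw.measurable_mk.aemeasurable hw.measurable_mk
  rcases eq_or_ne p ∞ with rfl | hpt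
  · simp only [eLpNorm_exponent_top]
    refine essSup_le_of_ae_le _ (Filter.Eventually.of_forall fun x => ?_)
    have h : ∀ᵐ z ∂ν, w (x + z) ≤ eLpNormEssSup w μ :=
      hν.ae_le ((quasiMeasurePreserving_add_left μ x).ae (p := fun y => w y ≤ eLpNormEssSup w μ)
        (by simpa using enorm_ae_le_eLpNormEssSup w μ))
    calc ‖∫⁻ z, w (x + z) ∂ν‖ₑ ≤ ∫⁻ _, eLpNormEssSup w μ ∂ν := by
          simpa using lintegral_mono_ae h
      _ = _ := by rw [lintegral_const, mul_comm]
  have hp0 : p ≠ 0 := (zero_lt_one.trans_le hp).ne'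
  have hr : 1 ≤ p.toReal := by
    simpa using ENNReal.toReal_mono hpt hp
  have hr0 : 0 < p.toReal := zero_lt_one.trans_le hr
  have hm : Measurable fun a : G × G => w (a.1 + a.2) :=
    hwm.comp (measurable_fst.add measurable_snd)
  have key : ∀ x, (∫⁻ z, w (x + z) ∂ν) ^ p.toReal ≤
      (∫⁻ z, w (x + z) ^ p.toReal ∂ν) * ν Set.univ ^ (p.toReal - 1) := by
    intro x
    have h := eLpNorm'_le_eLpNorm'_mul_rpow_measure_univ (μ := ν) (p := 1) (q := p.toReal)
      zero_lt_one hr (f := fun z => w (x + z))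
      (hwm.comp (measurable_const_add x)).aestronglyMeasurable
    simp only [eLpNorm', enorm_eq_self, ENNReal.rpow_one, div_one] at h
    calc _ ≤ ((∫⁻ z, w (x + z) ^ p.toReal ∂ν) ^ (1 / p.toReal) *
          ν Set.univ ^ (1 - 1 / p.toReal)) ^ p.toReal := by gcongr
      _ = _ := by
        rw [ENNReal.mul_rpow_of_nonneg _ _ hr0.le, ← ENNReal.rpow_mul, ← ENNReal.rpow_mul]
        congr 2 <;> field_simp
        simp
  have hshift : ∀ z, ∫⁻ x, w (x + z) ^ p.toReal ∂μ = ∫⁻ x, w x ^ p.toReal ∂μ := fun z =>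
    by simpa only [add_comm] using lintegral_add_left_eq_self (μ := μ) (fun x => w x ^ p.toReal) z
  rw [eLpNorm_eq_lintegral_rpow_enorm_toReal hp0 hpt,
    eLpNorm_eq_lintegral_rpow_enorm_toReal hp0 hpt]
  simp only [enorm_eq_self]
  have hν1 : ν Set.univ = (ν Set.univ ^ p.toReal) ^ (1 / p.toReal) := by
    rw [← ENNReal.rpow_mul]; field_simp; simp
  rw [hν1, ← ENNReal.mul_rpow_of_nonneg _ _ (by positivity)]
  gcongr
  calc ∫⁻ x, (∫⁻ z, w (x + z) ∂ν) ^ p.toReal ∂μ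
      ≤ ∫⁻ x, (∫⁻ z, w (x + z) ^ p.toReal ∂ν) * ν Set.univ ^ (p.toReal - 1) ∂μ :=
        lintegral_mono key
    _ = (∫⁻ x, ∫⁻ z, w (x + z) ^ p.toReal ∂ν ∂μ) * ν Set.univ ^ (p.toReal - 1) :=
        lintegral_mul_const _ (hm.pow_const _).lintegral_prod_right'
    _ = (ν Set.univ * ∫⁻ x, w x ^ p.toReal ∂μ) * ν Set.univ ^ (p.toReal - 1) := by
        rw [lintegral_lintegral_swap (hm.pow_const _).aemeasurable]
        simp_rw [hshift]
        rw [lintegral_const, mul_comm (∫⁻ x, w x ^ p.toReal ∂μ)]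
    _ = ν Set.univ ^ p.toReal * ∫⁻ x, w x ^ p.toReal ∂μ := by
        have h2 : ν Set.univ ^ p.toReal = ν Set.univ * ν Set.univ ^ (p.toReal - 1) := by
          conv_rhs => rw [← ENNReal.rpow_one (ν Set.univ), ← ENNReal.rpow_mul, one_mul,
            ← ENNReal.rpow_add_of_nonneg _ _ zero_le_one (by linarith)]
          simp
        rw [h2]; ring

variable {α : Type*} [MeasurableSpace α] {μ : Measure α}

lemma eLpNorm_const_mul_le {p : ℝ≥0∞} (hp : p ≠ 0) (c : ℝ≥0∞) {f : α → ℝ≥0∞}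
    (hf : AEMeasurable f μ) : eLpNorm (fun x => c * f x) p μ ≤ c * eLpNorm f p μ := by
  rcases eq_or_ne p ∞ with rfl | hpt
  · simp only [eLpNorm_exponent_top]
    refine essSup_le_of_ae_le _ ?_
    filter_upwards [enorm_ae_le_eLpNormEssSup f μ] with x hx
    simp only [enorm_eq_self] at hx ⊢
    gcongr
  have hr0 : 0 < p.toReal := ENNReal.toReal_pos hp hpt
  rw [eLpNorm_eq_lintegral_rpow_enorm_toReal hp hpt, eLpNorm_eq_lintegral_rpow_enorm_toReal hp hpt]
  simp only [enorm_eq_self, ENNReal.mul_rpow_of_nonneg _ _ hr0.le]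
  rw [lintegral_const_mul'' _ (hf.pow_const _), ENNReal.mul_rpow_of_nonneg _ _ (by positivity),
    ← ENNReal.rpow_mul, mul_one_div_cancel hr0.ne', ENNReal.rpow_one]

/-- Hölder's inequality for extended nonnegative functions. -/
lemma eLpNorm_mul_le {p q r : ℝ≥0∞} (hr : 1 ≤ r) (h : 1 / r = 1 / p + 1 / q)
    {f g : α → ℝ≥0∞} (hf : AEMeasurable f μ) (hg : AEMeasurable g μ) :
    eLpNorm (fun x => f x * g x) r μ ≤ eLpNorm f p μ * eLpNorm g q μ := by
  have hr0 : r ≠ 0 := (zero_lt_one.trans_le hr).ne'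
  have top_left : ∀ {f g : α → ℝ≥0∞}, AEMeasurable g μ →
      eLpNorm (fun x => f x * g x) r μ ≤ eLpNorm f ∞ μ * eLpNorm g r μ := by
    intro f g hg
    refine (eLpNorm_mono_enorm_ae ?_).trans (eLpNorm_const_mul_le hr0 (eLpNorm f ∞ μ) hg)
    filter_upwards [enorm_ae_le_eLpNormEssSup f μ] with x hx
    simp only [enorm_eq_self, eLpNorm_exponent_top] at hx ⊢
    gcongr
  simp only [one_div] at h
  rcases eq_or_ne p ∞ with rfl | hpt
  · obtain rfl : r = q := by simpa using h
    exact top_left hg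
  rcases eq_or_ne q ∞ with rfl | hqt
  · obtain rfl : r = p := by simpa using h
    simpa only [mul_comm] using top_left (f := g) (g := f) hf
  have hrinv : r⁻¹ ≤ 1 := ENNReal.inv_le_one.2 hr
  have hp0 : p ≠ 0 := by
    rintro rfl
    simp only [ENNReal.inv_zero, top_add] at h
    simp [h] at hrinv
  have hq0 : q ≠ 0 := by
    rintro rfl
    simp only [ENNReal.inv_zero, add_top] at h
    simp [h] at hrinv
  have hrt : r ≠ ∞ := by
    rintro rfl
    simp only [ENNReal.inv_top] at h
    have := (add_eq_zero.1 h.symm).1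
    simp [hpt] at this
  have hP := ENNReal.toReal_pos hp0 hpt
  have hQ := ENNReal.toReal_pos hq0 hqt
  have hR := ENNReal.toReal_pos hr0 hrt
  have hre : 1 / r.toReal = 1 / p.toReal + 1 / q.toReal := by
    have := congrArg ENNReal.toReal h
    rw [ENNReal.toReal_add (by simpa using hp0) (by simpa using hq0)] at this
    simpa using this
  rw [eLpNorm_eq_lintegral_rpow_enorm_toReal hr0 hrt, eLpNorm_eq_lintegral_rpow_enorm_toReal hp0 hpt,
    eLpNorm_eq_lintegral_rpow_enorm_toReal hq0 hqt]
  have hlt : r.toReal < p.toReal := by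
    have : 1 / p.toReal < 1 / r.toReal := by rw [hre]; linarith [one_div_pos.2 hQ]
    exact (one_div_lt_one_div hP hR).1 this
  simpa using ENNReal.lintegral_Lp_mul_le_Lq_mul_Lr hR hlt hre μ hf hg

/-- Minkowski's inequality for series of extended nonnegative functions. -/
lemma eLpNorm_tsum_le {p : ℝ≥0∞} (hp : 1 ≤ p) {f : ℕ → α → ℝ≥0∞}
    (hf : ∀ n, AEMeasurable (f n) μ) :
    eLpNorm (fun x => ∑' n, f n x) p μ ≤ ∑' n, eLpNorm (f n) p μ := by
  have hp0 : p ≠ 0 := (zero_lt_one.trans_le hp).ne'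
  rcases eq_or_ne p ∞ with rfl | hpt
  · simp only [eLpNorm_exponent_top]
    refine essSup_le_of_ae_le _ ?_
    filter_upwards [ae_all_iff.2 fun n => enorm_ae_le_eLpNormEssSup (f n) μ] with x hx
    simpa using ENNReal.tsum_le_tsum hx
  have hr0 : 0 < p.toReal := ENNReal.toReal_pos hp0 hpt
  have hpart : ∀ n, eLpNorm (fun x => ∑ i ∈ Finset.range n, f i x) p μ ≤
      ∑' n, eLpNorm (f n) p μ := by
    intro n
    have := eLpNorm_sum_le (s := Finset.range n) (f := f) (μ := μ)
      (fun i _ => (hf i).aestronglyMeasurable) hp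
    refine le_trans (le_of_eq ?_) (this.trans (ENNReal.sum_le_tsum _))
    congr 1; ext x; simp
  rw [eLpNorm_eq_lintegral_rpow_enorm_toReal hp0 hpt]
  have hsup : ∀ x, (‖∑' n, f n x‖ₑ) ^ p.toReal =
      ⨆ n, (∑ i ∈ Finset.range n, f i x) ^ p.toReal := by
    intro x
    rw [enorm_eq_self, ENNReal.tsum_eq_iSup_nat]
    exact (ENNReal.orderIsoRpow _ hr0).map_iSup _
  simp_rw [hsup]
  rw [lintegral_iSup' (fun n => (Finset.aemeasurable_fun_sum _ fun i _ => hf i).pow_const _)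
    (Filter.Eventually.of_forall fun x m n hmn => by
      dsimp only
      gcongr),
    one_div, ENNReal.rpow_inv_le_iff hr0]
  refine iSup_le fun n => ?_
  rw [← ENNReal.rpow_inv_le_iff hr0, ← one_div]
  have := hpart n
  rw [eLpNorm_eq_lintegral_rpow_enorm_toReal hp0 hpt] at this
  simpa using this

lemma ae_lt_top_of_eLpNorm_lt_top {p : ℝ≥0∞} (hp : p ≠ 0) {f : α → ℝ≥0∞}
    (hf : AEMeasurable f μ) (h : eLpNorm f p μ < ∞) : ∀ᵐ x ∂μ, f x < ∞ := by
  rcases eq_or_ne p ∞ with rfl | hpt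
  · filter_upwards [enorm_ae_le_eLpNormEssSup f μ] with x hx
    simp only [enorm_eq_self] at hx
    exact hx.trans_lt (by simpa using h)
  have hr0 : 0 < p.toReal := ENNReal.toReal_pos hp hpt
  rw [eLpNorm_lt_top_iff_lintegral_rpow_enorm_lt_top hp hpt] at h
  filter_upwards [ae_lt_top' (hf.enorm.pow_const _) h.ne] with x hx
  simpa [ENNReal.rpow_lt_top_iff_of_pos hr0] using hx

end

/-! ### Sequence norms -/

section

lemma normSeq_eq_eLpNorm {ι : Type*} [MeasurableSpace ι] [MeasurableSingletonClass ι] [Countable ι]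
    {r : ℝ≥0∞} (hr : r ≠ 0) (a : ι → ℝ≥0∞) : normSeq r a = eLpNorm a r Measure.count := by
  unfold normSeq
  split_ifs with h
  · subst h
    simp
  · rw [eLpNorm_eq_lintegral_rpow_enorm_toReal hr h, lintegral_count]
    simp

lemma le_normSeq {ι : Type*} {r : ℝ≥0∞} (hr : r ≠ 0) (a : ι → ℝ≥0∞) (i : ι) :
    a i ≤ normSeq r a := by
  unfold normSeq
  split_ifs with h
  · exact le_iSup a i
  · have hr0 : 0 < r.toReal := ENNReal.toReal_pos hr h
    rw [one_div, ENNReal.le_rpow_inv_iff hr0]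
    exact ENNReal.le_tsum (f := fun i => a i ^ r.toReal) i

/-- A family over `ℤ` vanishing below `-1` has the same sequence norm as its restriction. -/
lemma normSeq_subtype {r : ℝ≥0∞} (hr : r ≠ 0) (a : ℤ → ℝ≥0∞) (ha : ∀ q : ℤ, q ≤ -2 → a q = 0) :
    normSeq r (fun q : {q : ℤ // -1 ≤ q} => a q) = normSeq r a := by
  unfold normSeq
  split_ifs with h
  · refine le_antisymm (iSup_le fun q => le_iSup a q) (iSup_le fun q => ?_)
    by_cases hq : -1 ≤ q
    · exact le_iSup (fun q : {q : ℤ // -1 ≤ q} => a q) ⟨q, hq⟩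
    · rw [ha q (by omega)]; exact zero_le
  · have hr0 : 0 < r.toReal := ENNReal.toReal_pos hr h
    congr 1
    refine tsum_subtype_eq_of_support_subset (f := fun q => a q ^ r.toReal) (s := {q | -1 ≤ q}) ?_
    intro q hq
    by_contra hq'
    simp only [Set.mem_ofPred_eq, not_le] at hq'
    refine hq ?_
    simp [ha q (by omega), hr0]

/-- Young's inequality `ℓ¹ * ℓ^r ⊆ ℓ^r` for a kernel supported on the half-line `[-2, ∞)`. -/
lemma normSeq_tsum_shift_le {r : ℝ≥0∞} (hr : 1 ≤ r) (w : ℕ → ℝ≥0∞) (e : ℤ → ℝ≥0∞) :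
    normSeq r (fun q : ℤ => ∑' n : ℕ, w n * e (q - 2 + n)) ≤ (∑' n, w n) * normSeq r e := by
  have hr0 : r ≠ 0 := (zero_lt_one.trans_le hr).ne'
  rw [normSeq_eq_eLpNorm hr0, normSeq_eq_eLpNorm hr0]
  let ν : Measure ℤ := Measure.sum fun n : ℕ => w n • Measure.dirac ((n : ℤ) - 2)
  have hν : ν ≪ Measure.count := by
    intro s hs
    rw [Measure.count_eq_zero_iff] at hs
    simp [hs]
  have h := eLpNorm_lintegral_translate_le Measure.count ν hν
    (measurable_of_countable e).aemeasurable hr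
  have hmass : ν Set.univ = ∑' n, w n := by
    simp [ν, Measure.sum_apply]
  have hint : ∀ q : ℤ, ∫⁻ z, e (q + z) ∂ν = ∑' n : ℕ, w n * e (q - 2 + n) := by
    intro q
    simp only [ν, lintegral_sum_measure, lintegral_smul_measure, lintegral_dirac, smul_eq_mul]
    refine tsum_congr fun n => ?_
    congr 2; ring
  simpa only [hint, hmass] using h

/-- A convolution with a summable kernel can be written as its natural bound times a sequence in the
unit ball of `ℓ^r`. -/
lemma exists_normSeq_le_one {r : ℝ≥0∞} (hr : 1 ≤ r) (w : ℕ → ℝ≥0∞) (hw : ∑' n, w n ≠ ∞)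
    (e : ℤ → ℝ≥0∞) {X : ℝ≥0∞} (he : normSeq r e ≤ X) (hX : X ≠ ∞) :
    ∃ c : ℤ → ℝ≥0∞, normSeq r c ≤ 1 ∧
      ∀ q : ℤ, ∑' n : ℕ, w n * e (q - 2 + n) ≤ (∑' n, w n) * c q * X := by
  have hr0 : r ≠ 0 := (zero_lt_one.trans_le hr).ne'
  have hb := (normSeq_tsum_shift_le hr w e).trans (mul_le_mul_right he (∑' n, w n))
  set D := (∑' n, w n) * X with hD
  have hDt : D ≠ ∞ := ENNReal.mul_ne_top hw hX
  set d : ℤ → ℝ≥0∞ := fun q : ℤ => ∑' n : ℕ, w n * e (q - 2 + n) with hd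
  rcases eq_or_ne D 0 with h0 | h0
  · refine ⟨0, ?_, fun q => ?_⟩
    · rw [normSeq_eq_eLpNorm hr0]; simp
    · have := (le_normSeq hr0 d q).trans hb
      rw [h0] at this
      exact this.trans zero_le
  · refine ⟨fun q => D⁻¹ * d q, ?_, fun q => ?_⟩
    · rw [normSeq_eq_eLpNorm hr0]
      refine (eLpNorm_const_mul_le hr0 D⁻¹ (measurable_of_countable d).aemeasurable).trans ?_
      rw [← normSeq_eq_eLpNorm hr0]
      calc D⁻¹ * normSeq r d ≤ D⁻¹ * D := by gcongr
        _ = 1 := ENNReal.inv_mul_cancel h0 hDt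
    · calc d q = D * D⁻¹ * d q := by rw [ENNReal.mul_inv_cancel h0 hDt, one_mul]
        _ ≤ _ := by rw [hD]; ring_nf; rfl

end

/-! ### Tempered distributions that are functions -/

section

variable {N : ℕ}

lemma IsFun.locallyIntegrable {f : 𝓢'(Space N, ℂ)} {u : Space N → ℂ} (h : IsFun f u) :
    LocallyIntegrable u := by
  rw [locallyIntegrable_iff]
  intro k hk
  obtain ⟨R, hR0, hR⟩ := hk.isBounded.exists_pos_norm_le
  let b : ContDiffBump (0 : Space N) := ⟨R, R + 1, hR0, by linarith⟩
  have hb1 : HasCompactSupport (Complex.ofRealCLM ∘ b) := b.hasCompactSupport.comp_left rfl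
  have hb2 : ContDiff ℝ ((⊤ : ℕ∞) : WithTop ℕ∞) (Complex.ofRealCLM ∘ b) := by
    exact Complex.ofRealCLM.contDiff.comp b.contDiff
  refine ((h (hb1.toSchwartzMap hb2)).1.integrableOn (s := k)).congr_fun ?_ hk.measurableSet
  intro x hx
  have : b x = 1 := b.one_of_mem_closedBall (by simpa [b] using hR x hx)
  simp [this]

lemma IsFun.ae_eq {f : 𝓢'(Space N, ℂ)} {u v : Space N → ℂ} (hu : IsFun f u) (hv : IsFun f v) :
    u =ᵐ[volume] v := by
  refine ae_eq_of_integral_contDiff_smul_eq hu.locallyIntegrable hv.locallyIntegrable ?_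
  intro g hg hgc
  have h1 : HasCompactSupport (Complex.ofRealCLM ∘ g) := hgc.comp_left rfl
  have h2 : ContDiff ℝ ((⊤ : ℕ∞) : WithTop ℕ∞) (Complex.ofRealCLM ∘ g) :=
    Complex.ofRealCLM.contDiff.comp hg
  have := (hu (h1.toSchwartzMap h2)).2.symm.trans (hv (h1.toSchwartzMap h2)).2
  simpa using this

lemma IsFun.congr_ae {f : 𝓢'(Space N, ℂ)} {u v : Space N → ℂ} (hu : IsFun f u)
    (h : u =ᵐ[volume] v) : IsFun f v := by
  intro η
  have h' : (fun x => η x * u x) =ᵐ[volume] fun x => η x * v x := by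
    filter_upwards [h] with x hx
    rw [hx]
  exact ⟨(hu η).1.congr h', (hu η).2.trans (integral_congr_ae h')⟩

lemma IsFun.eq {f g : 𝓢'(Space N, ℂ)} {u : Space N → ℂ} (hf : IsFun f u) (hg : IsFun g u) :
    f = g := by
  ext η
  rw [(hf η).2, (hg η).2]

lemma IsFun.zero : IsFun (0 : 𝓢'(Space N, ℂ)) 0 := fun η => by simp

lemma IsFun.add {f g : 𝓢'(Space N, ℂ)} {u v : Space N → ℂ} (hf : IsFun f u) (hg : IsFun g v) :
    IsFun (f + g) (u + v) := by
  intro η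
  simp only [Pi.add_apply, mul_add]
  exact ⟨(hf η).1.add (hg η).1, by
    rw [integral_add (hf η).1 (hg η).1, ← (hf η).2, ← (hg η).2]; rfl⟩

lemma IsFun.neg {f : 𝓢'(Space N, ℂ)} {u : Space N → ℂ} (hf : IsFun f u) :
    IsFun (-f) (-u) := by
  intro η
  simp only [Pi.neg_apply, mul_neg]
  exact ⟨(hf η).1.neg, by rw [integral_neg, ← (hf η).2]; rfl⟩

lemma IsFun.sub {f g : 𝓢'(Space N, ℂ)} {u v : Space N → ℂ} (hf : IsFun f u) (hg : IsFun g v) :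
    IsFun (f - g) (u - v) := by
  simpa only [sub_eq_add_neg] using hf.add hg.neg

lemma IsFun.aestronglyMeasurable {f : 𝓢'(Space N, ℂ)} {u : Space N → ℂ} (h : IsFun f u) :
    AEStronglyMeasurable u volume :=
  h.locallyIntegrable.aestronglyMeasurable

/-- The `L^p` norm of a distribution that is a function is the `L^p` norm of the function. -/
lemma IsFun.normLp_eq {f : 𝓢'(Space N, ℂ)} {u : Space N → ℂ} (h : IsFun f u) (p : ℝ≥0∞) :
    normLp p f = eLpNorm u p volume := by
  refine le_antisymm ?_ ?_
  · by_cases hu : eLpNorm u p volume < ∞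
    · exact iInf_le_of_le u (iInf_le_of_le ⟨h.aestronglyMeasurable, hu⟩ (iInf_le_of_le h le_rfl))
    · simp only [not_lt, top_le_iff] at hu
      rw [hu]; exact le_top
  · refine le_iInf fun v => le_iInf fun _ => le_iInf fun hv => ?_
    rw [eLpNorm_congr_ae (h.ae_eq hv)]

lemma exists_isFun_of_normLp_lt_top {f : 𝓢'(Space N, ℂ)} {p : ℝ≥0∞} (h : normLp p f < ∞) :
    ∃ u, MemLp u p volume ∧ IsFun f u := by
  simp only [normLp, iInf_lt_iff] at h
  obtain ⟨u, hu, hf, -⟩ := h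
  exact ⟨u, hu, hf⟩

lemma isFun_toTemperedDistribution {p : ℝ≥0∞} [Fact (1 ≤ p)]
    (U : Lp ℂ p (volume : Measure (Space N))) :
    IsFun (Lp.toTemperedDistribution U) U := by
  intro η
  refine ⟨?_, by simp⟩
  have := ENNReal.HolderConjugate.inv_one_sub_inv' (Fact.out : 1 ≤ p)
  exact (Lp.memLp U).integrable_mul (η.memLp (1 - p⁻¹)⁻¹) |>.congr (by
    filter_upwards with x; simp [mul_comm])

lemma exists_isFun_of_memLp {u : Space N → ℂ} {p : ℝ≥0∞} (hp : 1 ≤ p) (hu : MemLp u p volume) :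
    ∃ f : 𝓢'(Space N, ℂ), IsFun f u := by
  have : Fact (1 ≤ p) := ⟨hp⟩
  exact ⟨_, (isFun_toTemperedDistribution (hu.toLp u)).congr_ae hu.coeFn_toLp⟩

/-- The function representing a distribution, if there is one. -/
def toFun (f : 𝓢'(Space N, ℂ)) : Space N → ℂ :=
  open Classical in if h : ∃ u, IsFun f u then h.choose else 0

/-- The distribution given by integration against a function, if this makes sense. -/
def ofFun (u : Space N → ℂ) : 𝓢'(Space N, ℂ) :=
  open Classical in if h : ∃ f, IsFun f u then h.choose else 0

lemma isFun_toFun {f : 𝓢'(Space N, ℂ)} (h : ∃ u, IsFun f u) : IsFun f (toFun f) := by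
  rw [toFun, dif_pos h]; exact h.choose_spec

lemma isFun_toFun_of_normLp {f : 𝓢'(Space N, ℂ)} {p : ℝ≥0∞} (h : normLp p f < ∞) :
    IsFun f (toFun f) := by
  obtain ⟨u, -, hu⟩ := exists_isFun_of_normLp_lt_top h
  exact isFun_toFun ⟨u, hu⟩

lemma memLp_toFun {f : 𝓢'(Space N, ℂ)} {p : ℝ≥0∞} (h : normLp p f < ∞) :
    MemLp (toFun f) p volume :=
  ⟨(isFun_toFun_of_normLp h).aestronglyMeasurable, by
    rwa [← (isFun_toFun_of_normLp h).normLp_eq p]⟩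

lemma isFun_ofFun {u : Space N → ℂ} {p : ℝ≥0∞} (hp : 1 ≤ p) (hu : MemLp u p volume) :
    IsFun (ofFun u) u := by
  have h := exists_isFun_of_memLp hp hu
  rw [ofFun, dif_pos h]; exact h.choose_spec

/-! ### The `L^p` norm of a distribution -/

lemma normLp_zero (p : ℝ≥0∞) : normLp p (0 : 𝓢'(Space N, ℂ)) = 0 := by
  rw [IsFun.zero.normLp_eq]; simp

lemma normLp_neg (p : ℝ≥0∞) (f : 𝓢'(Space N, ℂ)) : normLp p (-f) = normLp p f := by
  have key : ∀ f : 𝓢'(Space N, ℂ), normLp p (-f) ≤ normLp p f := by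
    intro f
    rcases eq_top_or_lt_top (normLp p f) with h | h
    · rw [h]; exact le_top
    · have hu := isFun_toFun_of_normLp h
      rw [hu.normLp_eq, hu.neg.normLp_eq, eLpNorm_neg]
  exact le_antisymm (key f) (by simpa using key (-f))

lemma normLp_add_le {p : ℝ≥0∞} (hp : 1 ≤ p) (f g : 𝓢'(Space N, ℂ)) :
    normLp p (f + g) ≤ normLp p f + normLp p g := by
  rcases eq_top_or_lt_top (normLp p f) with h | h
  · simp [h]
  rcases eq_top_or_lt_top (normLp p g) with h' | h'
  · simp [h']
  have hu := isFun_toFun_of_normLp h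
  have hv := isFun_toFun_of_normLp h'
  rw [hu.normLp_eq, hv.normLp_eq, (hu.add hv).normLp_eq]
  exact eLpNorm_add_le hu.aestronglyMeasurable hv.aestronglyMeasurable hp

lemma normLp_sub_le {p : ℝ≥0∞} (hp : 1 ≤ p) (f g : 𝓢'(Space N, ℂ)) :
    normLp p (f - g) ≤ normLp p f + normLp p g := by
  simpa only [sub_eq_add_neg, normLp_neg] using normLp_add_le hp f (-g)

/-- The `L^p` norm is countably subadditive along series that converge weakly: absolute convergence
in `L^p` identifies the weak limit. -/
lemma normLp_le_tsum {p : ℝ≥0∞} (hp : 1 ≤ p) {F : 𝓢'(Space N, ℂ)} {G : ℕ → 𝓢'(Space N, ℂ)}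
    (h : ∀ η, Filter.Tendsto (fun n => ∑ i ∈ Finset.range n, G i η) Filter.atTop (nhds (F η))) :
    normLp p F ≤ ∑' n, normLp p (G n) := by
  rcases eq_top_or_lt_top (∑' n, normLp p (G n)) with ht | ht
  · rw [ht]; exact le_top
  have : Fact (1 ≤ p) := ⟨hp⟩
  have hlt : ∀ n, normLp p (G n) < ∞ := fun n => (ENNReal.le_tsum n).trans_lt ht
  let U : ℕ → Lp ℂ p (volume : Measure (Space N)) := fun n => (memLp_toFun (hlt n)).toLp _
  have hU : ∀ n, IsFun (G n) (U n) := fun n =>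
    (isFun_toFun_of_normLp (hlt n)).congr_ae (MemLp.coeFn_toLp _).symm
  have hUn : ∀ n, ‖U n‖ₑ = normLp p (G n) := fun n => by
    rw [(hU n).normLp_eq, Lp.enorm_def]
  have hsum : Summable U := by
    refine Summable.of_enorm ?_
    simpa only [hUn] using ht.ne
  have hUG : ∀ n, Lp.toTemperedDistribution (U n) = G n := fun n =>
    (isFun_toTemperedDistribution (U n)).eq (hU n)
  have hF : Lp.toTemperedDistribution (∑' n, U n) = F := by
    ext η
    have h1 := (hsum.hasSum.mapL (Lp.toTemperedDistributionCLM ℂ volume p)).tendsto_sum_nat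
    have h2 := ((PointwiseConvergenceCLM.evalCLM (RingHom.id ℂ) ℂ η).continuous.tendsto _).comp h1
    refine tendsto_nhds_unique ?_ (h η)
    refine h2.congr fun n => ?_
    simp only [Function.comp_apply, map_sum, Lp.toTemperedDistributionCLM_apply, hUG]
    rfl
  rw [← hF, (isFun_toTemperedDistribution _).normLp_eq, ← Lp.enorm_def]
  simp only [← hUn]
  exact enorm_tsum_le_tsum_enorm

end

/-! ### The dyadic partition of unity -/

section

variable {N : ℕ}

namespace Cutoff

variable (φ : Cutoff N)

/-- The cut-off also vanishes on the boundary of the annulus, by continuity. -/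
lemma toSchwartz_eq_zero {ξ : Space N} (h : ‖ξ‖ ≤ 3 / 4 ∨ 8 / 3 ≤ ‖ξ‖) : φ.toSchwartz ξ = 0 := by
  have hout : ∀ ξ : Space N, (‖ξ‖ < 3 / 4 ∨ 8 / 3 < ‖ξ‖) → φ.toSchwartz ξ = 0 := by
    intro ξ h
    refine image_eq_zero_of_notMem_tsupport ?_
    rw [φ.tsupport_eq]
    simp only [Set.mem_ofPred_eq, not_and_or, not_le]
    exact h
  by_cases h1 : ‖ξ‖ < 3 / 4 ∨ 8 / 3 < ‖ξ‖
  · exact hout ξ h1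
  -- on the two bounding spheres the value is a limit of zeros along the ray through `ξ`
  have hpos : 0 < ‖ξ‖ := by
    rcases h with h | h <;> by_contra hc <;> push Not at h1 hc <;> linarith [h1.1]
  have hc : Continuous fun t : ℝ => φ.toSchwartz (t • ξ) :=
    φ.toSchwartz.continuous.comp (continuous_id.smul continuous_const)
  have h1' : φ.toSchwartz ((1 : ℝ) • ξ) = 0 := by
    rcases h with h | h
    · have hcl : IsClosed {t : ℝ | φ.toSchwartz (t • ξ) = 0} := isClosed_eq hc continuous_const
      have hsub : Set.Ioo (0 : ℝ) 1 ⊆ {t : ℝ | φ.toSchwartz (t • ξ) = 0} := by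
        intro t ht
        refine hout _ (Or.inl ?_)
        rw [norm_smul, Real.norm_of_nonneg ht.1.le]
        nlinarith [ht.2]
      have := hcl.closure_subset_iff.2 hsub
      rw [closure_Ioo zero_ne_one] at this
      exact this ⟨zero_le_one, le_rfl⟩
    · have hcl : IsClosed {t : ℝ | φ.toSchwartz (t • ξ) = 0} := isClosed_eq hc continuous_const
      have hsub : Set.Ioo (1 : ℝ) 2 ⊆ {t : ℝ | φ.toSchwartz (t • ξ) = 0} := by
        intro t ht
        refine hout _ (Or.inr ?_)
        rw [norm_smul, Real.norm_of_nonneg (by linarith [ht.1])]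
        nlinarith [ht.1]
      have := hcl.closure_subset_iff.2 hsub
      rw [closure_Ioo (by norm_num)] at this
      exact this ⟨le_rfl, by norm_num⟩
  simpa using h1'

lemma toSchwartz_nonneg (ξ : Space N) : 0 ≤ φ.toSchwartz ξ := by
  by_cases h : ‖ξ‖ ≤ 3 / 4 ∨ 8 / 3 ≤ ‖ξ‖
  · exact (φ.toSchwartz_eq_zero h).ge
  · push Not at h
    exact (φ.pos ξ h.1 h.2).le

lemma norm_zpow_smul (k : ℤ) (ξ : Space N) : ‖(2 : ℝ) ^ k • ξ‖ = 2 ^ k * ‖ξ‖ := by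
  rw [norm_smul, Real.norm_of_nonneg (by positivity)]

lemma dilate_nonneg (q : ℤ) (ξ : Space N) : 0 ≤ φ.dilate q ξ := φ.toSchwartz_nonneg _

lemma dilate_eq_zero_of_le {q : ℤ} {ξ : Space N} (h : ‖ξ‖ ≤ 3 / 4 * 2 ^ q) :
    φ.dilate q ξ = 0 := by
  refine φ.toSchwartz_eq_zero (Or.inl ?_)
  rw [norm_zpow_smul, zpow_neg, inv_mul_le_iff₀ (by positivity)]
  linarith

lemma dilate_eq_zero_of_ge {q : ℤ} {ξ : Space N} (h : 8 / 3 * 2 ^ q ≤ ‖ξ‖) :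
    φ.dilate q ξ = 0 := by
  refine φ.toSchwartz_eq_zero (Or.inr ?_)
  rw [norm_zpow_smul, zpow_neg, le_inv_mul_iff₀ (by positivity)]
  linarith

lemma dilate_smul (k q : ℤ) (ξ : Space N) :
    φ.dilate k ((2 : ℝ) ^ (-q) • ξ) = φ.dilate (k + q) ξ := by
  simp only [dilate, smul_smul, ← zpow_add₀ (two_ne_zero' ℝ)]
  congr 3; ring

/-- Away from the origin, only finitely many dilates are nonzero, locally uniformly. -/
lemma exists_dilate_eq_zero {ξ₀ : Space N} (h : ξ₀ ≠ 0) :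
    ∃ s : Finset ℤ, ∀ᶠ ξ in nhds ξ₀, ∀ k ∉ s, φ.dilate k ξ = 0 := by
  have hpos : 0 < ‖ξ₀‖ := norm_pos_iff.2 h
  obtain ⟨M, hM⟩ := pow_unbounded_of_one_lt (2 * ‖ξ₀‖ * (4 / 3)) (one_lt_two : (1 : ℝ) < 2)
  obtain ⟨M', hM'⟩ := pow_unbounded_of_one_lt (8 / 3 / (‖ξ₀‖ / 2)) (one_lt_two : (1 : ℝ) < 2)
  refine ⟨Finset.Icc (-M') M, ?_⟩
  have h1 : ∀ᶠ ξ in nhds ξ₀, ‖ξ‖ < 2 * ‖ξ₀‖ :=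
    continuous_norm.continuousAt.eventually (gt_mem_nhds (by linarith))
  have h2 : ∀ᶠ ξ in nhds ξ₀, ‖ξ₀‖ / 2 < ‖ξ‖ :=
    continuous_norm.continuousAt.eventually (lt_mem_nhds (by linarith))
  filter_upwards [h1, h2] with ξ h1 h2 k hk
  simp only [Finset.mem_Icc, not_and_or, not_le] at hk
  rcases hk with hk | hk
  · refine φ.dilate_eq_zero_of_ge (le_trans ?_ h2.le)
    have : (2 : ℝ) ^ k ≤ 2 ^ (-(M' : ℤ)) := zpow_le_zpow_right₀ one_le_two hk.le
    rw [zpow_neg, zpow_natCast] at this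
    rw [div_lt_iff₀ (by positivity)] at hM'
    calc 8 / 3 * (2 : ℝ) ^ k ≤ 8 / 3 * (2 ^ M')⁻¹ := by gcongr
      _ ≤ ‖ξ₀‖ / 2 := by
        rw [← div_eq_mul_inv, div_le_iff₀ (by positivity)]; linarith
  · refine φ.dilate_eq_zero_of_le ?_
    have : (2 : ℝ) ^ (M : ℤ) ≤ 2 ^ k := zpow_le_zpow_right₀ one_le_two hk.le
    rw [zpow_natCast] at this
    linarith

lemma dilate_zero (k : ℤ) : φ.dilate k (0 : Space N) = 0 :=
  φ.dilate_eq_zero_of_le (by rw [norm_zero]; positivity)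

lemma finite_support_dilate (ξ : Space N) : (Function.support fun k => φ.dilate k ξ).Finite := by
  rcases eq_or_ne ξ 0 with rfl | h
  · simp [dilate_zero]
  · obtain ⟨s, hs⟩ := φ.exists_dilate_eq_zero h
    refine s.finite_toSet.subset fun k hk => ?_
    by_contra hks
    exact hk (hs.self_of_nhds k hks)

lemma summable_dilate (ξ : Space N) : Summable fun k => φ.dilate k ξ :=
  summable_of_hasFiniteSupport (φ.finite_support_dilate ξ)

lemma tsum_dilate_pos {ξ : Space N} (h : ξ ≠ 0) : 0 < ∑' k, φ.dilate k ξ := by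
  have hpos : 0 < ‖ξ‖ := norm_pos_iff.2 h
  obtain ⟨n, hn1, hn2⟩ := exists_mem_Ico_zpow hpos one_lt_two
  -- `2^{-n}‖ξ‖` lies in `[1, 2)`, inside the annulus where the cutoff is positive
  refine (φ.summable_dilate ξ).tsum_pos (φ.dilate_nonneg · ξ) n (φ.pos _ ?_ ?_) <;>
    rw [norm_zpow_smul, zpow_neg]
  · rw [lt_inv_mul_iff₀ (by positivity)]
    have : (0 : ℝ) < 2 ^ n := by positivity
    linarith
  · rw [inv_mul_lt_iff₀ (by positivity)]
    rw [zpow_add_one₀ two_ne_zero] at hn2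
    have : (0 : ℝ) < 2 ^ n := by positivity
    linarith

lemma contDiffAt_tsum_dilate {ξ₀ : Space N} (h : ξ₀ ≠ 0) {ι : Type*} {i : ι → ℤ}
    (hi : Function.Injective i) :
    ContDiffAt ℝ ((⊤ : ℕ∞) : WithTop ℕ∞) (fun ξ => ∑' k, φ.dilate (i k) ξ) ξ₀ := by
  obtain ⟨s, hs⟩ := φ.exists_dilate_eq_zero h
  have hfin : ∀ᶠ ξ in nhds ξ₀, ∑' k, φ.dilate (i k) ξ =
      ∑ k ∈ s.preimage i hi.injOn, φ.dilate (i k) ξ := by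
    filter_upwards [hs] with ξ hξ
    exact tsum_eq_sum fun k hk => hξ _ (by simpa using hk)
  refine ContDiffAt.congr_of_eventuallyEq ?_ hfin
  refine ContDiffAt.sum fun k _ => ?_
  exact (φ.toSchwartz.smooth ⊤).contDiffAt.comp _ (contDiff_const_smul _).contDiffAt

lemma annulusSymbol_smul (k q : ℤ) (ξ : Space N) :
    φ.annulusSymbol k ((2 : ℝ) ^ (-q) • ξ) = φ.annulusSymbol (k + q) ξ := by
  simp only [annulusSymbol, dilate_smul]
  congr 1
  exact (Equiv.addRight q).tsum_eq fun k => φ.dilate k ξ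

lemma summable_annulusSymbol (ξ : Space N) : Summable fun k : ℕ => φ.annulusSymbol k ξ :=
  ((φ.summable_dilate ξ).comp_injective Nat.cast_injective).div_const _

lemma ballSymbol_eq (ξ : Space N) :
    φ.ballSymbol ξ = 1 - (∑' k : ℕ, φ.dilate k ξ) / ∑' k : ℤ, φ.dilate k ξ := by
  rw [ballSymbol]; congr 1
  exact tsum_div_const

lemma ballSymbol_eq_one {ξ : Space N} (h : ‖ξ‖ ≤ 3 / 4) : φ.ballSymbol ξ = 1 := by
  have : ∀ k : ℕ, φ.dilate k ξ = 0 := fun k => by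
    refine φ.dilate_eq_zero_of_le (h.trans ?_)
    have : (1 : ℝ) ≤ 2 ^ (k : ℤ) := one_le_zpow₀ one_le_two (by positivity)
    linarith
  rw [ballSymbol_eq]; simp [this]

lemma ballSymbol_eq_zero {ξ : Space N} (h : 4 / 3 ≤ ‖ξ‖) : φ.ballSymbol ξ = 0 := by
  have hne : ξ ≠ 0 := by rintro rfl; rw [norm_zero] at h; linarith
  have hz : ∀ k : ℤ, k < 0 → φ.dilate k ξ = 0 := fun k hk => by
    refine φ.dilate_eq_zero_of_ge (le_trans ?_ h)
    have : (2 : ℝ) ^ k ≤ 2 ^ (-1 : ℤ) := zpow_le_zpow_right₀ one_le_two (by omega)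
    norm_num at this
    linarith
  have : ∑' k : ℕ, φ.dilate k ξ = ∑' k : ℤ, φ.dilate k ξ := by
    refine Function.Injective.tsum_eq (f := fun k : ℤ => φ.dilate k ξ) Nat.cast_injective ?_
    intro k hk
    by_contra hk'
    refine hk (hz k ?_)
    by_contra hk0
    exact hk' ⟨k.toNat, by simp [not_lt.1 hk0]⟩
  rw [ballSymbol_eq, this, div_self (φ.tsum_dilate_pos hne).ne', sub_self]

lemma contDiff_ballSymbol : ContDiff ℝ ((⊤ : ℕ∞) : WithTop ℕ∞) φ.ballSymbol := by
  rw [contDiff_iff_contDiffAt]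
  intro ξ₀
  rcases eq_or_ne ξ₀ 0 with rfl | h
  · refine (contDiffAt_const (c := (1 : ℝ))).congr_of_eventuallyEq ?_
    filter_upwards [Metric.ball_mem_nhds (0 : Space N) (by norm_num : (0 : ℝ) < 3 / 4)] with ξ hξ
    exact φ.ballSymbol_eq_one (le_of_lt (by simpa using hξ))
  · have : φ.ballSymbol = fun ξ =>
        1 - (∑' k : ℕ, φ.dilate k ξ) / ∑' k : ℤ, φ.dilate k ξ := funext φ.ballSymbol_eq
    rw [this]
    exact contDiffAt_const.sub ((φ.contDiffAt_tsum_dilate h Nat.cast_injective).div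
      (φ.contDiffAt_tsum_dilate h Function.injective_id) (φ.tsum_dilate_pos h).ne')

/-- Consecutive dilates of the ball symbol differ by an annulus symbol. -/
lemma annulusSymbol_eq_sub (q : ℤ) (ξ : Space N) :
    φ.annulusSymbol q ξ =
      φ.ballSymbol ((2 : ℝ) ^ (-(q + 1)) • ξ) - φ.ballSymbol ((2 : ℝ) ^ (-q) • ξ) := by
  have h1 := (φ.summable_annulusSymbol ((2 : ℝ) ^ (-q) • ξ)).tsum_eq_zero_add
  simp only [ballSymbol, annulusSymbol_smul] at h1 ⊢
  have h2 : ∀ k : ℕ, ((k : ℤ) + (q + 1)) = ((k + 1 : ℕ) : ℤ) + q := fun k => by push_cast; ring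
  simp only [h2]
  rw [h1]
  simp

lemma hasCompactSupport_ballSymbol : HasCompactSupport φ.ballSymbol :=
  HasCompactSupport.of_support_subset_isCompact (isCompact_closedBall (0 : Space N) (4 / 3)) <| by
    intro ξ hξ
    simp only [Metric.mem_closedBall, dist_zero_right]
    by_contra h
    exact hξ (φ.ballSymbol_eq_zero (not_le.1 h).le)

/-- The symbol of the low-frequency cut-off at frequency `2^m`, which sums the blocks `Δ_q` with
`q < m`; it vanishes for negative `m`. -/
def lowSymbol (m : ℤ) : 𝓢(Space N, ℂ) :=
  if m < 0 then 0 else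
    HasCompactSupport.toSchwartzMap
      (f := fun ξ => (φ.ballSymbol ((2 : ℝ) ^ (-m) • ξ) : ℂ))
      ((φ.hasCompactSupport_ballSymbol.comp_homeomorph
        (Homeomorph.smulOfNeZero ((2 : ℝ) ^ (-m)) (by positivity))).comp_left Complex.ofReal_zero)
      (Complex.ofRealCLM.contDiff.comp (φ.contDiff_ballSymbol.comp (contDiff_const_smul _)))

lemma lowSymbol_of_neg {m : ℤ} (h : m < 0) : φ.lowSymbol m = 0 := by
  rw [lowSymbol, if_pos h]

lemma lowSymbol_apply {m : ℤ} (h : 0 ≤ m) (ξ : Space N) :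
    φ.lowSymbol m ξ = (φ.ballSymbol ((2 : ℝ) ^ (-m) • ξ) : ℂ) := by
  rw [lowSymbol, if_neg h.not_gt]; rfl

lemma symbol_eq (q : ℤ) : φ.symbol q = ⇑(φ.lowSymbol (q + 1) - φ.lowSymbol q) := by
  funext ξ
  simp only [symbol, _root_.sub_apply]
  split_ifs with h1 h2
  · simp [φ.lowSymbol_of_neg (show q + 1 < 0 by omega), φ.lowSymbol_of_neg (show q < 0 by omega)]
  · subst h2
    rw [φ.lowSymbol_of_neg (show (-1 : ℤ) < 0 by omega), φ.lowSymbol_apply (by omega)]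
    simp
  · rw [φ.lowSymbol_apply (by omega), φ.lowSymbol_apply (by omega), annulusSymbol_eq_sub]
    push_cast; rfl

lemma lowSymbol_eq_one {m : ℤ} (hm : 0 ≤ m) {ξ : Space N} (h : ‖ξ‖ ≤ 3 / 4 * 2 ^ m) :
    φ.lowSymbol m ξ = 1 := by
  rw [φ.lowSymbol_apply hm, φ.ballSymbol_eq_one, Complex.ofReal_one]
  rw [norm_zpow_smul, zpow_neg, inv_mul_le_iff₀ (by positivity)]
  linarith

lemma lowSymbol_eq_zero {m : ℤ} {ξ : Space N} (h : 4 / 3 * 2 ^ m ≤ ‖ξ‖) :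
    φ.lowSymbol m ξ = 0 := by
  rcases lt_or_ge m 0 with hm | hm
  · rw [φ.lowSymbol_of_neg hm]; rfl
  rw [φ.lowSymbol_apply hm, φ.ballSymbol_eq_zero, Complex.ofReal_zero]
  rw [norm_zpow_smul, zpow_neg, le_inv_mul_iff₀ (by positivity)]
  linarith

end Cutoff

end

/-! ### Integrals of translates of a Schwartz function -/

section

variable {N : ℕ}

open LineDeriv FourierTransform

/-- The translate `x ↦ κ (x - a)`. -/
def translate (a : Space N) (κ : 𝓢(Space N, ℂ)) : 𝓢(Space N, ℂ) := compSubConstCLM ℂ a κ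

lemma translate_apply (a : Space N) (κ : 𝓢(Space N, ℂ)) (x : Space N) :
    translate a κ x = κ (x - a) := rfl

lemma iteratedFDeriv_translate (a : Space N) (κ : 𝓢(Space N, ℂ)) (n : ℕ) (x : Space N) :
    iteratedFDeriv ℝ n (translate a κ) x = iteratedFDeriv ℝ n κ (x - a) :=
  iteratedFDeriv_comp_sub n a x

lemma exists_one_add_pow_mul_le (κ : 𝓢(Space N, ℂ)) (k n : ℕ) :
    ∃ B, 0 ≤ B ∧ ∀ x, (1 + ‖x‖) ^ k * ‖iteratedFDeriv ℝ n κ x‖ ≤ B :=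
  ⟨_, by positivity, fun x => one_add_le_sup_seminorm_apply (𝕜 := ℂ) (m := (k, n)) le_rfl le_rfl κ x⟩

/-- The seminorms of a translate grow polynomially. -/
lemma exists_pow_mul_translate_le (κ : 𝓢(Space N, ℂ)) (k n : ℕ) :
    ∃ B, 0 ≤ B ∧ ∀ a x, ‖x‖ ^ k * ‖iteratedFDeriv ℝ n (translate a κ) x‖ ≤ B * (1 + ‖a‖) ^ k := by
  obtain ⟨B, hB, h⟩ := exists_one_add_pow_mul_le κ k n
  refine ⟨B, hB, fun a x => ?_⟩
  rw [iteratedFDeriv_translate]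
  have h1 : ‖x‖ ≤ (1 + ‖x - a‖) * (1 + ‖a‖) := by
    have := norm_add_le (x - a) a
    rw [sub_add_cancel] at this
    nlinarith [norm_nonneg a, norm_nonneg (x - a)]
  calc ‖x‖ ^ k * ‖iteratedFDeriv ℝ n κ (x - a)‖
      ≤ ((1 + ‖x - a‖) * (1 + ‖a‖)) ^ k * ‖iteratedFDeriv ℝ n κ (x - a)‖ := by gcongr
    _ = ((1 + ‖x - a‖) ^ k * ‖iteratedFDeriv ℝ n κ (x - a)‖) * (1 + ‖a‖) ^ k := by
        rw [mul_pow]; ring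
    _ ≤ _ := by gcongr; exact h _

/-- Translation is strongly continuous on Schwartz space. -/
lemma continuous_translate (κ : 𝓢(Space N, ℂ)) : Continuous fun a => translate a κ := by
  have h0 : Filter.Tendsto (fun a => translate a κ) (nhds 0) (nhds κ) := by
    rw [(schwartz_withSeminorms ℂ (Space N) ℂ).tendsto_nhds]
    rintro ⟨k, n⟩ ε hε
    obtain ⟨B, hB, h⟩ := exists_one_add_pow_mul_le κ k (n + 1)
    have key : ∀ a : Space N, ‖a‖ ≤ 1 →
        SchwartzMap.seminorm ℂ k n (translate a κ - κ) ≤ 2 ^ k * B * ‖a‖ := by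
      intro a ha
      refine seminorm_le_bound ℂ k n _ (by positivity) fun x => ?_
      have hD : iteratedFDeriv ℝ n (⇑(translate a κ - κ)) x =
          iteratedFDeriv ℝ n κ (x - a) - iteratedFDeriv ℝ n κ x := by
        rw [← iteratedFDeriv_translate]
        exact iteratedFDeriv_sub_apply ((translate a κ).contDiffAt n) (κ.contDiffAt n)
      have hdiff : Differentiable ℝ (iteratedFDeriv ℝ n κ) :=
        (κ.smooth (n + 1)).differentiable_iteratedFDeriv (by exact_mod_cast Nat.lt_succ_self n)
      have hmv : ‖iteratedFDeriv ℝ n κ (x - a) - iteratedFDeriv ℝ n κ x‖ ≤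
          (2 ^ k * B / (1 + ‖x‖) ^ k) * ‖(x - a) - x‖ := by
        refine (convex_closedBall x 1).norm_image_sub_le_of_norm_fderiv_le (𝕜 := ℝ)
          (fun z _ => hdiff z) (fun z hz => ?_) (by simp) (by simpa using ha)
        rw [norm_fderiv_iteratedFDeriv, le_div_iff₀ (by positivity)]
        have hz' : 1 + ‖x‖ ≤ 2 * (1 + ‖z‖) := by
          have h1 := norm_sub_norm_le x z
          rw [← dist_eq_norm, dist_comm] at h1
          have h2 : dist z x ≤ 1 := hz
          linarith [norm_nonneg z]
        calc ‖iteratedFDeriv ℝ (n + 1) κ z‖ * (1 + ‖x‖) ^ k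
            ≤ ‖iteratedFDeriv ℝ (n + 1) κ z‖ * (2 * (1 + ‖z‖)) ^ k := by gcongr
          _ = 2 ^ k * ((1 + ‖z‖) ^ k * ‖iteratedFDeriv ℝ (n + 1) κ z‖) := by rw [mul_pow]; ring
          _ ≤ 2 ^ k * B := by gcongr; exact h z
      rw [hD]
      calc ‖x‖ ^ k * ‖iteratedFDeriv ℝ n κ (x - a) - iteratedFDeriv ℝ n κ x‖
          ≤ (1 + ‖x‖) ^ k * ((2 ^ k * B / (1 + ‖x‖) ^ k) * ‖(x - a) - x‖) := by
            gcongr; linarith [norm_nonneg x]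
        _ = 2 ^ k * B * ‖a‖ := by
            have : ‖(x - a) - x‖ = ‖a‖ := by simp
            rw [this]; field_simp
    have hlim : Filter.Tendsto (fun a : Space N => 2 ^ k * B * ‖a‖) (nhds 0) (nhds 0) := by
      have : Continuous fun a : Space N => 2 ^ k * B * ‖a‖ := by fun_prop
      simpa using this.tendsto 0
    filter_upwards [hlim.eventually (gt_mem_nhds hε), Metric.closedBall_mem_nhds (0 : Space N)
      zero_lt_one] with a ha ha'
    exact (key a (by simpa using ha')).trans_lt ha
  rw [continuous_iff_continuousAt]
  intro b
  have h1 : ∀ a, translate a κ = translate b (translate (a - b) κ) := by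
    intro a; ext x
    simp only [translate_apply]; congr 1; abel
  have h2 : Filter.Tendsto (fun a => translate (a - b) κ) (nhds b) (nhds κ) := by
    refine h0.comp ?_
    have : Continuous fun a : Space N => a - b := by fun_prop
    simpa using this.tendsto b
  have h3 := ((compSubConstCLM ℂ b : 𝓢(Space N, ℂ) →L[ℂ] 𝓢(Space N, ℂ)).continuous.tendsto κ).comp h2
  exact h3.congr fun a => (h1 a).symm

/-- The space in which `n`-th derivatives take values, with the operator norm. It is a type synonym in
order to fix the normed structure once and for all, over `ℝ` and over `ℂ`. -/
def Jet (N n : ℕ) : Type := Space N [×n]→L[ℝ] ℂ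

instance (n : ℕ) : NormedAddCommGroup (Jet N n) :=
  inferInstanceAs (NormedAddCommGroup (Space N [×n]→L[ℝ] ℂ))

instance (n : ℕ) : NormedSpace ℂ (Jet N n) :=
  inferInstanceAs (NormedSpace ℂ (Space N [×n]→L[ℝ] ℂ))

instance (n : ℕ) : NormedSpace ℝ (Jet N n) :=
  inferInstanceAs (NormedSpace ℝ (Space N [×n]→L[ℝ] ℂ))

instance (n : ℕ) : CompleteSpace (Jet N n) :=
  inferInstanceAs (CompleteSpace (Space N [×n]→L[ℝ] ℂ))

/-- Evaluation of an `n`-th derivative at `n` vectors. -/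
def Jet.eval {n : ℕ} (m : Fin n → Space N) : Jet N n →L[ℝ] ℂ :=
  ContinuousMultilinearMap.apply ℝ (fun _ : Fin n => Space N) ℂ m

lemma Jet.ext {n : ℕ} {A B : Jet N n} (h : ∀ m, Jet.eval m A = Jet.eval m B) : A = B :=
  ContinuousMultilinearMap.ext h

/-- The `n`-th derivative of a Schwartz function at a point. -/
def jet (n : ℕ) (η : 𝓢(Space N, ℂ)) (x : Space N) : Jet N n := iteratedFDeriv ℝ n η x

lemma norm_jet (n : ℕ) (η : 𝓢(Space N, ℂ)) (x : Space N) :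
    ‖jet n η x‖ = ‖iteratedFDeriv ℝ n η x‖ := rfl

lemma eval_jet {n : ℕ} (m : Fin n → Space N) (η : 𝓢(Space N, ℂ)) (x : Space N) :
    Jet.eval m (jet n η x) = (∂^{m} η) x :=
  (iteratedLineDerivOp_eq_iteratedFDeriv).symm

lemma Jet.eval_smul {n : ℕ} (m : Fin n → Space N) (c : ℂ) (A : Jet N n) :
    Jet.eval m (c • A) = c * Jet.eval m A := rfl

lemma continuous_jet (n : ℕ) (η : 𝓢(Space N, ℂ)) : Continuous (jet n η) :=
  (η.smooth n).continuous_iteratedFDeriv le_rfl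

lemma jet_add (n : ℕ) (η₁ η₂ : 𝓢(Space N, ℂ)) (x : Space N) :
    jet n (η₁ + η₂) x = jet n η₁ x + jet n η₂ x :=
  iteratedFDeriv_add_apply (η₁.contDiffAt n) (η₂.contDiffAt n)

lemma jet_smul (n : ℕ) (c : ℂ) (η : 𝓢(Space N, ℂ)) (x : Space N) :
    jet n (c • η) x = c • jet n η x :=
  iteratedFDeriv_const_smul_apply (η.contDiffAt n)

/-- The weighted derivative `x ↦ ‖x‖ ^ k • D^n η (x)` as a bounded continuous function. -/
def weightedDeriv (k n : ℕ) :
    𝓢(Space N, ℂ) →L[ℂ] BoundedContinuousFunction (Space N) (Jet N n) :=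
  mkCLMtoNormedSpace (fun η => BoundedContinuousFunction.ofNormedAddCommGroup
      (fun x => ((‖x‖ ^ k : ℝ) : ℂ) • jet n η x)
      ((Complex.continuous_ofReal.comp (continuous_norm.pow k)).smul (continuous_jet n η))
      (SchwartzMap.seminorm ℂ k n η)
      (fun x => by
        rw [norm_smul, Complex.norm_real, norm_pow, norm_norm, norm_jet]
        exact le_seminorm ℂ k n η x))
    (fun η₁ η₂ => by
      ext1 x
      simp only [BoundedContinuousFunction.coe_ofNormedAddCommGroup,
        BoundedContinuousFunction.coe_add, Pi.add_apply, ← smul_add, jet_add])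
    (fun c η => by
      ext1 x
      simp only [BoundedContinuousFunction.coe_ofNormedAddCommGroup,
        BoundedContinuousFunction.coe_smul, RingHom.id_apply, jet_smul]
      rw [smul_comm])
    ⟨{(k, n)}, 1, zero_le_one, fun η => by
      simp only [Finset.sup_singleton, one_mul, schwartzSeminormFamily_apply]
      exact BoundedContinuousFunction.norm_ofNormedAddCommGroup_le _ (apply_nonneg _ _) _⟩

lemma weightedDeriv_apply (k n : ℕ) (η : 𝓢(Space N, ℂ)) (x : Space N) :
    weightedDeriv k n η x = ((‖x‖ ^ k : ℝ) : ℂ) • jet n η x := rfl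

lemma norm_weightedDeriv_apply (k n : ℕ) (η : 𝓢(Space N, ℂ)) (x : Space N) :
    ‖weightedDeriv k n η x‖ = ‖x‖ ^ k * ‖iteratedFDeriv ℝ n η x‖ := by
  rw [weightedDeriv_apply, norm_smul, Complex.norm_real, norm_pow, norm_norm, norm_jet]

lemma seminorm_le_norm_weightedDeriv (k n : ℕ) (η : 𝓢(Space N, ℂ)) :
    SchwartzMap.seminorm ℂ k n η ≤ ‖weightedDeriv k n η‖ := by
  have h0 : 0 ≤ ‖weightedDeriv k n η‖ := norm_nonneg (weightedDeriv k n η)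
  refine seminorm_le_bound ℂ k n η h0 fun x => ?_
  rw [← norm_weightedDeriv_apply]
  exact (weightedDeriv k n η).norm_coe_le_norm x

/-- A linear functional dominated by the norm of a linear map into a normed space factors through
that map, by the Hahn-Banach theorem. -/
lemma exists_factor_of_norm_le {V Y : Type*} [AddCommGroup V] [Module ℂ V] [NormedAddCommGroup Y]
    [NormedSpace ℂ Y] (ι : V →ₗ[ℂ] Y) (F : V →ₗ[ℂ] ℂ) (C : ℝ) (hb : ∀ η, ‖F η‖ ≤ C * ‖ι η‖) :
    ∃ g : Y →L[ℂ] ℂ, ∀ η, F η = g (ι η) := by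
  have hker : ι.ker ≤ F.ker := by
    intro η hη
    have h0 := hb η
    rw [LinearMap.mem_ker.1 hη, norm_zero, mul_zero] at h0
    exact norm_le_zero_iff.1 h0
  let f : ι.range →ₗ[ℂ] ℂ := (ι.ker.liftQ F hker) ∘ₗ ι.quotKerEquivRange.symm.toLinearMap
  have hf : ∀ η, f ⟨ι η, LinearMap.mem_range_self ι η⟩ = F η := by
    intro η
    simp only [f, LinearMap.comp_apply, LinearEquiv.coe_coe]
    rw [ι.quotKerEquivRange_symm_apply_image η (LinearMap.mem_range_self ι η)]
    rfl
  let f' : ι.range →L[ℂ] ℂ := f.mkContinuous C fun x => by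
    obtain ⟨_, η, rfl⟩ := x
    rw [hf]
    exact hb η
  obtain ⟨g, hg, -⟩ := exists_extension_norm_eq ι.range f'
  exact ⟨g, fun η => ((hg ⟨ι η, LinearMap.mem_range_self ι η⟩).trans (hf η)).symm⟩

/-- A tempered distribution factors through finitely many weighted derivatives, hence through a
Banach space. -/
lemma exists_factor (F : 𝓢'(Space N, ℂ)) : ∃ (s : Finset (ℕ × ℕ))
    (g : ((i : s) → BoundedContinuousFunction (Space N) (Jet N i.1.2)) →L[ℂ] ℂ),
    ∀ η, F η = g (fun i => weightedDeriv i.1.1 i.1.2 η) := by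
  obtain ⟨s, C, -, hC⟩ := Seminorm.bound_of_continuous (schwartz_withSeminorms ℂ (Space N) ℂ)
    ((normSeminorm ℂ ℂ).comp (F : 𝓢(Space N, ℂ) →ₗ[ℂ] ℂ))
    (continuous_norm.comp (map_continuous F))
  let ι : 𝓢(Space N, ℂ) →ₗ[ℂ]
      ((i : s) → BoundedContinuousFunction (Space N) (Jet N i.1.2)) :=
    LinearMap.pi fun i => (weightedDeriv i.1.1 i.1.2).toLinearMap
  have hb : ∀ η, ‖(F : 𝓢(Space N, ℂ) →ₗ[ℂ] ℂ) η‖ ≤ (C : ℝ) * ‖ι η‖ := by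
    intro η
    refine (Seminorm.le_def.1 hC η).trans ?_
    have h0 : 0 ≤ ‖ι η‖ := norm_nonneg (ι η)
    have h1 : (s.sup (schwartzSeminormFamily ℂ (Space N) ℂ)) η ≤ ‖ι η‖ := by
      refine Seminorm.finset_sup_apply_le h0 fun i hi => ?_
      exact (seminorm_le_norm_weightedDeriv i.1 i.2 η).trans (norm_le_pi_norm (ι η) ⟨i, hi⟩)
    exact mul_le_mul_of_nonneg_left h1 C.2
  obtain ⟨g, hg⟩ := exists_factor_of_norm_le ι (F : 𝓢(Space N, ℂ) →ₗ[ℂ] ℂ) C hb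
  exact ⟨s, g, hg⟩

/-- A tempered distribution commutes with integrals of translates of a Schwartz function `κ`. The
Schwartz function `ψ` is such an integral in the sense that this holds for it and all its
derivatives pointwise. -/
lemma apply_eq_integral_translate {X : Type*} [MeasurableSpace X] [TopologicalSpace X]
    [OpensMeasurableSpace X] [SecondCountableTopology X] (μ : Measure X) (F : 𝓢'(Space N, ℂ))
    (κ ψ : 𝓢(Space N, ℂ)) (c : X → ℂ) (a : X → Space N) (ha : Continuous a)
    (hcm : AEStronglyMeasurable c μ)
    (hc : ∀ k : ℕ, Integrable (fun x => ‖c x‖ * (1 + ‖a x‖) ^ k) μ)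
    (h : ∀ (n : ℕ) (m : Fin n → Space N) (y : Space N),
      (∂^{m} ψ) y = ∫ x, c x * (∂^{m} κ) (y - a x) ∂μ) :
    Integrable (fun x => c x * F (translate (a x) κ)) μ ∧
      F ψ = ∫ x, c x * F (translate (a x) κ) ∂μ := by
  obtain ⟨s, g, hg⟩ := exists_factor F
  let Γ : X → ((i : s) → BoundedContinuousFunction (Space N) (Jet N i.1.2)) :=
    fun x => c x • fun i : s => weightedDeriv i.1.1 i.1.2 (translate (a x) κ)
  have hcont : Continuous fun x => (fun i : s => weightedDeriv i.1.1 i.1.2 (translate (a x) κ)) :=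
    continuous_pi fun i => (weightedDeriv i.1.1 i.1.2).continuous.comp
      ((continuous_translate κ).comp ha)
  choose B hB0 hB using fun i : ℕ × ℕ => exists_pow_mul_translate_le κ i.1 i.2
  have hint : Integrable Γ μ := by
    have hdom : Integrable (fun x => ∑ i : s, B i.1 * (‖c x‖ * (1 + ‖a x‖) ^ i.1.1)) μ :=
      integrable_finsetSum _ fun i _ => (hc i.1.1).const_mul _
    refine hdom.mono' (hcm.smul hcont.stronglyMeasurable.aestronglyMeasurable) ?_
    filter_upwards with x
    have hx : ∀ i : s, ‖weightedDeriv i.1.1 i.1.2 (translate (a x) κ)‖ ≤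
        B i.1 * (1 + ‖a x‖) ^ i.1.1 := fun i => by
      refine (BoundedContinuousFunction.norm_le (by have := hB0 i.1; positivity)).2 fun y => ?_
      rw [norm_weightedDeriv_apply]
      exact hB i.1 _ _
    rw [norm_smul]
    have : ‖fun i : s => weightedDeriv i.1.1 i.1.2 (translate (a x) κ)‖ ≤
        ∑ i : s, B i.1 * (1 + ‖a x‖) ^ i.1.1 := by
      have hnn : ∀ i : s, 0 ≤ B i.1 * (1 + ‖a x‖) ^ i.1.1 := fun i => by
        have := hB0 i.1; positivity
      refine (pi_norm_le_iff_of_nonneg (Finset.sum_nonneg fun i _ => hnn i)).2 fun i => ?_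
      exact (hx i).trans (Finset.single_le_sum (f := fun i : s => B i.1 * (1 + ‖a x‖) ^ i.1.1)
        (fun i _ => hnn i) (Finset.mem_univ i))
    calc ‖c x‖ * _ ≤ ‖c x‖ * ∑ i : s, B i.1 * (1 + ‖a x‖) ^ i.1.1 := by gcongr
      _ = _ := by rw [Finset.mul_sum]; exact Finset.sum_congr rfl fun i _ => by ring
  have hI : (fun i : s => weightedDeriv i.1.1 i.1.2 ψ) = ∫ x, Γ x ∂μ := by
    ext1 i
    ext1 y
    refine Jet.ext fun m => ?_
    let L : ((i : s) → BoundedContinuousFunction (Space N) (Jet N i.1.2)) →L[ℝ] ℂ :=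
      (Jet.eval m).comp
        ((BoundedContinuousFunction.evalCLM ℝ y).comp
          (ContinuousLinearMap.proj (R := ℝ)
            (φ := fun i : s => BoundedContinuousFunction (Space N) (Jet N i.1.2)) i))
    have hL := L.integral_comp_comm hint
    have hLw : ∀ (b : ℂ) (η : 𝓢(Space N, ℂ)),
        L (b • fun i : s => weightedDeriv i.1.1 i.1.2 η) =
          ((‖y‖ ^ i.1.1 : ℝ) : ℂ) * (b * (∂^{m} η) y) := by
      intro b η
      change Jet.eval m (b • weightedDeriv i.1.1 i.1.2 η y) = _
      rw [weightedDeriv_apply, Jet.eval_smul, Jet.eval_smul, eval_jet]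
      ring
    have hLΓ : ∀ x, L (Γ x) = ((‖y‖ ^ i.1.1 : ℝ) : ℂ) * (c x * (∂^{m} κ) (y - a x)) := by
      intro x
      rw [hLw, ← eval_jet, ← eval_jet]
      congr 3
      exact iteratedFDeriv_translate _ _ _ _
    have hgoal : Jet.eval m (weightedDeriv i.1.1 i.1.2 ψ y) = L (∫ x, Γ x ∂μ) := by
      rw [← hL]
      simp only [hLΓ]
      rw [integral_const_mul, ← h, weightedDeriv_apply, Jet.eval_smul, eval_jet]
    exact hgoal
  have hgΓ : ∀ x, g (Γ x) = c x * F (translate (a x) κ) := fun x => by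
    simp only [Γ, map_smul, smul_eq_mul, hg]
  refine ⟨(g.integrable_comp hint).congr (Filter.Eventually.of_forall hgΓ), ?_⟩
  rw [hg, hI, ← g.integral_comp_comm hint]
  exact integral_congr_ae (Filter.Eventually.of_forall hgΓ)

end

/-! ### Fourier multipliers with Schwartz symbol -/

section

variable {N : ℕ}

open LineDeriv FourierTransform

lemma hasTemperateGrowth_inner (v : Space N) :
    (inner ℝ · v : Space N → ℝ).HasTemperateGrowth :=
  ((innerSL ℝ).flip v).hasTemperateGrowth

lemma lineDerivOp_comm (v w : Space N) (κ : 𝓢(Space N, ℂ)) : ∂_{v} (∂_{w} κ) = ∂_{w} (∂_{v} κ) := by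
  suffices h : 𝓕 (∂_{v} (∂_{w} κ)) = 𝓕 (∂_{w} (∂_{v} κ)) by
    have h' := congrArg (fun χ : 𝓢(Space N, ℂ) => 𝓕⁻ χ) h
    simpa only [FourierTransform.fourierInv_fourier_eq] using h'
  ext ξ
  simp only [fourier_lineDerivOp_eq, _root_.smul_apply,
    smulLeftCLM_apply_apply (hasTemperateGrowth_inner _)]
  simp only [smul_eq_mul, Complex.real_smul]
  ring

lemma iteratedLineDerivOp_comm {n : ℕ} (m : Fin n → Space N) (w : Space N) (κ : 𝓢(Space N, ℂ)) :
    ∂^{m} (∂_{w} κ) = ∂_{w} (∂^{m} κ) := by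
  induction n with
  | zero => rfl
  | succ n ih => rw [iteratedLineDerivOp_succ_left, ih, lineDerivOp_comm,
      ← iteratedLineDerivOp_succ_left]

/-- The convolution of two scalar Schwartz functions. -/
def conv (η κ : 𝓢(Space N, ℂ)) : 𝓢(Space N, ℂ) := convolution (ContinuousLinearMap.mul ℂ ℂ) η κ

lemma conv_apply (η κ : 𝓢(Space N, ℂ)) (y : Space N) : conv η κ y = ∫ x, η x * κ (y - x) := by
  rw [conv, convolution_apply]; rfl

lemma lineDerivOp_conv (v : Space N) (η κ : 𝓢(Space N, ℂ)) :
    ∂_{v} (conv η κ) = conv η (∂_{v} κ) := by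
  change ∂_{v} (𝓕⁻ (pairing (ContinuousLinearMap.mul ℂ ℂ) (𝓕 η) (𝓕 κ))) =
    𝓕⁻ (pairing (ContinuousLinearMap.mul ℂ ℂ) (𝓕 η) (𝓕 (∂_{v} κ)))
  rw [lineDerivOp_fourierInv_eq]
  congr 1
  ext ξ
  simp only [fourier_lineDerivOp_eq, pairing_apply_apply, map_smul, _root_.smul_apply,
    smulLeftCLM_apply_apply (hasTemperateGrowth_inner _), ContinuousLinearMap.mul_apply']
  simp only [smul_eq_mul, Complex.real_smul]
  ring

lemma iteratedLineDerivOp_conv {n : ℕ} (m : Fin n → Space N) (η κ : 𝓢(Space N, ℂ)) :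
    ∂^{m} (conv η κ) = conv η (∂^{m} κ) := by
  induction n with
  | zero => rfl
  | succ n ih => rw [iteratedLineDerivOp_succ_left, ih, lineDerivOp_conv,
      ← iteratedLineDerivOp_succ_left]

/-- A Schwartz Fourier multiplier is the convolution with its kernel, up to reflection; in this form
it is the transpose that defines the multiplier on distributions. -/
lemma fourier_smulLeft_fourierInv (σ η : 𝓢(Space N, ℂ)) :
    𝓕 (smulLeftCLM ℂ σ (𝓕⁻ η)) = conv η (𝓕 σ) := by
  change _ = 𝓕⁻ (pairing (ContinuousLinearMap.mul ℂ ℂ) (𝓕 η) (𝓕 (𝓕 σ)))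
  have hneg : ∀ (h : 𝓢(Space N, ℂ)) (x : Space N), 𝓕 h x = 𝓕⁻ h (-x) := by
    intro h x
    rw [fourier_coe, fourierInv_coe, Real.fourierInv_eq_fourier_neg, neg_neg]
  ext y
  rw [fourier_coe, fourierInv_coe, Real.fourierInv_eq_fourier_comp_neg]
  refine congrFun (congrArg _ (funext fun ξ => ?_)) y
  simp only [pairing_apply_apply, ContinuousLinearMap.mul_apply']
  rw [hneg η, hneg (𝓕 σ), FourierTransform.fourierInv_fourier_eq, neg_neg,
    smulLeftCLM_apply_apply σ.hasTemperateGrowth, smul_eq_mul, mul_comm]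

lemma fourierMultiplier_apply (σ : 𝓢(Space N, ℂ)) (F : 𝓢'(Space N, ℂ)) (η : 𝓢(Space N, ℂ)) :
    TemperedDistribution.fourierMultiplierCLM ℂ σ F η = F (conv η (𝓕 σ)) := by
  rw [TemperedDistribution.fourierMultiplierCLM_apply_apply, fourier_smulLeft_fourierInv]

lemma integrable_norm_mul_one_add_pow (η : 𝓢(Space N, ℂ)) (k : ℕ) :
    Integrable (fun x => ‖η x‖ * (1 + ‖x‖) ^ k) := by
  have h : ∀ j : ℕ, Integrable (fun x => ‖η x‖ * (‖x‖ ^ j * (k.choose j : ℝ))) := fun j =>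
    ((η.integrable_pow_mul volume j).mul_const (k.choose j : ℝ)).congr
      (Filter.Eventually.of_forall fun x => by ring)
  have := integrable_finsetSum (Finset.range (k + 1)) fun j _ => h j
  refine this.congr (Filter.Eventually.of_forall fun x => ?_)
  simp only
  rw [add_comm (1 : ℝ), add_pow, Finset.mul_sum]
  exact Finset.sum_congr rfl fun j _ => by ring

/-- A tempered distribution applied to the Schwartz convolution. -/
lemma apply_conv (F : 𝓢'(Space N, ℂ)) (η κ : 𝓢(Space N, ℂ)) :
    Integrable (fun x => η x * F (translate x κ)) ∧
      F (conv η κ) = ∫ x, η x * F (translate x κ) := by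
  refine apply_eq_integral_translate volume F κ (conv η κ) η id continuous_id
    η.continuous.aestronglyMeasurable (integrable_norm_mul_one_add_pow η) fun n m y => ?_
  rw [iteratedLineDerivOp_conv, conv_apply]
  rfl

/-- A Fourier multiplier with a Schwartz symbol maps any tempered distribution to a function,
obtained by applying the distribution to the translates of the convolution kernel. -/
lemma isFun_fourierMultiplier (σ : 𝓢(Space N, ℂ)) (F : 𝓢'(Space N, ℂ)) :
    IsFun (TemperedDistribution.fourierMultiplierCLM ℂ σ F) (fun x => F (translate x (𝓕 σ))) :=
  fun η => ⟨(apply_conv F η (𝓕 σ)).1, by rw [fourierMultiplier_apply, (apply_conv F η (𝓕 σ)).2]⟩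

lemma continuous_apply_translate (F : 𝓢'(Space N, ℂ)) (κ : 𝓢(Space N, ℂ)) :
    Continuous fun x => F (translate x κ) :=
  (map_continuous F).comp (continuous_translate κ)

lemma IsFun.apply_translate {F : 𝓢'(Space N, ℂ)} {u : Space N → ℂ} (h : IsFun F u)
    (κ : 𝓢(Space N, ℂ)) (x : Space N) : F (translate x κ) = ∫ z, κ z * u (x + z) := by
  rw [(h _).2, ← integral_add_left_eq_self _ x]
  simp [translate_apply]

lemma enorm_apply_translate_le {F : 𝓢'(Space N, ℂ)} {u : Space N → ℂ} (h : IsFun F u)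
    (κ : 𝓢(Space N, ℂ)) (x : Space N) :
    ‖F (translate x κ)‖ₑ ≤ ∫⁻ z, ‖u (x + z)‖ₑ ∂(volume.withDensity fun z => ‖κ z‖ₑ) := by
  rw [h.apply_translate, lintegral_withDensity_eq_lintegral_mul₀']
  · refine (enorm_integral_le_lintegral_enorm _).trans_eq (lintegral_congr fun z => ?_)
    simp [enorm_mul]
  · exact κ.continuous.enorm.measurable.aemeasurable
  · refine AEMeasurable.mono_ac ?_ (withDensity_absolutelyContinuous _ _)
    exact h.aestronglyMeasurable.enorm.comp_quasiMeasurePreserving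
      (quasiMeasurePreserving_add_left volume x)

lemma eLpNorm_apply_translate_le {F : 𝓢'(Space N, ℂ)} {u : Space N → ℂ} (h : IsFun F u)
    (κ : 𝓢(Space N, ℂ)) {p : ℝ≥0∞} (hp : 1 ≤ p) :
    eLpNorm (fun x => F (translate x κ)) p volume ≤ (∫⁻ x, ‖κ x‖ₑ) * eLpNorm u p volume := by
  refine (eLpNorm_mono_enorm (g := fun x =>
    ∫⁻ z, ‖u (x + z)‖ₑ ∂(volume.withDensity fun z => ‖κ z‖ₑ)) fun x => ?_).trans ?_
  · simpa using enorm_apply_translate_le h κ x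
  · refine (eLpNorm_lintegral_translate_le volume (volume.withDensity fun z => ‖κ z‖ₑ)
      (withDensity_absolutelyContinuous _ _) (w := fun x => ‖u x‖ₑ)
      h.aestronglyMeasurable.enorm hp).trans_eq ?_
    rw [withDensity_apply _ MeasurableSet.univ, Measure.restrict_univ, eLpNorm_enorm]

/-- Multipliers with Schwartz symbol are bounded on `L^p`. -/
lemma normLp_fourierMultiplier_le (σ : 𝓢(Space N, ℂ)) (F : 𝓢'(Space N, ℂ)) {p : ℝ≥0∞}
    (hp : 1 ≤ p) {A : ℝ≥0∞} (hA : A ≠ 0) (hκ : ∫⁻ x, ‖𝓕 σ x‖ₑ ≤ A) :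
    normLp p (TemperedDistribution.fourierMultiplierCLM ℂ σ F) ≤ A * normLp p F := by
  rcases eq_top_or_lt_top (normLp p F) with h | h
  · rw [h, ENNReal.mul_top hA]; exact le_top
  · have hu := isFun_toFun_of_normLp h
    rw [(isFun_fourierMultiplier σ F).normLp_eq, hu.normLp_eq]
    exact (eLpNorm_apply_translate_le hu _ hp).trans (by gcongr)

/-! ### Distributions with bounded gradient -/

/-- The fundamental theorem of calculus for the translates of a Schwartz function. -/
lemma apply_translate_add_sub (F : 𝓢'(Space N, ℂ)) (κ : 𝓢(Space N, ℂ)) (x h : Space N) :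
    F (translate (x + h) κ) - F (translate x κ) =
      ∫ s in (0 : ℝ)..1, (∂_{h} F) (translate (x + s • h) κ) := by
  have hline : ∀ (χ : 𝓢(Space N, ℂ)) (y : Space N), ∀ s : ℝ,
      HasDerivAt (fun s : ℝ => χ (y - (x + s • h))) (-(∂_{h} χ) (y - (x + s • h))) s := by
    intro χ y s
    have h1 : HasDerivAt (fun s : ℝ => y - (x + s • h)) (-h) s := by
      have := ((hasDerivAt_id s).smul_const h).const_add x |>.const_sub y
      simpa using this
    have h2 := (χ.hasFDerivAt (y - (x + s • h))).comp_hasDerivAt s h1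
    rw [lineDerivOp_apply_eq_fderiv, ← map_neg]
    exact h2
  have hcont : Continuous fun s : ℝ => x + s • h := by fun_prop
  have key := apply_eq_integral_translate (volume.restrict (Set.Ioc (0 : ℝ) 1)) F (∂_{h} κ)
    (translate (x + h) κ - translate x κ) (fun _ => -1) (fun s : ℝ => x + s • h) hcont
    aestronglyMeasurable_const
    (fun k => (Continuous.integrableOn_Icc (by fun_prop)).mono_set Set.Ioc_subset_Icc_self) ?_
  · rw [← map_sub, key.2, ← intervalIntegral.integral_of_le zero_le_one]
    refine intervalIntegral.integral_congr fun s _ => ?_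
    simp only [TemperedDistribution.lineDerivOp_apply_apply, neg_mul, one_mul]
    rw [← map_neg]
    congr 1
    ext y
    simp only [_root_.neg_apply, translate_apply, lineDerivOp_apply_eq_fderiv]
    rw [show (⇑(translate (x + s • h) κ)) = fun y => κ (y - (x + s • h)) from rfl,
      fderiv_comp_sub]
  · intro n m y
    have htr : ∀ a, (∂^{m} (translate a κ)) y = (∂^{m} κ) (y - a) := fun a => by
      rw [iteratedLineDerivOp_eq_iteratedFDeriv, iteratedLineDerivOp_eq_iteratedFDeriv,
        iteratedFDeriv_translate]
    have hint := intervalIntegral.integral_eq_sub_of_hasDerivAt (a := 0) (b := 1)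
      (fun s _ => hline (∂^{m} κ) y s)
      (Continuous.intervalIntegrable (by
        exact ((∂_{h} (∂^{m} κ)).continuous.comp (continuous_const.sub hcont)).neg) 0 1)
    have hsub : ∂^{m} (translate (x + h) κ - translate x κ) =
        ∂^{m} (translate (x + h) κ) - ∂^{m} (translate x κ) := by
      rw [sub_eq_add_neg, iteratedLineDerivOp_add, iteratedLineDerivOp_neg, ← sub_eq_add_neg]
    rw [hsub, _root_.sub_apply, htr, htr, iteratedLineDerivOp_comm,
      ← intervalIntegral.integral_of_le zero_le_one]
    simp only [neg_mul, one_mul]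
    rw [hint]
    simp

lemma norm_lineDeriv_apply_le {F : 𝓢'(Space N, ℂ)} (hF : normGradLp ∞ F < ∞)
    (h : Space N) (χ : 𝓢(Space N, ℂ)) :
    ‖(∂_{h} F) χ‖ ≤ (∫ z, ‖χ z‖) * (normGradLp ∞ F).toReal * ‖h‖ := by
  have key : ∀ M : ℝ, (normGradLp ∞ F).toReal < M → ‖(∂_{h} F) χ‖ ≤ (∫ z, ‖χ z‖) * M * ‖h‖ := by
    intro M hM
    have hε : normGradLp ∞ F < ENNReal.ofReal M := (ENNReal.lt_ofReal_iff_toReal_lt hF.ne).2 hM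
    rw [normGradLp] at hε
    simp only [iInf_lt_iff] at hε
    obtain ⟨u, -, hf, hlt⟩ := hε
    have hM0 : 0 ≤ M := ENNReal.toReal_nonneg.trans hM.le
    have hu : ∀ᵐ z, ‖u z‖ ≤ M := by
      filter_upwards [enorm_ae_le_eLpNormEssSup u volume] with z hz
      rw [← eLpNorm_exponent_top] at hz
      have h2 := hz.trans hlt.le
      rwa [← ofReal_norm, ENNReal.ofReal_le_ofReal_iff hM0] at h2
    have hsum : h = ∑ j, h j • EuclideanSpace.single j (1 : ℝ) := by
      ext i
      simp [Finset.sum_apply, Pi.single_apply]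
    have hD : (∂_{h} F) χ = ∫ z, ∑ j, (h j : ℂ) * (χ z * u z j) := by
      rw [integral_finsetSum _ fun j _ => ((hf j χ).1.const_mul _)]
      conv_lhs => rw [hsum, lineDerivOp_left_sum]
      have : ∀ (s : Finset (Fin N)) (G : Fin N → 𝓢'(Space N, ℂ)),
          (∑ j ∈ s, G j) χ = ∑ j ∈ s, G j χ := fun s G =>
        map_sum (PointwiseConvergenceCLM.evalCLM (RingHom.id ℂ) ℂ χ) G s
      rw [this]
      refine Finset.sum_congr rfl fun j _ => ?_
      rw [integral_const_mul, ← (hf j χ).2, lineDerivOp_left_smul]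
      rfl
    rw [hD, mul_assoc, ← integral_mul_const]
    refine norm_integral_le_of_norm_le (χ.integrable.norm.mul_const _) ?_
    filter_upwards [hu] with z hz
    have hcs : ‖∑ j, (h j : ℂ) * u z j‖ ≤ ‖h‖ * ‖u z‖ := by
      refine (norm_sum_le _ _).trans ?_
      simp only [norm_mul, Complex.norm_real]
      rw [EuclideanSpace.norm_eq, EuclideanSpace.norm_eq]
      exact Real.sum_mul_le_sqrt_mul_sqrt _ _ _
    have : ∑ j, (h j : ℂ) * (χ z * u z j) = χ z * ∑ j, (h j : ℂ) * u z j := by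
      rw [Finset.mul_sum]
      exact Finset.sum_congr rfl fun j _ => by ring
    rw [this, norm_mul]
    calc ‖χ z‖ * ‖∑ j, (h j : ℂ) * u z j‖ ≤ ‖χ z‖ * (‖h‖ * M) := by
          gcongr
          exact hcs.trans (by gcongr)
      _ = ‖χ z‖ * (M * ‖h‖) := by ring
  have hlim : Filter.Tendsto (fun M : ℝ => (∫ z, ‖χ z‖) * M * ‖h‖)
      (nhdsWithin (normGradLp ∞ F).toReal (Set.Ioi (normGradLp ∞ F).toReal))
      (nhds ((∫ z, ‖χ z‖) * (normGradLp ∞ F).toReal * ‖h‖)) :=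
    (Continuous.tendsto (by fun_prop) _).mono_left nhdsWithin_le_nhds
  refine ge_of_tendsto hlim ?_
  filter_upwards [self_mem_nhdsWithin] with M hM using key M hM

/-- A distribution with bounded gradient, tested against translates of a Schwartz function, is
Lipschitz continuous in the translation. -/
lemma norm_apply_translate_sub_le {F : 𝓢'(Space N, ℂ)} (hF : normGradLp ∞ F < ∞)
    (κ : 𝓢(Space N, ℂ)) (x y : Space N) :
    ‖F (translate x κ) - F (translate y κ)‖ ≤
      (∫ z, ‖κ z‖) * (normGradLp ∞ F).toReal * ‖x - y‖ := by
  have h := apply_translate_add_sub F κ y (x - y)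
  rw [add_sub_cancel] at h
  rw [h]
  refine (intervalIntegral.norm_integral_le_of_norm_le_const (C := (∫ z, ‖κ z‖) *
    (normGradLp ∞ F).toReal * ‖x - y‖) fun s _ => ?_).trans_eq (by simp)
  refine (norm_lineDeriv_apply_le hF _ _).trans_eq ?_
  congr 2
  exact integral_sub_right_eq_self (fun z => ‖κ z‖) _

end

/-! ### Low-frequency cut-offs -/

section

variable {N : ℕ}

open LineDeriv FourierTransform

variable (φ : Cutoff N)

/-- The convolution kernel of the low-frequency cut-off at frequency `2^m`. -/
def Cutoff.kernel (m : ℤ) : 𝓢(Space N, ℂ) := 𝓕 (φ.lowSymbol m)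

/-- The low-frequency cut-off `S_m = ∑_{q < m} Δ_q`. -/
def low (m : ℤ) : 𝓢'(Space N, ℂ) →L[ℂ] 𝓢'(Space N, ℂ) :=
  TemperedDistribution.fourierMultiplierCLM ℂ (φ.lowSymbol m)

lemma isFun_low (m : ℤ) (F : 𝓢'(Space N, ℂ)) :
    IsFun (low φ m F) fun x => F (translate x (φ.kernel m)) := isFun_fourierMultiplier _ _

lemma low_of_neg {m : ℤ} (hm : m < 0) (F : 𝓢'(Space N, ℂ)) : low φ m F = 0 := by
  have h : φ.kernel m = 0 := by
    rw [Cutoff.kernel, φ.lowSymbol_of_neg hm]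
    exact map_zero (fourierCLM ℂ 𝓢(Space N, ℂ))
  refine (isFun_low φ m F).eq ?_
  have : (fun x => F (translate x (φ.kernel m))) = 0 := by
    funext x
    rw [h, show translate x (0 : 𝓢(Space N, ℂ)) = 0 from map_zero (compSubConstCLM ℂ x), map_zero]
    rfl
  rw [this]
  exact IsFun.zero

lemma block_eq (q : ℤ) (F : 𝓢'(Space N, ℂ)) : block φ q F = low φ (q + 1) F - low φ q F := by
  ext η
  have hg := fun m => (φ.lowSymbol m).hasTemperateGrowth
  have h : smulLeftCLM ℂ (φ.symbol q) (𝓕⁻ η) = smulLeftCLM ℂ (φ.lowSymbol (q + 1)) (𝓕⁻ η) -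
      smulLeftCLM ℂ (φ.lowSymbol q) (𝓕⁻ η) := by
    ext ξ
    rw [φ.symbol_eq, smulLeftCLM_apply_apply (SchwartzMap.hasTemperateGrowth _),
      _root_.sub_apply, _root_.sub_apply, smulLeftCLM_apply_apply (hg _),
      smulLeftCLM_apply_apply (hg _), sub_smul]
  change F (𝓕 (smulLeftCLM ℂ (φ.symbol q) (𝓕⁻ η))) =
    F (𝓕 (smulLeftCLM ℂ (φ.lowSymbol (q + 1)) (𝓕⁻ η))) -
      F (𝓕 (smulLeftCLM ℂ (φ.lowSymbol q) (𝓕⁻ η)))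
  rw [h, ← map_sub]
  congr 1
  exact map_sub (fourierCLM ℂ 𝓢(Space N, ℂ)) _ _

lemma block_eq_fourierMultiplier (q : ℤ) : block φ q =
    TemperedDistribution.fourierMultiplierCLM ℂ ⇑(φ.lowSymbol (q + 1) - φ.lowSymbol q) := by
  rw [block, φ.symbol_eq]

/-- Composition of multipliers with Schwartz symbols, in terms of the symbols. -/
lemma fourierMultiplier_comp (σ τ : 𝓢(Space N, ℂ)) (F : 𝓢'(Space N, ℂ)) :
    TemperedDistribution.fourierMultiplierCLM ℂ τ (TemperedDistribution.fourierMultiplierCLM ℂ σ F)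
      = TemperedDistribution.fourierMultiplierCLM ℂ (⇑σ * ⇑τ) F :=
  TemperedDistribution.fourierMultiplierCLM_fourierMultiplierCLM_apply
    σ.hasTemperateGrowth τ.hasTemperateGrowth F

lemma low_block_comm (m q : ℤ) (F : 𝓢'(Space N, ℂ)) :
    low φ m (block φ q F) = block φ q (low φ m F) := by
  rw [block_eq_fourierMultiplier, low, fourierMultiplier_comp, fourierMultiplier_comp, mul_comm]

lemma fourierMultiplier_zero (F : 𝓢'(Space N, ℂ)) :
    TemperedDistribution.fourierMultiplierCLM ℂ (0 : Space N → ℂ) F = 0 := by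
  have := TemperedDistribution.fourierMultiplierCLM_const (E := Space N) (F := ℂ) 0
  rw [zero_smul] at this
  exact congrArg (fun T : 𝓢'(Space N, ℂ) →L[ℂ] 𝓢'(Space N, ℂ) => T F) this

lemma two_zpow_mono {m n : ℤ} (h : m ≤ n) : (2 : ℝ) ^ m ≤ 2 ^ n :=
  zpow_le_zpow_right₀ one_le_two h

namespace Cutoff

/-- The block `Δ_q` lives at frequencies above `3/4 * 2^q` (if `q ≥ 0`). -/
lemma symbol_eq_zero_of_le {q m : ℤ} (hqm : m < q) {ξ : Space N} (h : ‖ξ‖ < 4 / 3 * 2 ^ m)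
    (hm : 0 ≤ m) : (φ.lowSymbol (q + 1) - φ.lowSymbol q) ξ = 0 := by
  have h1 : (2 : ℝ) ^ (m + 1) ≤ 2 ^ q := two_zpow_mono hqm
  have h2 : (2 : ℝ) ^ (q + 1) = 2 ^ q * 2 := zpow_add_one₀ two_ne_zero q
  have h3 : (2 : ℝ) ^ (m + 1) = 2 ^ m * 2 := zpow_add_one₀ two_ne_zero m
  have h4 : (0 : ℝ) < 2 ^ m := by positivity
  rw [_root_.sub_apply, φ.lowSymbol_eq_one (by omega) (by linarith),
    φ.lowSymbol_eq_one (by omega) (by linarith), sub_self]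

/-- The block `Δ_q` lives at frequencies below `8/3 * 2^q`. -/
lemma symbol_eq_zero_of_ge {q : ℤ} {ξ : Space N} (h : 8 / 3 * 2 ^ q ≤ ‖ξ‖) :
    (φ.lowSymbol (q + 1) - φ.lowSymbol q) ξ = 0 := by
  have h2 : (2 : ℝ) ^ (q + 1) = 2 ^ q * 2 := zpow_add_one₀ two_ne_zero q
  have h4 : (0 : ℝ) < 2 ^ q := by positivity
  rw [_root_.sub_apply, φ.lowSymbol_eq_zero (by linarith), φ.lowSymbol_eq_zero (by linarith),
    sub_self]

end Cutoff

lemma block_low_eq_zero {q m : ℤ} (h : m < q) (F : 𝓢'(Space N, ℂ)) :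
    block φ q (low φ m F) = 0 := by
  rcases lt_or_ge m 0 with hm | hm
  · rw [low_of_neg φ hm, map_zero]
  rw [block_eq_fourierMultiplier, low, fourierMultiplier_comp]
  have : (⇑(φ.lowSymbol m) * ⇑(φ.lowSymbol (q + 1) - φ.lowSymbol q) : Space N → ℂ) = 0 := by
    funext ξ
    rw [Pi.mul_apply, Pi.zero_apply]
    rcases lt_or_ge ‖ξ‖ (4 / 3 * 2 ^ m) with hξ | hξ
    · rw [φ.symbol_eq_zero_of_le h hξ hm, mul_zero]
    · rw [φ.lowSymbol_eq_zero hξ, zero_mul]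
  rw [this, fourierMultiplier_zero]

lemma block_of_le {q : ℤ} (hq : q ≤ -2) (F : 𝓢'(Space N, ℂ)) : block φ q F = 0 := by
  rw [block_eq, low_of_neg φ (by omega), low_of_neg φ (by omega), sub_zero]

lemma block_low_eq_self {q m : ℤ} (h : q + 2 ≤ m) (F : 𝓢'(Space N, ℂ)) :
    block φ q (low φ m F) = block φ q F := by
  rcases le_or_gt q (-2) with hq | hq
  · rw [block_of_le φ hq, block_of_le φ hq]
  rw [block_eq_fourierMultiplier, low, fourierMultiplier_comp]
  have : (⇑(φ.lowSymbol m) * ⇑(φ.lowSymbol (q + 1) - φ.lowSymbol q) : Space N → ℂ) =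
      ⇑(φ.lowSymbol (q + 1) - φ.lowSymbol q) := by
    funext ξ
    rw [Pi.mul_apply]
    rcases lt_or_ge ‖ξ‖ (8 / 3 * 2 ^ q) with hξ | hξ
    · rw [φ.lowSymbol_eq_one (by omega), one_mul]
      have h1 : (2 : ℝ) ^ (q + 2) ≤ 2 ^ m := two_zpow_mono h
      have h2 : (2 : ℝ) ^ (q + 2) = 2 ^ q * 4 := by rw [zpow_add₀ two_ne_zero]; norm_num
      have h4 : (0 : ℝ) < 2 ^ q := by positivity
      linarith
    · rw [φ.symbol_eq_zero_of_ge hξ, mul_zero]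
  rw [this]

lemma sum_block (m : ℤ) (n : ℕ) (F : 𝓢'(Space N, ℂ)) :
    ∑ i ∈ Finset.range n, block φ (m + i) F = low φ (m + n) F - low φ m F := by
  induction n with
  | zero => simp
  | succ n ih =>
    rw [Finset.sum_range_succ, ih, block_eq]
    push_cast
    rw [← add_assoc]; abel

/-! ### Kernel estimates -/

/-- The kernels are `L¹`-normalised dilates of the kernel of `S_0`. -/
lemma kernel_apply {m : ℤ} (hm : 0 ≤ m) (x : Space N) :
    φ.kernel m x = (((2 : ℝ) ^ m) ^ N : ℝ) • φ.kernel 0 ((2 : ℝ) ^ m • x) := by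
  have hc : (0 : ℝ) < 2 ^ m := by positivity
  rw [Cutoff.kernel, Cutoff.kernel, fourier_coe, fourier_coe, Real.fourier_eq, Real.fourier_eq]
  have h := Measure.integral_comp_inv_smul_of_nonneg (volume : Measure (Space N))
    (fun v => Real.fourierChar (-inner ℝ v ((2 : ℝ) ^ m • x)) • φ.lowSymbol 0 v) hc.le
  rw [finrank_euclideanSpace_fin] at h
  rw [← h]
  congr 1
  ext v
  rw [φ.lowSymbol_apply hm, φ.lowSymbol_apply le_rfl, inner_smul_left, inner_smul_right,
    zpow_neg]
  simp [hc.ne']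

/-- Integration against the kernel of `S_m`, rescaled. -/
lemma integral_kernel_mul {m : ℤ} (hm : 0 ≤ m) (G : Space N → ℂ) :
    ∫ x, φ.kernel m x * G x = ∫ z, φ.kernel 0 z * G (((2 : ℝ) ^ m)⁻¹ • z) := by
  have hc : (0 : ℝ) < 2 ^ m := by positivity
  have h := Measure.integral_comp_smul_of_nonneg (volume : Measure (Space N))
    (fun z => φ.kernel 0 z * G (((2 : ℝ) ^ m)⁻¹ • z)) ((2 : ℝ) ^ m) (hR := hc.le)
  rw [finrank_euclideanSpace_fin] at h
  simp only [smul_smul, inv_mul_cancel₀ hc.ne', one_smul] at h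
  calc ∫ x, φ.kernel m x * G x
      = (((2 : ℝ) ^ m) ^ N) • ∫ x, φ.kernel 0 ((2 : ℝ) ^ m • x) * G x := by
        rw [← integral_smul]
        refine integral_congr_ae (Filter.Eventually.of_forall fun x => ?_)
        simp only [kernel_apply φ hm, smul_mul_assoc]
    _ = _ := by rw [h, smul_smul, mul_inv_cancel₀ (by positivity), one_smul]

lemma integral_norm_kernel_mul {m : ℤ} (hm : 0 ≤ m) (G : Space N → ℝ) :
    ∫ x, ‖φ.kernel m x‖ * G x = ∫ z, ‖φ.kernel 0 z‖ * G (((2 : ℝ) ^ m)⁻¹ • z) := by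
  have hc : (0 : ℝ) < 2 ^ m := by positivity
  have h := Measure.integral_comp_smul_of_nonneg (volume : Measure (Space N))
    (fun z => ‖φ.kernel 0 z‖ * G (((2 : ℝ) ^ m)⁻¹ • z)) ((2 : ℝ) ^ m) (hR := hc.le)
  rw [finrank_euclideanSpace_fin] at h
  simp only [smul_smul, inv_mul_cancel₀ hc.ne', one_smul] at h
  calc ∫ x, ‖φ.kernel m x‖ * G x
      = (((2 : ℝ) ^ m) ^ N) • ∫ x, ‖φ.kernel 0 ((2 : ℝ) ^ m • x)‖ * G x := by
        rw [← integral_smul]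
        refine integral_congr_ae (Filter.Eventually.of_forall fun x => ?_)
        simp only [kernel_apply φ hm, norm_smul, smul_eq_mul, norm_pow, norm_zpow,
          Real.norm_ofNat, mul_assoc]
    _ = _ := by rw [h, smul_smul, mul_inv_cancel₀ (by positivity), one_smul]

lemma integrable_norm_mul_norm (κ : 𝓢(Space N, ℂ)) : Integrable fun x => ‖κ x‖ * ‖x‖ := by
  refine (κ.integrable_pow_mul volume 1).congr (Filter.Eventually.of_forall fun x => ?_)
  simp only [pow_one, mul_comm]

lemma kernel_of_neg {m : ℤ} (hm : m < 0) : φ.kernel m = 0 := by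
  rw [Cutoff.kernel, φ.lowSymbol_of_neg hm]
  exact map_zero (fourierCLM ℂ 𝓢(Space N, ℂ))

/-- The kernels of the cut-offs are bounded in `L¹` and their first moments decay like `2^{-m}`. -/
lemma exists_kernel_bound : ∃ A : ℝ≥0, 1 ≤ A ∧ ∀ m : ℤ,
    ∫⁻ x, ‖φ.kernel m x‖ₑ ≤ A ∧
      ∫⁻ x, ‖φ.kernel m x‖ₑ * ‖x‖ₑ ≤ A * (2 : ℝ≥0∞) ^ (-(m : ℝ)) := by
  set a := ∫ x, ‖φ.kernel 0 x‖
  set b := ∫ x, ‖φ.kernel 0 x‖ * ‖x‖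
  have ha : 0 ≤ a := integral_nonneg fun x => norm_nonneg _
  have hb : 0 ≤ b := integral_nonneg fun x => by positivity
  refine ⟨Real.toNNReal (1 + a + b), Real.one_le_toNNReal.2 (by linarith), fun m => ?_⟩
  have hA : ((Real.toNNReal (1 + a + b) : ℝ≥0) : ℝ≥0∞) = ENNReal.ofReal (1 + a + b) := rfl
  rw [hA]
  rcases lt_or_ge m 0 with hm | hm
  · simp [kernel_of_neg φ hm]
  constructor
  · rw [← ofReal_integral_norm_eq_lintegral_enorm (φ.kernel m).integrable]
    have := integral_norm_kernel_mul φ hm (fun _ => 1)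
    simp only [mul_one] at this
    rw [this]
    exact ENNReal.ofReal_le_ofReal (by linarith)
  · have h1 : ∫⁻ x, ‖φ.kernel m x‖ₑ * ‖x‖ₑ = ∫⁻ x, ‖‖φ.kernel m x‖ * ‖x‖‖ₑ := by
      simp [enorm_mul]
    rw [h1, ← ofReal_integral_norm_eq_lintegral_enorm (integrable_norm_mul_norm _)]
    have h2 : (2 : ℝ≥0∞) ^ (-(m : ℝ)) = ENNReal.ofReal (((2 : ℝ) ^ m)⁻¹) := by
      rw [← ENNReal.ofReal_ofNat 2, ENNReal.ofReal_rpow_of_pos two_pos, Real.rpow_neg two_pos.le,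
        Real.rpow_intCast]
    rw [h2, ← ENNReal.ofReal_mul (by positivity)]
    refine ENNReal.ofReal_le_ofReal ?_
    simp only [norm_mul, norm_norm]
    rw [integral_norm_kernel_mul φ hm]
    have h3 : ∀ z : Space N, ‖φ.kernel 0 z‖ * ‖((2 : ℝ) ^ m)⁻¹ • z‖ =
        ((2 : ℝ) ^ m)⁻¹ * (‖φ.kernel 0 z‖ * ‖z‖) := fun z => by
      rw [norm_smul, norm_inv, norm_zpow, Real.norm_ofNat]; ring
    simp only [h3]
    rw [integral_const_mul, mul_comm]
    gcongr
    linarith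

lemma integral_kernel_zero : ∫ z, φ.kernel 0 z = 1 := by
  have h : 𝓕⁻ (φ.kernel 0) (0 : Space N) = 1 := by
    rw [Cutoff.kernel, FourierTransform.fourierInv_fourier_eq, φ.lowSymbol_eq_one le_rfl (by norm_num)]
  rw [fourierInv_coe, Real.fourierInv_eq] at h
  simpa using h

/-! ### Convergence of the low-frequency cut-offs -/

lemma conv_comm (η κ : 𝓢(Space N, ℂ)) : conv η κ = conv κ η := by
  change 𝓕⁻ (pairing (ContinuousLinearMap.mul ℂ ℂ) (𝓕 η) (𝓕 κ)) =
    𝓕⁻ (pairing (ContinuousLinearMap.mul ℂ ℂ) (𝓕 κ) (𝓕 η))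
  congr 1
  ext ξ
  exact mul_comm _ _

/-- Pairings with translates grow polynomially. -/
lemma exists_norm_apply_translate_le (F : 𝓢'(Space N, ℂ)) (η : 𝓢(Space N, ℂ)) :
    ∃ (C : ℝ) (k : ℕ), ∀ a, ‖F (translate a η)‖ ≤ C * (1 + ‖a‖) ^ k := by
  obtain ⟨s, C, -, hC⟩ := Seminorm.bound_of_continuous (schwartz_withSeminorms ℂ (Space N) ℂ)
    ((normSeminorm ℂ ℂ).comp (F : 𝓢(Space N, ℂ) →ₗ[ℂ] ℂ))
    (continuous_norm.comp (map_continuous F))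
  choose B hB0 hB using fun i : ℕ × ℕ => exists_pow_mul_translate_le η i.1 i.2
  set k := ∑ i ∈ s, i.1
  set D := ∑ i ∈ s, B i
  have hD : 0 ≤ D := Finset.sum_nonneg fun i _ => hB0 i
  refine ⟨C * D, k, fun a => ?_⟩
  refine (Seminorm.le_def.1 hC _).trans ?_
  have h1 : (s.sup (schwartzSeminormFamily ℂ (Space N) ℂ)) (translate a η) ≤
      D * (1 + ‖a‖) ^ k := by
    refine Seminorm.finset_sup_apply_le (by positivity) fun i hi => ?_
    refine seminorm_le_bound ℂ _ _ _ (by positivity) fun x => (hB i a x).trans ?_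
    have ha : 1 ≤ 1 + ‖a‖ := by linarith [norm_nonneg a]
    gcongr
    · exact Finset.single_le_sum (f := B) (fun i _ => hB0 i) hi
    · exact Finset.single_le_sum (f := fun i : ℕ × ℕ => i.1) (fun i _ => Nat.zero_le _) hi
  calc (C : ℝ) * _ ≤ C * (D * (1 + ‖a‖) ^ k) := mul_le_mul_of_nonneg_left h1 C.2
    _ = _ := by ring

/-- The low-frequency cut-offs converge weakly to the identity. -/
lemma tendsto_low (F : 𝓢'(Space N, ℂ)) (η : 𝓢(Space N, ℂ)) :
    Filter.Tendsto (fun n : ℕ => low φ n F η) Filter.atTop (nhds (F η)) := by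
  -- after rescaling, `S_n F (η)` is an average of `F` over small translates of `η`
  have h1 : ∀ n : ℕ, low φ n F η =
      ∫ z, φ.kernel 0 z * F (translate (((2 : ℝ) ^ (n : ℤ))⁻¹ • z) η) := fun n => by
    have h0 : low φ n F η = F (conv η (φ.kernel n)) := fourierMultiplier_apply _ _ _
    rw [h0, conv_comm, (apply_conv F (φ.kernel n) η).2,
      integral_kernel_mul φ (by positivity) (fun x => F (translate x η))]
  have h2 : F η = ∫ z, φ.kernel 0 z * F η := by
    rw [integral_mul_const, integral_kernel_zero, one_mul]
  simp only [h1]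
  rw [h2]
  obtain ⟨C, k, hC⟩ := exists_norm_apply_translate_le F η
  have hC0 : 0 ≤ C := by
    have := hC 0
    simp only [norm_zero, add_zero, one_pow, mul_one] at this
    exact (norm_nonneg _).trans this
  have hcF := continuous_apply_translate F η
  refine tendsto_integral_of_dominated_convergence
    (fun z => C * (‖φ.kernel 0 z‖ * (1 + ‖z‖) ^ k)) (fun n => ?_)
    ((integrable_norm_mul_one_add_pow _ k).const_mul C) (fun n => ?_) ?_
  · exact ((φ.kernel 0).continuous.mul (hcF.comp (continuous_const_smul _))).aestronglyMeasurable
  · refine Filter.Eventually.of_forall fun z => ?_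
    rw [norm_mul]
    have hn : ‖((2 : ℝ) ^ (n : ℤ))⁻¹ • z‖ ≤ ‖z‖ := by
      rw [norm_smul, norm_inv, norm_zpow, Real.norm_ofNat]
      refine mul_le_of_le_one_left (norm_nonneg z) (inv_le_one_of_one_le₀ ?_)
      exact one_le_zpow₀ one_le_two (by positivity)
    calc ‖φ.kernel 0 z‖ * ‖F (translate (((2 : ℝ) ^ (n : ℤ))⁻¹ • z) η)‖
        ≤ ‖φ.kernel 0 z‖ * (C * (1 + ‖((2 : ℝ) ^ (n : ℤ))⁻¹ • z‖) ^ k) := by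
          gcongr; exact hC _
      _ ≤ ‖φ.kernel 0 z‖ * (C * (1 + ‖z‖) ^ k) := by gcongr
      _ = _ := by ring
  · refine Filter.Eventually.of_forall fun z => ?_
    refine Filter.Tendsto.const_mul _ ?_
    have h3 : Filter.Tendsto (fun n : ℕ => ((2 : ℝ) ^ (n : ℤ))⁻¹ • z) Filter.atTop (nhds 0) := by
      have : Filter.Tendsto (fun n : ℕ => ((2 : ℝ) ^ (n : ℤ))⁻¹) Filter.atTop (nhds 0) := by
        simp only [zpow_natCast]
        exact tendsto_inv_atTop_zero.comp (tendsto_pow_atTop_atTop_of_one_lt one_lt_two)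
      simpa using this.smul_const z
    have h4 := (hcF.tendsto 0).comp h3
    have h5 : translate 0 η = η := by ext x; simp [translate_apply]
    rwa [h5] at h4

/-- Shifting an integer index does not change the limit along the natural numbers. -/
lemma tendsto_int_shift {a : ℤ → ℂ} {l : ℂ}
    (h : Filter.Tendsto (fun n : ℕ => a n) Filter.atTop (nhds l)) (m : ℤ) :
    Filter.Tendsto (fun n : ℕ => a (m + n)) Filter.atTop (nhds l) := by
  have h2 : Filter.Tendsto (fun n : ℕ => (m + n).toNat) Filter.atTop Filter.atTop := by
    refine Filter.tendsto_atTop.2 fun b => ?_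
    filter_upwards [Filter.eventually_ge_atTop ((b : ℤ) - m).toNat] with n hn
    omega
  refine (h.comp h2).congr' ?_
  filter_upwards [Filter.eventually_ge_atTop (-m).toNat] with n hn
  have : (((m + n).toNat : ℕ) : ℤ) = m + n := by omega
  simp only [Function.comp_apply, this]

lemma tendsto_sum_block (m : ℤ) (F : 𝓢'(Space N, ℂ)) (η : 𝓢(Space N, ℂ)) :
    Filter.Tendsto (fun n => ∑ i ∈ Finset.range n, block φ (m + i) F η) Filter.atTop
      (nhds ((F - low φ m F) η)) := by
  have h1 : ∀ n : ℕ, ∑ i ∈ Finset.range n, block φ (m + i) F η = (low φ (m + n) F - low φ m F) η := by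
    intro n
    rw [← sum_block]
    exact (map_sum (PointwiseConvergenceCLM.evalCLM (RingHom.id ℂ) ℂ η)
      (fun i : ℕ => block φ (m + i) F) (Finset.range n)).symm
  simp only [h1]
  refine Filter.Tendsto.sub_const ?_ _
  exact tendsto_int_shift (a := fun k => low φ k F η) (tendsto_low φ F η) m

lemma normLp_sub_low_le {p : ℝ≥0∞} (hp : 1 ≤ p) (m : ℤ) (F : 𝓢'(Space N, ℂ)) :
    normLp p (F - low φ m F) ≤ ∑' n : ℕ, normLp p (block φ (m + n) F) :=
  normLp_le_tsum hp (tendsto_sum_block φ m F)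

end

/-! ### Products of distributions that are functions -/

section

variable {N : ℕ}

open LineDeriv FourierTransform

/-- Hölder's inequality for the pairing of an `L^p` distribution with a fixed Schwartz function. -/
lemma exists_enorm_apply_le {p : ℝ≥0∞} (hp : 1 ≤ p) (η : 𝓢(Space N, ℂ)) :
    ∃ C : ℝ≥0, ∀ F : 𝓢'(Space N, ℂ), normLp p F < ∞ → ‖F η‖ₑ ≤ C * normLp p F := by
  have := ENNReal.HolderConjugate.inv_one_sub_inv' hp
  have hη := (η.memLp (1 - p⁻¹)⁻¹ (μ := volume)).2
  refine ⟨(eLpNorm η (1 - p⁻¹)⁻¹ volume).toNNReal, fun F hF => ?_⟩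
  rw [ENNReal.coe_toNNReal hη.ne]
  have hu := isFun_toFun_of_normLp hF
  rw [(hu η).2, hu.normLp_eq]
  refine (enorm_integral_le_lintegral_enorm _).trans ?_
  rw [← eLpNorm_one_eq_lintegral_enorm]
  have := eLpNorm_smul_le_mul_eLpNorm (p := (1 - p⁻¹)⁻¹) (q := p) (r := 1)
    hu.aestronglyMeasurable η.continuous.aestronglyMeasurable (μ := volume)
  exact this

/-- The product of two distributions that are functions. -/
def product (f g : 𝓢'(Space N, ℂ)) : 𝓢'(Space N, ℂ) := ofFun fun x => toFun f x * toFun g x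

section Product

variable {p p₁ p₂ : ℝ≥0∞}

lemma holderTriple (hpp : 1 / p = 1 / p₁ + 1 / p₂) :
    ENNReal.HolderTriple p₂ p₁ p :=
  ⟨by simpa [add_comm] using hpp.symm⟩

lemma one_le_left (hp : 1 ≤ p) (hpp : 1 / p = 1 / p₁ + 1 / p₂) : 1 ≤ p₁ := by
  have h : 1 / p₁ ≤ 1 / p := by rw [hpp]; exact le_self_add
  simp only [one_div, ENNReal.inv_le_inv] at h
  exact hp.trans h

lemma one_le_right (hp : 1 ≤ p) (hpp : 1 / p = 1 / p₁ + 1 / p₂) : 1 ≤ p₂ := by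
  have h : 1 / p₂ ≤ 1 / p := by rw [hpp]; exact le_add_self
  simp only [one_div, ENNReal.inv_le_inv] at h
  exact hp.trans h

lemma isFun_product_toFun (hp : 1 ≤ p) (hpp : 1 / p = 1 / p₁ + 1 / p₂)
    {f g : 𝓢'(Space N, ℂ)} (hf : normLp p₂ f < ∞) (hg : normLp p₁ g < ∞) :
    IsFun (product f g) (fun x => toFun f x * toFun g x) := by
  have := holderTriple hpp
  exact isFun_ofFun hp ((memLp_toFun hg).mul' (memLp_toFun hf))

lemma isFun_product (hp : 1 ≤ p) (hpp : 1 / p = 1 / p₁ + 1 / p₂)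
    {f g : 𝓢'(Space N, ℂ)} (hf : normLp p₂ f < ∞) (hg : normLp p₁ g < ∞)
    {u v : Space N → ℂ} (hu : IsFun f u) (hv : IsFun g v) :
    IsFun (product f g) (fun x => u x * v x) := by
  refine (isFun_product_toFun hp hpp hf hg).congr_ae ?_
  filter_upwards [(isFun_toFun ⟨u, hu⟩).ae_eq hu, (isFun_toFun ⟨v, hv⟩).ae_eq hv] with x h1 h2
  rw [h1, h2]

lemma normLp_product_le (hp : 1 ≤ p) (hpp : 1 / p = 1 / p₁ + 1 / p₂)
    {f g : 𝓢'(Space N, ℂ)} (hf : normLp p₂ f < ∞) (hg : normLp p₁ g < ∞) :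
    normLp p (product f g) ≤ normLp p₂ f * normLp p₁ g := by
  have := holderTriple hpp
  have hu := isFun_toFun_of_normLp hf
  have hv := isFun_toFun_of_normLp hg
  rw [(isFun_product hp hpp hf hg hu hv).normLp_eq p, hu.normLp_eq, hv.normLp_eq]
  exact eLpNorm_smul_le_mul_eLpNorm (p := p₂) (q := p₁) (r := p) (f := toFun g) (φ := toFun f)
    hv.aestronglyMeasurable hu.aestronglyMeasurable

lemma product_sub (hp : 1 ≤ p) (hpp : 1 / p = 1 / p₁ + 1 / p₂)
    {f g g' : 𝓢'(Space N, ℂ)} (hf : normLp p₂ f < ∞) (hg : normLp p₁ g < ∞)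
    (hg' : normLp p₁ g' < ∞) : product f (g - g') = product f g - product f g' := by
  have hu := isFun_toFun_of_normLp hf
  have hv := isFun_toFun_of_normLp hg
  have hv' := isFun_toFun_of_normLp hg'
  have hs : normLp p₁ (g - g') < ∞ :=
    (normLp_sub_le (one_le_left hp hpp) g g').trans_lt (ENNReal.add_lt_top.2 ⟨hg, hg'⟩)
  refine (isFun_product hp hpp hf hs hu (hv.sub hv')).eq ?_
  convert (isFun_product hp hpp hf hg hu hv).sub (isFun_product hp hpp hf hg' hu hv') using 1
  funext x
  simp only [Pi.sub_apply]
  ring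

lemma sub_product (hp : 1 ≤ p) (hpp : 1 / p = 1 / p₁ + 1 / p₂)
    {f f' g : 𝓢'(Space N, ℂ)} (hf : normLp p₂ f < ∞) (hf' : normLp p₂ f' < ∞)
    (hg : normLp p₁ g < ∞) : product (f - f') g = product f g - product f' g := by
  have hu := isFun_toFun_of_normLp hf
  have hu' := isFun_toFun_of_normLp hf'
  have hv := isFun_toFun_of_normLp hg
  have hs : normLp p₂ (f - f') < ∞ :=
    (normLp_sub_le (one_le_right hp hpp) f f').trans_lt (ENNReal.add_lt_top.2 ⟨hf, hf'⟩)
  refine (isFun_product hp hpp hs hg (hu.sub hu') hv).eq ?_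
  convert (isFun_product hp hpp hf hg hu hv).sub (isFun_product hp hpp hf' hg hu' hv) using 1
  funext x
  simp only [Pi.sub_apply]
  ring

lemma isProduct_product (hp : 1 ≤ p) (hpp : 1 / p = 1 / p₁ + 1 / p₂)
    {f g : 𝓢'(Space N, ℂ)} (hf : normLp p₂ f < ∞) (hg : normLp p₁ g < ∞) :
    IsProduct f g (product f g) :=
  ⟨_, _, isFun_toFun_of_normLp hf, isFun_toFun_of_normLp hg, isFun_product_toFun hp hpp hf hg⟩

end Product

/-- Holds for every `f`: if `f` is not a function, `toFun f` is zero by convention. -/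
lemma product_zero (f : 𝓢'(Space N, ℂ)) : product f 0 = 0 := by
  have h0 : toFun (0 : 𝓢'(Space N, ℂ)) =ᵐ[volume] 0 :=
    (isFun_toFun ⟨0, IsFun.zero⟩).ae_eq IsFun.zero
  have h1 : IsFun (0 : 𝓢'(Space N, ℂ)) (fun x => toFun f x * toFun (0 : 𝓢'(Space N, ℂ)) x) := by
    refine IsFun.zero.congr_ae ?_
    filter_upwards [h0] with x hx
    rw [hx]; simp
  have h2 : IsFun (product f 0) (fun x => toFun f x * toFun (0 : 𝓢'(Space N, ℂ)) x) := by
    rw [product, ofFun, dif_pos ⟨_, h1⟩]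
    exact Exists.choose_spec (⟨_, h1⟩ : ∃ F, IsFun F _)
  exact h2.eq h1

/-! ### Commutators with an almost everywhere Lipschitz function -/

/-- The commutator of a Fourier multiplier with multiplication by an (almost everywhere) Lipschitz
function gains the first moment of the convolution kernel. -/
lemma normLp_commutator_le {r : ℝ≥0∞} (hr : 1 ≤ r) {u v : Space N → ℂ} {w P Q : 𝓢'(Space N, ℂ)}
    {Λ : ℝ≥0∞} (hLip : ∀ᵐ x, ∀ᵐ y, ‖u x - u y‖ₑ ≤ Λ * ‖x - y‖ₑ)
    (σ : 𝓢(Space N, ℂ)) (hw : IsFun w v) (hP : IsFun P fun x => u x * v x)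
    (hQ : IsFun Q fun x => u x * w (translate x (𝓕 σ))) :
    normLp r (Q - TemperedDistribution.fourierMultiplierCLM ℂ σ P) ≤
      Λ * (∫⁻ z, ‖𝓕 σ z‖ₑ * ‖z‖ₑ) * normLp r w := by
  set κ := 𝓕 σ
  have hd := hQ.sub (isFun_fourierMultiplier σ P)
  rw [hd.normLp_eq, hw.normLp_eq]
  set ν := (volume : Measure (Space N)).withDensity fun z => Λ * (‖κ z‖ₑ * ‖z‖ₑ)
  have hm : Measurable fun z : Space N => Λ * (‖κ z‖ₑ * ‖z‖ₑ) :=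
    (κ.continuous.enorm.measurable.mul continuous_id.enorm.measurable).const_mul _
  have hνuniv : ν Set.univ = Λ * ∫⁻ z, ‖κ z‖ₑ * ‖z‖ₑ := by
    rw [withDensity_apply _ MeasurableSet.univ, Measure.restrict_univ, lintegral_const_mul]
    exact κ.continuous.enorm.measurable.mul continuous_id.enorm.measurable
  have hle : ∀ᵐ x, ‖(u x * w (translate x κ)) - P (translate x κ)‖ₑ ≤
      ∫⁻ z, ‖v (x + z)‖ₑ ∂ν := by
    filter_upwards [hLip] with x hx
    have hx' : ∀ᵐ z, ‖u x - u (x + z)‖ₑ ≤ Λ * ‖x - (x + z)‖ₑ :=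
      (quasiMeasurePreserving_add_left volume x).ae hx
    have hi1 : Integrable fun z => κ z * v (x + z) := by
      have := ((hw (translate x κ)).1).comp_add_left x
      simpa [translate_apply] using this
    have hi2 : Integrable fun z => κ z * (u (x + z) * v (x + z)) := by
      have := ((hP (translate x κ)).1).comp_add_left x
      simpa [translate_apply] using this
    rw [hw.apply_translate, hP.apply_translate, ← integral_const_mul,
      ← integral_sub (hi1.const_mul _) hi2]
    rw [lintegral_withDensity_eq_lintegral_mul₀' hm.aemeasurable]
    · refine (enorm_integral_le_lintegral_enorm _).trans (lintegral_mono_ae ?_)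
      filter_upwards [hx'] with z hz
      have h1 : u x * (κ z * v (x + z)) - κ z * (u (x + z) * v (x + z)) =
          (u x - u (x + z)) * (κ z * v (x + z)) := by ring
      have h2 : ‖x - (x + z)‖ₑ = ‖z‖ₑ := by simp
      rw [h1, enorm_mul, enorm_mul]
      rw [h2] at hz
      calc ‖u x - u (x + z)‖ₑ * (‖κ z‖ₑ * ‖v (x + z)‖ₑ)
          ≤ (Λ * ‖z‖ₑ) * (‖κ z‖ₑ * ‖v (x + z)‖ₑ) := by gcongr
        _ = Λ * (‖κ z‖ₑ * ‖z‖ₑ) * ‖v (x + z)‖ₑ := by ring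
    · refine AEMeasurable.mono_ac ?_ (withDensity_absolutelyContinuous _ _)
      exact hw.aestronglyMeasurable.enorm.comp_quasiMeasurePreserving
        (quasiMeasurePreserving_add_left volume x)
  refine (eLpNorm_mono_enorm_ae (g := fun x => ∫⁻ z, ‖v (x + z)‖ₑ ∂ν) ?_).trans ?_
  · filter_upwards [hle] with x hx
    simpa using hx
  · refine (eLpNorm_lintegral_translate_le volume ν (withDensity_absolutelyContinuous _ _)
      (w := fun x => ‖v x‖ₑ) hw.aestronglyMeasurable.enorm hr).trans_eq ?_
    rw [hνuniv, eLpNorm_enorm]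

end

/-! ### Products of low-frequency distributions -/

section

variable {N : ℕ}

open LineDeriv FourierTransform

lemma fourier_iteratedLineDerivOp_eq_zero {n : ℕ} (m : Fin n → Space N) {κ : 𝓢(Space N, ℂ)}
    {ξ : Space N} (h : 𝓕 κ ξ = 0) : 𝓕 (∂^{m} κ) ξ = 0 := by
  induction n with
  | zero => exact h
  | succ n ih =>
    rw [iteratedLineDerivOp_succ_left, fourier_lineDerivOp_eq, _root_.smul_apply,
      smulLeftCLM_apply_apply (hasTemperateGrowth_inner _), ih, smul_zero, smul_zero]

lemma fourier_fourier_apply (σ : 𝓢(Space N, ℂ)) (ξ : Space N) : 𝓕 (𝓕 σ) ξ = σ (-ξ) := by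
  have h : 𝓕⁻ (𝓕 σ) (-ξ) = σ (-ξ) := by rw [FourierTransform.fourierInv_fourier_eq]
  rw [← h, fourier_coe (𝓕 σ), fourierInv_coe, Real.fourierInv_eq_fourier_neg, neg_neg]

/-- The reflected translate `x ↦ κ (y - x)`. -/
def reflect (y : Space N) (κ : 𝓢(Space N, ℂ)) : 𝓢(Space N, ℂ) :=
  translate y (compCLMOfContinuousLinearEquiv ℂ
    (LinearIsometryEquiv.neg ℝ (E := Space N)).toContinuousLinearEquiv κ)

lemma reflect_apply (y : Space N) (κ : 𝓢(Space N, ℂ)) (x : Space N) :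
    reflect y κ x = κ (y - x) := by
  change κ (-(x - y)) = _
  rw [neg_sub]

lemma fourierInv_reflect_eq_zero {κ : 𝓢(Space N, ℂ)} {ξ : Space N} (h : 𝓕 κ ξ = 0)
    (y : Space N) : 𝓕⁻ (reflect y κ) ξ = 0 := by
  rw [fourierInv_coe, Real.fourierInv_eq, ← integral_sub_left_eq_self _ volume y]
  simp only [reflect_apply, sub_sub_cancel, inner_sub_left]
  rw [fourier_coe, Real.fourier_eq] at h
  have : ∀ x, Real.fourierChar (inner ℝ y ξ - inner ℝ x ξ) • κ x =
      Real.fourierChar (inner ℝ y ξ) • (Real.fourierChar (-inner ℝ x ξ) • κ x) := fun x => by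
    rw [smul_smul, sub_eq_add_neg, AddChar.map_add_eq_mul]
  simp only [this]
  simp only [Circle.smul_def] at h ⊢
  rw [integral_smul, h, smul_zero]

/-- A multiplier localised in `‖ξ‖ < ρ` annihilates, when tested against it, the product of a
Schwartz function with frequencies above `2 * ρ` and one with frequencies below `ρ`. -/
lemma fourierMultiplier_apply_eq_zero (F : 𝓢'(Space N, ℂ)) {ρ : ℝ} {σ χ B θ : 𝓢(Space N, ℂ)}
    (hσ : ∀ ξ, ρ ≤ ‖ξ‖ → σ ξ = 0) (hχ : ∀ ξ, ‖ξ‖ < 2 * ρ → χ ξ = 0)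
    (hB : ∀ ξ, ρ ≤ ‖ξ‖ → B ξ = 0) (hθ : ∀ x, θ x = 𝓕 χ x * 𝓕 B x) :
    TemperedDistribution.fourierMultiplierCLM ℂ σ F θ = 0 := by
  have hθ' : θ = 𝓕 (conv χ B) := by
    rw [conv, fourier_convolution]
    ext x
    rw [hθ]; rfl
  have h0 : smulLeftCLM ℂ σ (𝓕⁻ θ) = 0 := by
    ext ξ
    rw [smulLeftCLM_apply_apply σ.hasTemperateGrowth, hθ', FourierTransform.fourierInv_fourier_eq,
      conv_apply]
    rcases le_or_gt ρ ‖ξ‖ with hξ | hξ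
    · rw [hσ ξ hξ, zero_smul]; rfl
    · have : ∀ x, χ x * B (ξ - x) = 0 := by
        intro x
        rcases lt_or_ge ‖x‖ (2 * ρ) with hx | hx
        · rw [hχ x hx, zero_mul]
        · rw [hB, mul_zero]
          have := norm_sub_norm_le x ξ
          rw [norm_sub_rev] at this
          linarith
      simp only [this, integral_zero, smul_zero]
      rfl
  rw [TemperedDistribution.fourierMultiplierCLM_apply_apply, h0]
  rw [show 𝓕 (0 : 𝓢(Space N, ℂ)) = 0 from map_zero (fourierCLM ℂ 𝓢(Space N, ℂ)), map_zero]

/-- The product of two distributions with frequencies below `ρ` has frequencies below `2 * ρ`: it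
vanishes on Schwartz functions with higher frequencies. -/
lemma integral_low_mul_low_eq_zero (F G : 𝓢'(Space N, ℂ)) {ρ : ℝ} {σ χ : 𝓢(Space N, ℂ)}
    (hσ : ∀ ξ, ρ ≤ ‖ξ‖ → σ ξ = 0) (hχ : ∀ ξ, ‖ξ‖ < 2 * ρ → χ ξ = 0) :
    ∫ x, 𝓕 χ x * (F (translate x (𝓕 σ)) * G (translate x (𝓕 σ))) = 0 := by
  set κ := 𝓕 σ
  obtain ⟨C, k, hC⟩ := exists_norm_apply_translate_le F κ
  have hcont := continuous_apply_translate F κ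
  have hC0 : 0 ≤ C := by
    have := hC 0
    simp only [norm_zero, add_zero, one_pow, mul_one] at this
    exact (norm_nonneg _).trans this
  -- the integral is `G` applied to `∫ 𝓕 χ(x) F(τ_x κ) κ(· - x) dx`, and this function is zero
  have key := apply_eq_integral_translate volume G κ 0 (fun x => 𝓕 χ x * F (translate x κ)) id
    continuous_id ((𝓕 χ).continuous.mul hcont).aestronglyMeasurable ?_ ?_
  · have h := key.2
    rw [map_zero] at h
    rw [h]
    exact integral_congr_ae (Filter.Eventually.of_forall fun x => by simp only [id, mul_assoc])
  · intro j
    refine ((integrable_norm_mul_one_add_pow (𝓕 χ) (k + j)).const_mul C).mono'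
      ((((𝓕 χ).continuous.mul hcont).norm.mul (by fun_prop)).aestronglyMeasurable) ?_
    refine Filter.Eventually.of_forall fun x => ?_
    rw [norm_mul, norm_norm, norm_mul, norm_pow, Real.norm_of_nonneg (by positivity), id]
    calc ‖𝓕 χ x‖ * ‖F (translate x κ)‖ * (1 + ‖x‖) ^ j
        ≤ ‖𝓕 χ x‖ * (C * (1 + ‖x‖) ^ k) * (1 + ‖x‖) ^ j := by gcongr; exact hC x
      _ = C * (‖𝓕 χ x‖ * (1 + ‖x‖) ^ (k + j)) := by rw [pow_add]; ring
  · intro n m y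
    have hzero : (∂^{m} (0 : 𝓢(Space N, ℂ))) y = 0 := by
      rw [iteratedLineDerivOp_zero]; rfl
    rw [hzero]
    -- the frequencies of `θ` are those of `𝓕 χ`, shifted by less than `ρ`
    set lam := reflect y (∂^{m} κ)
    let θ : 𝓢(Space N, ℂ) := pairing (ContinuousLinearMap.mul ℂ ℂ) (𝓕 χ) lam
    have hθ : TemperedDistribution.fourierMultiplierCLM ℂ σ F θ = 0 := by
      refine fourierMultiplier_apply_eq_zero F (B := 𝓕⁻ lam) hσ hχ (fun ξ hξ => ?_) fun x => ?_
      · refine fourierInv_reflect_eq_zero (fourier_iteratedLineDerivOp_eq_zero m ?_) y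
        rw [fourier_fourier_apply]
        exact hσ _ (by rwa [norm_neg])
      · rw [FourierTransform.fourier_fourierInv_eq]; rfl
    rw [((isFun_fourierMultiplier σ F) θ).2] at hθ
    rw [← hθ]
    refine integral_congr_ae (Filter.Eventually.of_forall fun x => ?_)
    have : θ x = 𝓕 χ x * (∂^{m} κ) (y - x) := by
      change 𝓕 χ x * lam x = _
      rw [reflect_apply]
    simp only [this, id]
    ring

variable (φ : Cutoff N)

/-- The block `Δ_q` does not see the product of the low-frequency parts at frequency `2^(q-2)`. -/
lemma block_low_mul_low (F G P : 𝓢'(Space N, ℂ)) (q : ℤ)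
    (hP : IsFun P fun x => F (translate x (φ.kernel (q - 2))) * G (translate x (φ.kernel (q - 2)))) :
    block φ q P = 0 := by
  rcases lt_or_ge (q - 2) 0 with hq | hq
  · rw [kernel_of_neg φ hq] at hP
    have h0 : (fun x => F (translate x (0 : 𝓢(Space N, ℂ))) * G (translate x 0)) = 0 := by
      funext x
      rw [show translate x (0 : 𝓢(Space N, ℂ)) = 0 from map_zero (compSubConstCLM ℂ x), map_zero,
        zero_mul]
      rfl
    rw [h0] at hP
    rw [hP.eq IsFun.zero, map_zero]
  ext η
  have h1 : block φ q P η =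
      P (𝓕 (smulLeftCLM ℂ (⇑(φ.lowSymbol (q + 1) - φ.lowSymbol q)) (𝓕⁻ η))) := by
    rw [block_eq_fourierMultiplier, TemperedDistribution.fourierMultiplierCLM_apply_apply]
  rw [h1, (hP _).2]
  refine integral_low_mul_low_eq_zero F G (ρ := 4 / 3 * 2 ^ (q - 2))
    (fun ξ hξ => φ.lowSymbol_eq_zero hξ) fun ξ hξ => ?_
  have h2 : (2 : ℝ) ^ (q - 1) = 2 ^ (q - 2) * 2 := by
    rw [← zpow_add_one₀ two_ne_zero]; congr 1; ring
  rw [smulLeftCLM_apply_apply (SchwartzMap.hasTemperateGrowth _),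
    φ.symbol_eq_zero_of_le (m := q - 1) (by omega) (by rw [h2]; linarith) (by omega), zero_smul]

/-! ### Distributions with summable blocks -/

lemma normLp_low_le {A : ℝ≥0} (hA1 : 1 ≤ A) (hA : ∀ m : ℤ, ∫⁻ x, ‖φ.kernel m x‖ₑ ≤ A)
    {p : ℝ≥0∞} (hp : 1 ≤ p) (m : ℤ) (F : 𝓢'(Space N, ℂ)) :
    normLp p (low φ m F) ≤ A * normLp p F :=
  normLp_fourierMultiplier_le _ F hp (by
    have : A ≠ 0 := (zero_lt_one.trans_le hA1).ne'
    exact_mod_cast this) (hA m)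

lemma normLp_block_le {A : ℝ≥0} (hA1 : 1 ≤ A) (hA : ∀ m : ℤ, ∫⁻ x, ‖φ.kernel m x‖ₑ ≤ A)
    {p : ℝ≥0∞} (hp : 1 ≤ p) (q : ℤ) (F : 𝓢'(Space N, ℂ)) :
    normLp p (block φ q F) ≤ 2 * A * normLp p F := by
  rw [block_eq]
  refine (normLp_sub_le hp _ _).trans ?_
  refine (add_le_add (normLp_low_le φ hA1 hA hp _ F) (normLp_low_le φ hA1 hA hp _ F)).trans_eq ?_
  ring

lemma normLp_le_tsum_block {p : ℝ≥0∞} (hp : 1 ≤ p) (F : 𝓢'(Space N, ℂ)) :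
    normLp p F ≤ ∑' n : ℕ, normLp p (block φ (-1 + n) F) := by
  have := normLp_sub_low_le φ hp (-1) F
  rwa [low_of_neg φ (by omega), sub_zero] at this

/-- If the blocks are summable in `L^p`, the low-frequency cut-offs converge in `L^p`. -/
lemma tendsto_normLp_sub_low {p : ℝ≥0∞} (hp : 1 ≤ p) {F : 𝓢'(Space N, ℂ)}
    (h : ∑' n : ℕ, normLp p (block φ (-1 + n) F) ≠ ∞) :
    Filter.Tendsto (fun n : ℕ => normLp p (F - low φ n F)) Filter.atTop (nhds 0) := by
  have h1 := (Filter.tendsto_add_atTop_iff_nat 1).2 (ENNReal.tendsto_sum_nat_add _ h)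
  refine tendsto_of_tendsto_of_tendsto_of_le_of_le tendsto_const_nhds h1 (fun _ => zero_le)
    fun n => (normLp_sub_low_le φ hp n F).trans_eq ?_
  refine tsum_congr fun i => ?_
  congr 3
  push_cast; ring

/-- A function with bounded gradient and summable blocks is Lipschitz off a null set, as an almost
everywhere limit of uniformly Lipschitz functions. -/
lemma ae_lipschitz {A : ℝ≥0} (hA : ∀ m : ℤ, ∫⁻ x, ‖φ.kernel m x‖ₑ ≤ A) {p : ℝ≥0∞} (hp : 1 ≤ p)
    {F : 𝓢'(Space N, ℂ)} {u : Space N → ℂ} (hu : IsFun F u) (hL : normGradLp ∞ F < ∞)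
    (h : ∑' n : ℕ, normLp p (block φ (-1 + n) F) ≠ ∞) :
    ∀ᵐ x, ∀ᵐ y, ‖u x - u y‖ₑ ≤ (A * normGradLp ∞ F) * ‖x - y‖ₑ := by
  have h1 : Filter.Tendsto (fun n : ℕ =>
      eLpNorm ((fun x => F (translate x (φ.kernel n))) - u) p volume) Filter.atTop (nhds 0) := by
    refine (tendsto_normLp_sub_low φ hp h).congr fun n => ?_
    rw [(hu.sub (isFun_low φ n F)).normLp_eq, ← eLpNorm_neg, neg_sub]
  obtain ⟨ns, -, hns⟩ := (tendstoInMeasure_of_tendsto_eLpNorm (zero_lt_one.trans_le hp).ne'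
    (fun n => (continuous_apply_translate F _).aestronglyMeasurable) hu.aestronglyMeasurable
    h1).exists_seq_tendsto_ae
  filter_upwards [hns] with x hx
  filter_upwards [hns] with y hy
  have h2 := (hx.sub hy).enorm
  refine le_of_tendsto h2 (Filter.Eventually.of_forall fun n => ?_)
  have h3 := norm_apply_translate_sub_le hL (φ.kernel (ns n)) x y
  have h4 : ENNReal.ofReal ‖F (translate x (φ.kernel (ns n))) - F (translate y (φ.kernel (ns n)))‖ ≤
      ENNReal.ofReal ((∫ z, ‖φ.kernel (ns n) z‖) * (normGradLp ∞ F).toReal * ‖x - y‖) :=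
    ENNReal.ofReal_le_ofReal h3
  rw [ofReal_norm, ENNReal.ofReal_mul (mul_nonneg (integral_nonneg fun _ => norm_nonneg _)
    ENNReal.toReal_nonneg), ENNReal.ofReal_mul (integral_nonneg fun _ => norm_nonneg _),
    ENNReal.ofReal_toReal hL.ne, ofReal_norm,
    ofReal_integral_norm_eq_lintegral_enorm (φ.kernel (ns n)).integrable] at h4
  refine h4.trans ?_
  gcongr
  exact hA _

end

/-! ### The commutator estimate at fixed time -/

section

variable {N : ℕ}

open LineDeriv FourierTransform

lemma two_rpow_le {x y : ℝ} (k : ℕ) (h : x ≤ y + k) : (2 : ℝ≥0∞) ^ x ≤ 2 ^ k * 2 ^ y := by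
  calc (2 : ℝ≥0∞) ^ x ≤ 2 ^ (y + k) := ENNReal.rpow_le_rpow_of_exponent_le (by simp) h
    _ = _ := by
      rw [ENNReal.rpow_add _ _ (by simp) (by simp), ENNReal.rpow_natCast, mul_comm]

/-- `A` bounds the `L¹` norms and the rescaled first moments of all low-frequency kernels. -/
structure IsKernelBound (φ : Cutoff N) (A : ℝ≥0) : Prop where
  one_le : 1 ≤ A
  norm_le : ∀ m : ℤ, ∫⁻ x, ‖φ.kernel m x‖ₑ ≤ A
  moment_le : ∀ m : ℤ, ∫⁻ x, ‖φ.kernel m x‖ₑ * ‖x‖ₑ ≤ A * (2 : ℝ≥0∞) ^ (-(m : ℝ))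

lemma exists_isKernelBound (φ : Cutoff N) : ∃ A, IsKernelBound φ A := by
  obtain ⟨A, h1, h⟩ := exists_kernel_bound φ
  exact ⟨A, h1, fun m => (h m).1, fun m => (h m).2⟩

/-- The assumptions on `f` that make multiplication by `f` map `L^{p₁}` to `L^p` and give it good
commutators: summable blocks in `L^{p₂}` and a bounded gradient. -/
structure IsGoodFactor (φ : Cutoff N) (p p₁ p₂ : ℝ≥0∞) (f : 𝓢'(Space N, ℂ)) : Prop where
  one_le : 1 ≤ p
  holder : 1 / p = 1 / p₁ + 1 / p₂
  summable : ∑' n : ℕ, normLp p₂ (block φ (-1 + n) f) ≠ ∞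
  grad : normGradLp ∞ f < ∞

/-- The commutator `f Δ_q g - Δ_q (f g)`. -/
def comm (φ : Cutoff N) (f : 𝓢'(Space N, ℂ)) (q : ℤ) (g : 𝓢'(Space N, ℂ)) : 𝓢'(Space N, ℂ) :=
  product f (block φ q g) - block φ q (product f g)

/-- The commutator `f S_m g - S_m (f g)` with a low-frequency cut-off. -/
def commLow (φ : Cutoff N) (f : 𝓢'(Space N, ℂ)) (m : ℤ) (g : 𝓢'(Space N, ℂ)) : 𝓢'(Space N, ℂ) :=
  product f (low φ m g) - low φ m (product f g)

variable {φ : Cutoff N} {A : ℝ≥0} {p p₁ p₂ : ℝ≥0∞} {f g g' : 𝓢'(Space N, ℂ)}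

namespace IsKernelBound

lemma normLp_low_lt_top (hA : IsKernelBound φ A) {r : ℝ≥0∞} (hr : 1 ≤ r) (hg : normLp r g < ∞)
    (m : ℤ) : normLp r (low φ m g) < ∞ :=
  (normLp_low_le φ hA.one_le hA.norm_le hr m g).trans_lt (ENNReal.mul_lt_top (by simp) hg)

lemma normLp_block_lt_top (hA : IsKernelBound φ A) {r : ℝ≥0∞} (hr : 1 ≤ r) (hg : normLp r g < ∞)
    (q : ℤ) : normLp r (block φ q g) < ∞ :=
  (normLp_block_le φ hA.one_le hA.norm_le hr q g).trans_lt
    (ENNReal.mul_lt_top (ENNReal.mul_lt_top (by simp) (by simp)) hg)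

end IsKernelBound

namespace IsGoodFactor

lemma one_le_left (hf : IsGoodFactor φ p p₁ p₂ f) : 1 ≤ p₁ :=
  LittlewoodPaley.one_le_left hf.one_le hf.holder

lemma one_le_right (hf : IsGoodFactor φ p p₁ p₂ f) : 1 ≤ p₂ :=
  LittlewoodPaley.one_le_right hf.one_le hf.holder

lemma normLp_lt_top (hf : IsGoodFactor φ p p₁ p₂ f) : normLp p₂ f < ∞ :=
  (normLp_le_tsum_block φ hf.one_le_right f).trans_lt hf.summable.lt_top

lemma product_sub (hf : IsGoodFactor φ p p₁ p₂ f) (hg : normLp p₁ g < ∞) (hg' : normLp p₁ g' < ∞) :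
    product f (g - g') = product f g - product f g' :=
  LittlewoodPaley.product_sub hf.one_le hf.holder hf.normLp_lt_top hg hg'

lemma comm_sub (hf : IsGoodFactor φ p p₁ p₂ f) (hA : IsKernelBound φ A) (hg : normLp p₁ g < ∞)
    (hg' : normLp p₁ g' < ∞) (q : ℤ) : comm φ f q (g - g') = comm φ f q g - comm φ f q g' := by
  rw [comm, comm, comm, map_sub, hf.product_sub (hA.normLp_block_lt_top hf.one_le_left hg q)
    (hA.normLp_block_lt_top hf.one_le_left hg' q), hf.product_sub hg hg', map_sub]
  abel

lemma comm_eq_commLow_sub (hf : IsGoodFactor φ p p₁ p₂ f) (hA : IsKernelBound φ A)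
    (hg : normLp p₁ g < ∞) (q : ℤ) :
    comm φ f q g = commLow φ f (q + 1) g - commLow φ f q g := by
  rw [comm, commLow, commLow, block_eq, block_eq,
    hf.product_sub (hA.normLp_low_lt_top hf.one_le_left hg _)
      (hA.normLp_low_lt_top hf.one_le_left hg _)]
  abel

lemma normLp_commLow_le (hf : IsGoodFactor φ p p₁ p₂ f) (hA : IsKernelBound φ A)
    (hg : normLp p₁ g < ∞) {r : ℝ≥0∞} (hr : 1 ≤ r) (m : ℤ) :
    normLp r (commLow φ f m g) ≤
      A ^ 2 * normGradLp ∞ f * (2 : ℝ≥0∞) ^ (-(m : ℝ)) * normLp r g := by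
  have hu := isFun_toFun_of_normLp hf.normLp_lt_top
  have hv := isFun_toFun_of_normLp hg
  have hlow := hA.normLp_low_lt_top hf.one_le_left hg m
  refine (normLp_commutator_le hr
    (ae_lipschitz φ hA.norm_le hf.one_le_right hu hf.grad hf.summable) (φ.lowSymbol m) hv
    (isFun_product hf.one_le hf.holder hf.normLp_lt_top hg hu hv)
    (isFun_product hf.one_le hf.holder hf.normLp_lt_top hlow hu (isFun_low φ m g))).trans ?_
  calc (A : ℝ≥0∞) * normGradLp ∞ f * (∫⁻ z, ‖φ.kernel m z‖ₑ * ‖z‖ₑ) * normLp r g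
      ≤ A * normGradLp ∞ f * (A * (2 : ℝ≥0∞) ^ (-(m : ℝ))) * normLp r g := by
        gcongr; exact hA.moment_le m
    _ = _ := by ring

/-- The products `f S_n g` converge weakly to `f g`: the commutators of `S_n` with `f` tend to zero
in norm, and `S_n (f g)` tends weakly to `f g`. -/
lemma tendsto_product_low (hf : IsGoodFactor φ p p₁ p₂ f) (hA : IsKernelBound φ A)
    (hg : normLp p₁ g < ∞) (η : 𝓢(Space N, ℂ)) :
    Filter.Tendsto (fun n : ℕ => product f (low φ n g) η) Filter.atTop
      (nhds (product f g η)) := by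
  obtain ⟨C, hC⟩ := exists_enorm_apply_le hf.one_le_left η
  have h0 : Filter.Tendsto (fun n : ℕ => commLow φ f n g η) Filter.atTop (nhds 0) := by
    rw [tendsto_zero_iff_enorm_tendsto_zero]
    have h1 : Filter.Tendsto (fun n : ℕ => C * (A ^ 2 * normGradLp ∞ f *
        (2 : ℝ≥0∞) ^ (-((n : ℤ) : ℝ)) * normLp p₁ g)) Filter.atTop (nhds 0) := by
      have h2 : Filter.Tendsto (fun n : ℕ => (2 : ℝ≥0∞) ^ (-((n : ℤ) : ℝ))) Filter.atTop
          (nhds 0) := by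
        have : ∀ n : ℕ, (2 : ℝ≥0∞) ^ (-((n : ℤ) : ℝ)) = (2⁻¹ : ℝ≥0∞) ^ n := fun n => by
          rw [ENNReal.rpow_neg, ← ENNReal.inv_pow, Int.cast_natCast, ENNReal.rpow_natCast]
        simp only [this]
        exact ENNReal.tendsto_pow_atTop_nhds_zero_of_lt_one (by simp)
      have h3 : (C : ℝ≥0∞) * (A ^ 2 * normGradLp ∞ f * normLp p₁ g) ≠ ∞ :=
        (ENNReal.mul_lt_top (by simp) (ENNReal.mul_lt_top (ENNReal.mul_lt_top
          (ENNReal.pow_lt_top (by simp)) hf.grad) hg)).ne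
      have := ENNReal.Tendsto.const_mul h2 (Or.inr h3)
      rw [mul_zero] at this
      refine this.congr fun n => ?_
      ring
    refine tendsto_of_tendsto_of_tendsto_of_le_of_le tendsto_const_nhds h1 (fun _ => zero_le)
      fun n => ?_
    have hle := hf.normLp_commLow_le hA hg hf.one_le_left n
    have hlt : normLp p₁ (commLow φ f n g) < ∞ := hle.trans_lt
      (ENNReal.mul_lt_top (ENNReal.mul_lt_top (ENNReal.mul_lt_top
          (ENNReal.pow_lt_top (by simp)) hf.grad)
        (ENNReal.rpow_ne_top_of_ne_zero (by simp) (by simp)).lt_top) hg)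
    exact (hC _ hlt).trans (by gcongr)
  have h4 := h0.add (tendsto_low φ (product f g) η)
  rw [zero_add] at h4
  refine h4.congr fun n => ?_
  change (product f (low φ n g) η - low φ n (product f g) η) + _ = _
  rw [sub_add_cancel]

lemma tendsto_comm_low (hf : IsGoodFactor φ p p₁ p₂ f) (hA : IsKernelBound φ A)
    (hg : normLp p₁ g < ∞) (q : ℤ) (η : 𝓢(Space N, ℂ)) :
    Filter.Tendsto (fun n : ℕ => comm φ f q (low φ n g) η) Filter.atTop
      (nhds (comm φ f q g η)) := by
  have h1 := hf.tendsto_product_low hA (hA.normLp_block_lt_top hf.one_le_left hg q) η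
  have h2 := hf.tendsto_product_low hA hg (𝓕 (smulLeftCLM ℂ (φ.symbol q) (𝓕⁻ η)))
  refine (h1.sub h2).congr fun n => ?_
  rw [low_block_comm]
  rfl

lemma tendsto_sum_comm_block (hf : IsGoodFactor φ p p₁ p₂ f) (hA : IsKernelBound φ A)
    (hg : normLp p₁ g < ∞) (q m : ℤ) (η : 𝓢(Space N, ℂ)) :
    Filter.Tendsto (fun n => ∑ i ∈ Finset.range n, comm φ f q (block φ (m + i) g) η) Filter.atTop
      (nhds ((comm φ f q g - comm φ f q (low φ m g)) η)) := by
  have hlow := fun k => hA.normLp_low_lt_top hf.one_le_left hg k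
  have h1 : ∀ n : ℕ, ∑ i ∈ Finset.range n, comm φ f q (block φ (m + i) g) η =
      comm φ f q (low φ (m + n) g) η - comm φ f q (low φ m g) η := by
    intro n
    induction n with
    | zero => simp
    | succ n ih =>
      rw [Finset.sum_range_succ, ih, block_eq, hf.comm_sub hA (hlow _) (hlow _)]
      change _ + (comm φ f q (low φ (m + n + 1) g) η - comm φ f q (low φ (m + n) g) η) = _
      push_cast
      rw [← add_assoc]; ring
  simp only [h1]
  refine Filter.Tendsto.sub_const ?_ _
  exact tendsto_int_shift (a := fun k => comm φ f q (low φ k g) η)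
    (hf.tendsto_comm_low hA hg q η) m

/-- The low frequencies of `g`: only the frequencies of `f` above `2^(q-2)` contribute. -/
lemma normLp_comm_low_le (hf : IsGoodFactor φ p p₁ p₂ f) (hA : IsKernelBound φ A)
    (hg : normLp p₁ g < ∞) (q : ℤ) :
    normLp p (comm φ f q (low φ (q - 2) g)) ≤
      2 * A ^ 2 * (normLp p₁ g * ∑' n : ℕ, normLp p₂ (block φ (q - 2 + n) f)) := by
  have hlg := hA.normLp_low_lt_top hf.one_le_left hg (q - 2)
  have hlf := hA.normLp_low_lt_top hf.one_le_right hf.normLp_lt_top (q - 2)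
  have hff : normLp p₂ (f - low φ (q - 2) f) < ∞ :=
    (normLp_sub_le hf.one_le_right _ _).trans_lt (ENNReal.add_lt_top.2 ⟨hf.normLp_lt_top, hlf⟩)
  have h1 : comm φ f q (low φ (q - 2) g) =
      -block φ q (product (f - low φ (q - 2) f) (low φ (q - 2) g)) := by
    rw [comm, block_low_eq_zero φ (by omega), product_zero, zero_sub,
      sub_product hf.one_le hf.holder hf.normLp_lt_top hlf hlg, map_sub,
      block_low_mul_low φ f g (product (low φ (q - 2) f) (low φ (q - 2) g)) q
        (isFun_product hf.one_le hf.holder hlf hlg (isFun_low φ _ f) (isFun_low φ _ g)), sub_zero]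
  rw [h1, normLp_neg]
  calc normLp p (block φ q (product (f - low φ (q - 2) f) (low φ (q - 2) g)))
      ≤ 2 * A * (normLp p₂ (f - low φ (q - 2) f) * normLp p₁ (low φ (q - 2) g)) :=
        (normLp_block_le φ hA.one_le hA.norm_le hf.one_le q _).trans
          (by gcongr; exact normLp_product_le hf.one_le hf.holder hff hlg)
    _ ≤ 2 * A * ((∑' n : ℕ, normLp p₂ (block φ (q - 2 + n) f)) * (A * normLp p₁ g)) := by
        gcongr
        · exact normLp_sub_low_le φ hf.one_le_right _ f
        · exact normLp_low_le φ hA.one_le hA.norm_le hf.one_le_left _ g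
    _ = _ := by ring

/-- The single blocks of `g` at frequencies above `2^(q-2)`. For `j ≥ q + 3` the block `Δ_q` only
sees `S_{j-1}` of the product, and `S_{j-1} Δ_j g = 0`. -/
lemma normLp_comm_block_le (hf : IsGoodFactor φ p p₁ p₂ f) (hA : IsKernelBound φ A)
    (hg : normLp p₁ g < ∞) {q j : ℤ} (hj : q - 2 ≤ j) :
    normLp p (comm φ f q (block φ j g)) ≤ 8 * A ^ 3 *
      (normGradLp ∞ f * ((2 : ℝ≥0∞) ^ (-(j : ℝ)) * normLp p (block φ j g))) := by
  have hw := hA.normLp_block_lt_top hf.one_le_left hg j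
  have hA1 : (1 : ℝ≥0∞) ≤ A := by exact_mod_cast hA.one_le
  have hjr : (q : ℝ) - 2 ≤ j := by exact_mod_cast hj
  rcases le_or_gt j (q + 2) with h | h
  · have hjr' : (j : ℝ) ≤ q + 2 := by exact_mod_cast h
    -- `Δ_q = S_{q+1} - S_q`, and `2^{-q}` is comparable to `2^{-j}` in this range
    rw [hf.comm_eq_commLow_sub hA hw]
    refine (normLp_sub_le hf.one_le _ _).trans ((add_le_add (hf.normLp_commLow_le hA hw hf.one_le _)
      (hf.normLp_commLow_le hA hw hf.one_le _)).trans ?_)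
    have h1 : (2 : ℝ≥0∞) ^ (-((q + 1 : ℤ) : ℝ)) ≤ 2 ^ 2 * 2 ^ (-(j : ℝ)) :=
      two_rpow_le 2 (by push_cast; linarith)
    have h2 : (2 : ℝ≥0∞) ^ (-(q : ℝ)) ≤ 2 ^ 2 * 2 ^ (-(j : ℝ)) :=
      two_rpow_le 2 (by push_cast; linarith)
    calc _ ≤ A ^ 2 * normGradLp ∞ f * (2 ^ 2 * (2 : ℝ≥0∞) ^ (-(j : ℝ))) * normLp p (block φ j g) +
          A ^ 2 * normGradLp ∞ f * (2 ^ 2 * (2 : ℝ≥0∞) ^ (-(j : ℝ))) * normLp p (block φ j g) := by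
          gcongr
      _ = 8 * (A ^ 2 * 1) * (normGradLp ∞ f * ((2 : ℝ≥0∞) ^ (-(j : ℝ)) * normLp p (block φ j g))) := by
          ring
      _ ≤ 8 * (A ^ 2 * A) *
          (normGradLp ∞ f * ((2 : ℝ≥0∞) ^ (-(j : ℝ)) * normLp p (block φ j g))) := by
          gcongr
      _ = _ := by ring
  · -- here `[f, Δ_q] Δ_j g = Δ_q [f, S_{j-1}] Δ_j g`
    have h0 : low φ (j - 1) (block φ j g) = 0 := by
      rw [low_block_comm, block_low_eq_zero φ (by omega)]
    have h1 : block φ q (block φ j g) = 0 := by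
      rw [← block_low_eq_self φ (le_refl (q + 2)), low_block_comm,
        block_low_eq_zero φ (by omega), map_zero]
    have h2 : comm φ f q (block φ j g) = block φ q (commLow φ f (j - 1) (block φ j g)) := by
      rw [comm, commLow, h1, h0, product_zero, zero_sub, zero_sub, map_neg,
        block_low_eq_self φ (by omega)]
    rw [h2]
    have h3 : (2 : ℝ≥0∞) ^ (-((j - 1 : ℤ) : ℝ)) ≤ 2 ^ 2 * 2 ^ (-(j : ℝ)) :=
      two_rpow_le 2 (by push_cast; linarith)
    calc normLp p (block φ q (commLow φ f (j - 1) (block φ j g)))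
        ≤ 2 * A * (A ^ 2 * normGradLp ∞ f * (2 : ℝ≥0∞) ^ (-((j - 1 : ℤ) : ℝ)) *
            normLp p (block φ j g)) :=
          (normLp_block_le φ hA.one_le hA.norm_le hf.one_le q _).trans
            (by gcongr; exact hf.normLp_commLow_le hA hw hf.one_le _)
      _ ≤ 2 * A * (A ^ 2 * normGradLp ∞ f * (2 ^ 2 * (2 : ℝ≥0∞) ^ (-(j : ℝ))) *
            normLp p (block φ j g)) := by gcongr
      _ = _ := by ring

/-- The commutator estimate at fixed time, before any summation in `q`. -/
lemma normLp_comm_le (hf : IsGoodFactor φ p p₁ p₂ f) (hA : IsKernelBound φ A)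
    (hg : normLp p₁ g < ∞) (q : ℤ) :
    normLp p (comm φ f q g) ≤ 8 * A ^ 3 *
      (normGradLp ∞ f * ∑' n : ℕ, (2 : ℝ≥0∞) ^ (-((q - 2 + n : ℤ) : ℝ)) *
          normLp p (block φ (q - 2 + n) g) +
        normLp p₁ g * ∑' n : ℕ, normLp p₂ (block φ (q - 2 + n) f)) := by
  have hA1 : (1 : ℝ≥0∞) ≤ A := by exact_mod_cast hA.one_le
  have h1 : comm φ f q g =
      (comm φ f q g - comm φ f q (low φ (q - 2) g)) + comm φ f q (low φ (q - 2) g) := by abel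
  have h2 : normLp p (comm φ f q g - comm φ f q (low φ (q - 2) g)) ≤ 8 * A ^ 3 *
      (normGradLp ∞ f * ∑' n : ℕ, (2 : ℝ≥0∞) ^ (-((q - 2 + n : ℤ) : ℝ)) *
          normLp p (block φ (q - 2 + n) g)) := by
    refine (normLp_le_tsum hf.one_le (hf.tendsto_sum_comm_block hA hg q (q - 2))).trans ?_
    rw [← ENNReal.tsum_mul_left, ← ENNReal.tsum_mul_left]
    exact ENNReal.tsum_le_tsum fun n => hf.normLp_comm_block_le hA hg (by omega)
  have h3 : (2 : ℝ≥0∞) * (A : ℝ≥0∞) ^ 2 ≤ 8 * (A : ℝ≥0∞) ^ 3 := by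
    calc (2 : ℝ≥0∞) * (A : ℝ≥0∞) ^ 2 = 2 * ((A : ℝ≥0∞) ^ 2 * 1) := by ring
      _ ≤ 8 * ((A : ℝ≥0∞) ^ 2 * A) := by gcongr; norm_num
      _ = _ := by ring
  rw [h1, mul_add]
  exact (normLp_add_le hf.one_le _ _).trans
    (add_le_add h2 ((hf.normLp_comm_low_le hA hg q).trans (by gcongr)))

lemma isCommutator_comm (hf : IsGoodFactor φ p p₁ p₂ f) (hA : IsKernelBound φ A)
    (hg : normLp p₁ g < ∞) (q : ℤ) : IsCommutator φ f q g (comm φ f q g) :=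
  ⟨_, _, isProduct_product hf.one_le hf.holder hf.normLp_lt_top hg,
    isProduct_product hf.one_le hf.holder hf.normLp_lt_top
      (hA.normLp_block_lt_top hf.one_le_left hg q), rfl⟩

end IsGoodFactor

end

/-! ### From dyadic sums to Besov norms -/

section

lemma two_rpow_add (x y : ℝ) : (2 : ℝ≥0∞) ^ (x + y) = 2 ^ x * 2 ^ y :=
  ENNReal.rpow_add _ _ (by simp) (by simp)

lemma tsum_two_rpow_ne_top {σ : ℝ} (hσ : 0 < σ) (x : ℝ) :
    ∑' n : ℕ, (2 : ℝ≥0∞) ^ ((x - n) * σ) ≠ ∞ := by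
  have h : ∀ n : ℕ, (2 : ℝ≥0∞) ^ ((x - n) * σ) = 2 ^ (x * σ) * ((2 : ℝ≥0∞) ^ (-σ)) ^ n := by
    intro n
    rw [← ENNReal.rpow_natCast, ← ENNReal.rpow_mul, ← two_rpow_add]
    congr 1; ring
  simp only [h]
  rw [ENNReal.tsum_mul_left, ENNReal.tsum_geometric]
  refine ENNReal.mul_ne_top (ENNReal.rpow_ne_top_of_ne_zero (by simp) (by simp)) ?_
  rw [ENNReal.inv_ne_top]
  refine (tsub_pos_of_lt ?_).ne'
  exact ENNReal.rpow_lt_one_of_one_lt_of_neg (by norm_num) (by linarith)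

/-- The blocks of an element of a Besov space of positive regularity are summable. -/
lemma tsum_ne_top_of_normSeq_lt_top {r : ℝ≥0∞} (hr : 1 ≤ r) {σ : ℝ} (hσ : 0 < σ) (a : ℤ → ℝ≥0∞)
    (h : normSeq r (fun q : {q : ℤ // -1 ≤ q} => (2 : ℝ≥0∞) ^ ((q : ℤ) * σ : ℝ) * a q) < ∞) :
    ∑' n : ℕ, a (-1 + n) ≠ ∞ := by
  set X := normSeq r (fun q : {q : ℤ // -1 ≤ q} => (2 : ℝ≥0∞) ^ ((q : ℤ) * σ : ℝ) * a q)
  have hle : ∀ n : ℕ, a (-1 + n) ≤ (2 : ℝ≥0∞) ^ ((1 - n) * σ) * X := by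
    intro n
    have h1 := le_normSeq (zero_lt_one.trans_le hr).ne'
      (fun q : {q : ℤ // -1 ≤ q} => (2 : ℝ≥0∞) ^ ((q : ℤ) * σ : ℝ) * a q) ⟨-1 + n, by omega⟩
    calc a (-1 + n) = (2 : ℝ≥0∞) ^ ((1 - n) * σ) *
          ((2 : ℝ≥0∞) ^ (((-1 + n : ℤ) : ℝ) * σ) * a (-1 + n)) := by
          rw [← mul_assoc, ← two_rpow_add]
          have : ((1 - n) * σ + ((-1 + n : ℤ) : ℝ) * σ) = 0 := by push_cast; ring
          rw [this, ENNReal.rpow_zero, one_mul]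
      _ ≤ _ := by gcongr
  refine ne_top_of_le_ne_top ?_ (ENNReal.tsum_le_tsum hle)
  rw [ENNReal.tsum_mul_right]
  exact ENNReal.mul_ne_top (tsum_two_rpow_ne_top hσ 1) h.ne

/-- The sequence-space part of the commutator estimates: convolution with the summable weight
`2^{(2-n)(s+1)}` turns the bounds for a single block into Besov norms. -/
lemma exists_sequence_bound {r : ℝ≥0∞} (hr : 1 ≤ r) {s : ℝ} (hs : -1 < s) :
    ∃ W : ℝ≥0, ∀ (a b : ℤ → ℝ≥0∞) (L G : ℝ≥0∞), (∀ q ≤ -2, a q = 0) → (∀ q ≤ -2, b q = 0) →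
      L ≠ ∞ → G ≠ ∞ →
      normSeq r (fun q : {q : ℤ // -1 ≤ q} => (2 : ℝ≥0∞) ^ ((q : ℤ) * (s + 1) : ℝ) * a q) ≠ ∞ →
      normSeq r (fun q : {q : ℤ // -1 ≤ q} => (2 : ℝ≥0∞) ^ ((q : ℤ) * s : ℝ) * b q) ≠ ∞ →
      ∃ c : ℤ → ℝ≥0∞, normSeq r c ≤ 1 ∧ ∀ q : ℤ,
        L * ∑' n : ℕ, (2 : ℝ≥0∞) ^ (-((q - 2 + n : ℤ) : ℝ)) * b (q - 2 + n) +
            G * ∑' n : ℕ, a (q - 2 + n) ≤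
          W * c q * (2 : ℝ≥0∞) ^ (-(q * (s + 1)) : ℝ) *
            (L * normSeq r (fun q : {q : ℤ // -1 ≤ q} => (2 : ℝ≥0∞) ^ ((q : ℤ) * s : ℝ) * b q) +
             G * normSeq r
              (fun q : {q : ℤ // -1 ≤ q} => (2 : ℝ≥0∞) ^ ((q : ℤ) * (s + 1) : ℝ) * a q)) := by
  have hr0 : r ≠ 0 := (zero_lt_one.trans_le hr).ne'
  set w : ℕ → ℝ≥0∞ := fun n => (2 : ℝ≥0∞) ^ ((2 - n : ℝ) * (s + 1))
  have hw : ∑' n, w n ≠ ∞ := tsum_two_rpow_ne_top (by linarith) 2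
  refine ⟨(∑' n, w n).toNNReal, fun a b L G ha hb hL hG hA hB => ?_⟩
  rw [ENNReal.coe_toNNReal hw]
  set α : ℤ → ℝ≥0∞ := fun q => (2 : ℝ≥0∞) ^ ((q : ℤ) * (s + 1) : ℝ) * a q with hα
  set β : ℤ → ℝ≥0∞ := fun q => (2 : ℝ≥0∞) ^ ((q : ℤ) * s : ℝ) * b q with hβ
  have hA' := normSeq_subtype hr0 α fun q hq => by simp only [hα, ha q hq, mul_zero]
  have hB' := normSeq_subtype hr0 β fun q hq => by simp only [hβ, hb q hq, mul_zero]
  rw [hA'] at hA ⊢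
  rw [hB'] at hB ⊢
  set X := L * normSeq r β + G * normSeq r α
  have hX : X ≠ ∞ := ENNReal.add_ne_top.2 ⟨ENNReal.mul_ne_top hL hB, ENNReal.mul_ne_top hG hA⟩
  have he : normSeq r (fun q => L * β q + G * α q) ≤ X := by
    simp only [X, normSeq_eq_eLpNorm hr0]
    refine (eLpNorm_add_le (f := fun q => L * β q) (g := fun q => G * α q)
      (measurable_of_countable _).aestronglyMeasurable
      (measurable_of_countable _).aestronglyMeasurable hr).trans ?_
    exact add_le_add (eLpNorm_const_mul_le hr0 _ (measurable_of_countable β).aemeasurable)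
      (eLpNorm_const_mul_le hr0 _ (measurable_of_countable α).aemeasurable)
  obtain ⟨c, hc, h⟩ := exists_normSeq_le_one hr w hw _ he hX
  refine ⟨c, hc, fun q => ?_⟩
  -- every term on the left is the corresponding weighted term times `2^{-q(s+1)}`
  have h1 : ∀ n : ℕ, (2 : ℝ≥0∞) ^ (-((q - 2 + n : ℤ) : ℝ)) * b (q - 2 + n) =
      (2 : ℝ≥0∞) ^ (-(q * (s + 1)) : ℝ) * (w n * β (q - 2 + n)) := by
    intro n
    simp only [w, hβ]
    rw [← mul_assoc, ← mul_assoc, ← two_rpow_add, ← two_rpow_add]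
    congr 2
    push_cast; ring
  have h2 : ∀ n : ℕ, a (q - 2 + n) =
      (2 : ℝ≥0∞) ^ (-(q * (s + 1)) : ℝ) * (w n * α (q - 2 + n)) := by
    intro n
    simp only [w, hα]
    rw [← mul_assoc, ← mul_assoc, ← two_rpow_add, ← two_rpow_add]
    have : -(q * (s + 1)) + (2 - n : ℝ) * (s + 1) + ((q - 2 + n : ℤ) : ℝ) * (s + 1) = 0 := by
      push_cast; ring
    rw [this, ENNReal.rpow_zero, one_mul]
  rw [tsum_congr h1, tsum_congr h2, ENNReal.tsum_mul_left, ENNReal.tsum_mul_left]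
  calc L * ((2 : ℝ≥0∞) ^ (-(q * (s + 1)) : ℝ) * ∑' n : ℕ, w n * β (q - 2 + n)) +
        G * ((2 : ℝ≥0∞) ^ (-(q * (s + 1)) : ℝ) * ∑' n : ℕ, w n * α (q - 2 + n))
      = (2 : ℝ≥0∞) ^ (-(q * (s + 1)) : ℝ) *
          ∑' n : ℕ, w n * (L * β (q - 2 + n) + G * α (q - 2 + n)) := by
        have : ∀ n : ℕ, w n * (L * β (q - 2 + n) + G * α (q - 2 + n)) =
            L * (w n * β (q - 2 + n)) + G * (w n * α (q - 2 + n)) := fun n => by ring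
        rw [tsum_congr this, ENNReal.tsum_add, ENNReal.tsum_mul_left, ENNReal.tsum_mul_left]
        ring
    _ ≤ (2 : ℝ≥0∞) ^ (-(q * (s + 1)) : ℝ) * ((∑' n, w n) * c q * X) := by
        gcongr; exact h q
    _ = _ := by ring

variable {N : ℕ}

/-- The fixed-time commutator estimate. -/
theorem exists_commutator_bound (φ : Cutoff N) {s : ℝ} (hs : -1 < s) {p r : ℝ≥0∞} (hp : 1 ≤ p)
    (hr : 1 ≤ r) : ∃ C : ℝ≥0, ∀ p₁ p₂ : ℝ≥0∞, 1 / p = 1 / p₁ + 1 / p₂ →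
      ∀ f g : 𝓢'(Space N, ℂ), normGradLp ∞ f < ∞ → normBesov φ (s + 1) p₂ r f < ∞ →
        normLp p₁ g < ∞ → normBesov φ s p r g < ∞ →
        ∃ c : ℤ → ℝ≥0∞, normSeq r c ≤ 1 ∧ ∀ q : ℤ, IsCommutator φ f q g (comm φ f q g) ∧
          normLp p (comm φ f q g) ≤ C * c q * (2 : ℝ≥0∞) ^ (-(q * (s + 1)) : ℝ) *
            (normGradLp ∞ f * normBesov φ s p r g + normLp p₁ g * normBesov φ (s + 1) p₂ r f) := by
  obtain ⟨A, hA⟩ := exists_isKernelBound φ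
  obtain ⟨W, hW⟩ := exists_sequence_bound hr hs
  refine ⟨8 * A ^ 3 * W, fun p₁ p₂ hpp f g hL hf hg hB => ?_⟩
  have hgood : IsGoodFactor φ p p₁ p₂ f := ⟨hp, hpp,
    tsum_ne_top_of_normSeq_lt_top hr (by linarith) (fun q => normLp p₂ (block φ q f)) hf, hL⟩
  obtain ⟨c, hc, h⟩ := hW (fun q => normLp p₂ (block φ q f)) (fun q => normLp p (block φ q g))
    (normGradLp ∞ f) (normLp p₁ g) (fun q hq => by rw [block_of_le φ hq, normLp_zero])
    (fun q hq => by rw [block_of_le φ hq, normLp_zero]) hL.ne hg.ne hf.ne hB.ne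
  refine ⟨c, hc, fun q => ⟨hgood.isCommutator_comm hA hg q, ?_⟩⟩
  refine (hgood.normLp_comm_le hA hg q).trans ?_
  calc _ ≤ 8 * (A : ℝ≥0∞) ^ 3 * (W * c q * (2 : ℝ≥0∞) ^ (-(q * (s + 1)) : ℝ) *
            (normGradLp ∞ f * normBesov φ s p r g + normLp p₁ g * normBesov φ (s + 1) p₂ r f)) := by
        gcongr
        exact h q
    _ = _ := by push_cast; ring

end

/-! ### Measurability in time -/

section

variable {N : ℕ}

open LineDeriv FourierTransform

/-- A family of functions of `x`, indexed by `t`, that for almost every `t` coincides with a jointly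
measurable family. -/
def AEJointlyMeasurable {α : Type*} [MeasurableSpace α] (μ : Measure α) (G : α → Space N → ℂ) :
    Prop :=
  ∃ G' : α → Space N → ℂ, Measurable (Function.uncurry G') ∧ ∀ᵐ t ∂μ, G t = G' t

namespace AEJointlyMeasurable

variable {α : Type*} [MeasurableSpace α] {μ : Measure α} {G H : α → Space N → ℂ}

/-- Carathéodory families: continuous in space and almost everywhere measurable in time. -/
lemma of_continuous (hc : ∀ t, Continuous (G t))
    (hm : ∀ x, AEStronglyMeasurable (fun t => G t x) μ) : AEJointlyMeasurable μ G := by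
  classical
  let d := TopologicalSpace.denseSeq (Space N)
  have h : ∀ᵐ t ∂μ, ∀ n, G t (d n) = (hm (d n)).mk _ t :=
    ae_all_iff.2 fun n => (hm (d n)).ae_eq_mk
  obtain ⟨S, hS, hSm, hSd⟩ := h.exists_measurable_mem
  let G' : Space N → α → ℂ := fun x t => if t ∈ S then G t x else 0
  have hG'c : ∀ t, Continuous fun x => G' x t := by
    intro t
    by_cases ht : t ∈ S
    · simpa only [G', if_pos ht] using hc t
    · simpa only [G', if_neg ht] using continuous_const
  have hG'd : ∀ n, Measurable (G' (d n)) := by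
    intro n
    have : G' (d n) = fun t => if t ∈ S then (hm (d n)).mk _ t else 0 := by
      funext t
      by_cases ht : t ∈ S
      · simp only [G', if_pos ht, hSd t ht n]
      · simp only [G', if_neg ht]
    rw [this]
    exact Measurable.ite hSm (hm (d n)).stronglyMeasurable_mk.measurable measurable_const
  have hG'm : ∀ x, Measurable (G' x) := by
    intro x
    obtain ⟨y, hy, hyx⟩ := mem_closure_iff_seq_limit.1
      ((TopologicalSpace.denseRange_denseSeq (Space N)) x)
    choose n hn using hy
    refine measurable_of_tendsto_metrizable (f := fun k => G' (d (n k))) (fun k => hG'd _) ?_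
    refine tendsto_pi_nhds.2 fun t => ?_
    have h2 := ((hG'c t).tendsto x).comp hyx
    refine h2.congr fun k => ?_
    simp only [Function.comp_apply, ← hn k]
    rfl
  refine ⟨fun t x => G' x t,
    (measurable_uncurry_of_continuous_of_measurable hG'c hG'm).comp measurable_swap, ?_⟩
  filter_upwards [hS] with t ht
  funext x
  simp only [G', if_pos ht]

lemma of_time_independent {h : Space N → ℂ} (hh : Measurable h) :
    AEJointlyMeasurable μ fun _ => h :=
  ⟨fun _ => h, hh.comp measurable_snd, Filter.Eventually.of_forall fun _ => rfl⟩

lemma mul (hG : AEJointlyMeasurable μ G) (hH : AEJointlyMeasurable μ H) :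
    AEJointlyMeasurable μ fun t x => G t x * H t x := by
  obtain ⟨G', hG'm, hG'⟩ := hG
  obtain ⟨H', hH'm, hH'⟩ := hH
  refine ⟨fun t x => G' t x * H' t x, hG'm.mul hH'm, ?_⟩
  filter_upwards [hG', hH'] with t h1 h2
  rw [h1, h2]

lemma sub (hG : AEJointlyMeasurable μ G) (hH : AEJointlyMeasurable μ H) :
    AEJointlyMeasurable μ fun t x => G t x - H t x := by
  obtain ⟨G', hG'm, hG'⟩ := hG
  obtain ⟨H', hH'm, hH'⟩ := hH
  refine ⟨fun t x => G' t x - H' t x, hG'm.sub hH'm, ?_⟩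
  filter_upwards [hG', hH'] with t h1 h2
  rw [h1, h2]

lemma aestronglyMeasurable_integral (hG : AEJointlyMeasurable μ G) :
    AEStronglyMeasurable (fun t => ∫ x, G t x) μ := by
  obtain ⟨G', hG'm, hG'⟩ := hG
  refine ⟨fun t => ∫ x, G' t x, hG'm.stronglyMeasurable.integral_prod_right, ?_⟩
  filter_upwards [hG'] with t h1
  rw [h1]

/-- Spatial `L^p` norms of a jointly measurable family are measurable in time. -/
lemma aemeasurable_eLpNorm (hG : AEJointlyMeasurable μ G) (p : ℝ≥0∞) :
    AEMeasurable (fun t => eLpNorm (G t) p volume) μ := by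
  obtain ⟨G', hG'm, hG'⟩ := hG
  suffices h : Measurable fun t => eLpNorm (G' t) p volume by
    refine ⟨_, h, ?_⟩
    filter_upwards [hG'] with t h1
    rw [h1]
  have he : Measurable fun z : α × Space N => ‖G' z.1 z.2‖ₑ := hG'm.enorm
  rcases eq_or_ne p 0 with rfl | hp0
  · simp only [eLpNorm_exponent_zero]; exact measurable_const
  rcases eq_or_ne p ∞ with rfl | hpt
  · simp only [eLpNorm_exponent_top]
    refine measurable_of_Ioi fun c => ?_
    have hset : (fun t => eLpNormEssSup (G' t) volume) ⁻¹' Set.Ioi c =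
        {t | 0 < volume (Prod.mk t ⁻¹' {z : α × Space N | c < ‖G' z.1 z.2‖ₑ})} := by
      ext t
      have h1 : eLpNormEssSup (G' t) volume ≤ c ↔
          volume (Prod.mk t ⁻¹' {z : α × Space N | c < ‖G' z.1 z.2‖ₑ}) = 0 := by
        have h2 : volume (Prod.mk t ⁻¹' {z : α × Space N | c < ‖G' z.1 z.2‖ₑ}) = 0 ↔
            ∀ᵐ x, ‖G' t x‖ₑ ≤ c := by
          rw [ae_iff]
          simp only [not_le]
          rfl
        rw [h2]
        exact ⟨fun h => (enorm_ae_le_eLpNormEssSup (G' t) volume).mono fun x hx => hx.trans h,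
          fun h => essSup_le_of_ae_le c h⟩
      simp only [Set.mem_preimage, Set.mem_Ioi, Set.mem_ofPred_eq]
      rw [← not_le, h1, pos_iff_ne_zero]
    rw [hset]
    exact measurable_measure_prodMk_left (measurableSet_lt measurable_const he) measurableSet_Ioi
  · simp only [eLpNorm_eq_lintegral_rpow_enorm_toReal hp0 hpt]
    exact ((he.pow_const _).lintegral_prod_right').pow_const _

end AEJointlyMeasurable

lemma aeJointlyMeasurable_apply_translate {α : Type*} [MeasurableSpace α] {μ : Measure α}
    {F : α → 𝓢'(Space N, ℂ)} (hF : ∀ η, AEStronglyMeasurable (fun t => F t η) μ)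
    (κ : 𝓢(Space N, ℂ)) : AEJointlyMeasurable μ fun t x => F t (translate x κ) :=
  .of_continuous (fun t => continuous_apply_translate (F t) κ) fun _ => hF _

variable {φ : Cutoff N}

/-- The convolution kernel of the block `Δ_q`. -/
def Cutoff.blockKernel (φ : Cutoff N) (q : ℤ) : 𝓢(Space N, ℂ) :=
  𝓕 (φ.lowSymbol (q + 1) - φ.lowSymbol q)

lemma isFun_block (q : ℤ) (F : 𝓢'(Space N, ℂ)) :
    IsFun (block φ q F) fun x => F (translate x (φ.blockKernel q)) := by
  rw [block_eq_fourierMultiplier]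
  exact isFun_fourierMultiplier _ F

section

variable {α : Type*} [MeasurableSpace α] {μ : Measure α} {A : ℝ≥0} {p p₁ p₂ : ℝ≥0∞}
  {f g : α → 𝓢'(Space N, ℂ)}

lemma aemeasurable_normLp_block (hF : ∀ η, AEStronglyMeasurable (fun t => f t η) μ) (q : ℤ) :
    AEMeasurable (fun t => normLp p (block φ q (f t))) μ := by
  simp only [(isFun_block q (f _)).normLp_eq]
  exact (aeJointlyMeasurable_apply_translate hF _).aemeasurable_eLpNorm p

/-- Products are measurable in time, as limits of products of smooth functions. -/
lemma aestronglyMeasurable_product (hA : IsKernelBound φ A)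
    (hf : ∀ η, AEStronglyMeasurable (fun t => f t η) μ)
    (hg : ∀ η, AEStronglyMeasurable (fun t => g t η) μ)
    (hfgood : ∀ᵐ t ∂μ, IsGoodFactor φ p p₁ p₂ (f t)) (hglt : ∀ᵐ t ∂μ, normLp p₁ (g t) < ∞)
    (η : 𝓢(Space N, ℂ)) : AEStronglyMeasurable (fun t => product (f t) (g t) η) μ := by
  refine aestronglyMeasurable_of_tendsto_ae Filter.atTop
    (f := fun (J : ℕ) t => product (f t) (low φ J (g t)) η) (fun J => ?_) ?_
  swap
  · filter_upwards [hfgood, hglt] with t h1 h2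
    exact h1.tendsto_product_low hA h2 η
  refine aestronglyMeasurable_of_tendsto_ae Filter.atTop
    (f := fun (n : ℕ) t => product (low φ n (f t)) (low φ J (g t)) η) (fun n => ?_) ?_
  · have hj := (AEJointlyMeasurable.of_time_independent (μ := μ) η.continuous.measurable).mul
      ((aeJointlyMeasurable_apply_translate hf (φ.kernel n)).mul
        (aeJointlyMeasurable_apply_translate hg (φ.kernel J)))
    refine hj.aestronglyMeasurable_integral.congr ?_
    filter_upwards [hfgood, hglt] with t h1 h2
    exact ((isFun_product h1.one_le h1.holder
      (hA.normLp_low_lt_top h1.one_le_right h1.normLp_lt_top n)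
      (hA.normLp_low_lt_top h1.one_le_left h2 J) (isFun_low φ n (f t))
      (isFun_low φ J (g t))) η).2.symm
  · filter_upwards [hfgood, hglt] with t h1 h2
    obtain ⟨C, hC⟩ := exists_enorm_apply_le h1.one_le η
    have hlg := hA.normLp_low_lt_top h1.one_le_left h2 J
    have hlim := tendsto_normLp_sub_low φ h1.one_le_right h1.summable
    have h0 : Filter.Tendsto (fun n : ℕ => C * (normLp p₂ (f t - low φ n (f t)) *
        normLp p₁ (low φ J (g t)))) Filter.atTop (nhds 0) := by
      have := ENNReal.Tendsto.const_mul (a := C) (ENNReal.Tendsto.mul_const hlim (Or.inr hlg.ne))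
        (Or.inr ENNReal.coe_ne_top)
      simpa using this
    rw [tendsto_iff_edist_tendsto_0]
    refine tendsto_of_tendsto_of_tendsto_of_le_of_le tendsto_const_nhds h0 (fun _ => zero_le)
      fun n => ?_
    have hlf := hA.normLp_low_lt_top h1.one_le_right h1.normLp_lt_top n
    have hd : normLp p₂ (f t - low φ n (f t)) < ∞ :=
      (normLp_sub_le h1.one_le_right _ _).trans_lt (ENNReal.add_lt_top.2 ⟨h1.normLp_lt_top, hlf⟩)
    have hle := normLp_product_le h1.one_le h1.holder hd hlg
    rw [edist_comm, edist_eq_enorm_sub]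
    have hsub := sub_product h1.one_le h1.holder h1.normLp_lt_top hlf hlg
    have : product (f t) (low φ J (g t)) η - product (low φ n (f t)) (low φ J (g t)) η =
        product (f t - low φ n (f t)) (low φ J (g t)) η := by rw [hsub]; rfl
    rw [this]
    exact (hC _ (hle.trans_lt (ENNReal.mul_lt_top hd hlg))).trans (by gcongr)

lemma aestronglyMeasurable_comm (hA : IsKernelBound φ A)
    (hf : ∀ η, AEStronglyMeasurable (fun t => f t η) μ)
    (hg : ∀ η, AEStronglyMeasurable (fun t => g t η) μ)
    (hfgood : ∀ᵐ t ∂μ, IsGoodFactor φ p p₁ p₂ (f t)) (hglt : ∀ᵐ t ∂μ, normLp p₁ (g t) < ∞)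
    (q : ℤ) (η : 𝓢(Space N, ℂ)) : AEStronglyMeasurable (fun t => comm φ (f t) q (g t) η) μ := by
  have h1 : AEStronglyMeasurable (fun t => product (f t) (block φ q (g t)) η) μ := by
    refine aestronglyMeasurable_product (g := fun t => block φ q (g t)) hA hf (fun χ => hg _)
      hfgood ?_ η
    filter_upwards [hfgood, hglt] with t h1 h2
    exact hA.normLp_block_lt_top h1.one_le_left h2 q
  exact h1.sub (aestronglyMeasurable_product hA hf hg hfgood hglt
    (𝓕 (smulLeftCLM ℂ (φ.symbol q) (𝓕⁻ η))))

/-- The `L^p` norm of the commutator is measurable in time, as the limit of the norms obtained by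
replacing `f Δ_q g` with `(S_n f) Δ_q g`, which are norms of continuous functions. -/
lemma aemeasurable_normLp_comm (hA : IsKernelBound φ A)
    (hf : ∀ η, AEStronglyMeasurable (fun t => f t η) μ)
    (hg : ∀ η, AEStronglyMeasurable (fun t => g t η) μ)
    (hfgood : ∀ᵐ t ∂μ, IsGoodFactor φ p p₁ p₂ (f t)) (hglt : ∀ᵐ t ∂μ, normLp p₁ (g t) < ∞)
    (q : ℤ) : AEMeasurable (fun t => normLp p (comm φ (f t) q (g t))) μ := by
  refine aemeasurable_of_tendsto_metrizable_ae Filter.atTop (f := fun (n : ℕ) t =>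
    normLp p (product (low φ n (f t)) (block φ q (g t)) - block φ q (product (f t) (g t))))
    (fun n => ?_) ?_
  · have hj := ((aeJointlyMeasurable_apply_translate hf (φ.kernel n)).mul
      (aeJointlyMeasurable_apply_translate hg (φ.blockKernel q))).sub
      (aeJointlyMeasurable_apply_translate (F := fun t => product (f t) (g t))
        (aestronglyMeasurable_product hA hf hg hfgood hglt) (φ.blockKernel q))
    refine (hj.aemeasurable_eLpNorm p).congr ?_
    filter_upwards [hfgood, hglt] with t h1 h2
    have h3 := (isFun_product h1.one_le h1.holder
      (hA.normLp_low_lt_top h1.one_le_right h1.normLp_lt_top n)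
      (hA.normLp_block_lt_top h1.one_le_left h2 q) (isFun_low φ n (f t))
      (isFun_block q (g t))).sub (isFun_block (φ := φ) q (product (f t) (g t)))
    exact (h3.normLp_eq p).symm
  · filter_upwards [hfgood, hglt] with t h1 h2
    have hlg := hA.normLp_block_lt_top h1.one_le_left h2 q
    have hlim := tendsto_normLp_sub_low φ h1.one_le_right h1.summable
    have h0 : Filter.Tendsto (fun n : ℕ => normLp p₂ (f t - low φ n (f t)) *
        normLp p₁ (block φ q (g t))) Filter.atTop (nhds 0) := by
      have := ENNReal.Tendsto.mul_const hlim (Or.inr hlg.ne)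
      simpa using this
    have hd : ∀ n : ℕ, normLp p (product (f t - low φ n (f t)) (block φ q (g t))) ≤
        normLp p₂ (f t - low φ n (f t)) * normLp p₁ (block φ q (g t)) ∧
        product (f t - low φ n (f t)) (block φ q (g t)) =
          product (f t) (block φ q (g t)) - product (low φ n (f t)) (block φ q (g t)) := by
      intro n
      have hlf := hA.normLp_low_lt_top h1.one_le_right h1.normLp_lt_top n
      exact ⟨normLp_product_le h1.one_le h1.holder ((normLp_sub_le h1.one_le_right _ _).trans_lt
        (ENNReal.add_lt_top.2 ⟨h1.normLp_lt_top, hlf⟩)) hlg,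
        sub_product h1.one_le h1.holder h1.normLp_lt_top hlf hlg⟩
    have hlo := ENNReal.Tendsto.sub (tendsto_const_nhds (x := normLp p (comm φ (f t) q (g t)))
      (f := Filter.atTop)) h0 (Or.inr ENNReal.zero_ne_top)
    have hhi := (tendsto_const_nhds (x := normLp p (comm φ (f t) q (g t)))
      (f := Filter.atTop)).add h0
    rw [tsub_zero] at hlo
    rw [add_zero] at hhi
    refine tendsto_of_tendsto_of_tendsto_of_le_of_le hlo hhi (fun n => ?_) fun n => ?_
    · rw [tsub_le_iff_right]
      have : comm φ (f t) q (g t) =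
          (product (low φ n (f t)) (block φ q (g t)) - block φ q (product (f t) (g t))) +
            product (f t - low φ n (f t)) (block φ q (g t)) := by
        rw [(hd n).2, comm]; abel
      rw [this]
      exact (normLp_add_le h1.one_le _ _).trans (by gcongr; exact (hd n).1)
    · have : product (low φ n (f t)) (block φ q (g t)) - block φ q (product (f t) (g t)) =
          comm φ (f t) q (g t) - product (f t - low φ n (f t)) (block φ q (g t)) := by
        rw [(hd n).2, comm]; abel
      rw [this]
      exact (normLp_sub_le h1.one_le _ _).trans (by gcongr; exact (hd n).1)

end

end

/-! ### The commutator estimate in Chemin–Lerner spaces -/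

section

variable {N : ℕ}

lemma MemTimeDist.aestronglyMeasurable {θ : ℝ≥0∞} {T : ℝ} {f : ℝ → 𝓢'(Space N, ℂ)}
    (h : MemTimeDist θ T f) (η : 𝓢(Space N, ℂ)) :
    AEStronglyMeasurable (fun t => f t η) (timeMeasure T) := (h η).1

section

variable {φ : Cutoff N} {T : ℝ} {f g : ℝ → 𝓢'(Space N, ℂ)} {A : ℝ≥0}
  {p p₁ p₂ θ θ₁ θ₂ θ₃ θ₄ : ℝ≥0∞}

lemma ae_isGoodFactor (hp : 1 ≤ p) (hpp : 1 / p = 1 / p₁ + 1 / p₂) (hθ₁ : 1 ≤ θ₁) (hθ₄ : 1 ≤ θ₄)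
    (hf : ∀ η, AEStronglyMeasurable (fun t => f t η) (timeMeasure T))
    (hL : MemLp (fun t => normGradLp ∞ (f t)) θ₁ (timeMeasure T))
    (hsum : ∑' n : ℕ, normTimeLp θ₄ p₂ T (fun t => block φ (-1 + n) (f t)) ≠ ∞) :
    ∀ᵐ t ∂timeMeasure T, IsGoodFactor φ p p₁ p₂ (f t) := by
  have hm : ∀ n : ℕ, AEMeasurable (fun t => normLp p₂ (block φ (-1 + n) (f t))) (timeMeasure T) :=
    fun n => aemeasurable_normLp_block hf _
  have h1 := ae_lt_top_of_eLpNorm_lt_top (zero_lt_one.trans_le hθ₄).ne'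
    (AEMeasurable.tsum hm) ((eLpNorm_tsum_le hθ₄ hm).trans_lt hsum.lt_top)
  have h2 := ae_lt_top_of_eLpNorm_lt_top (zero_lt_one.trans_le hθ₁).ne' hL.1.aemeasurable hL.2
  filter_upwards [h1, h2] with t ht1 ht2
  exact ⟨hp, hpp, ht1.ne, ht2⟩

/-- The time-dependent version of the estimate for a single block, by the inequalities of Minkowski
and Hölder in time. -/
lemma normTimeLp_comm_le (hA : IsKernelBound φ A) (hθ : 1 ≤ θ)
    (h12 : 1 / θ = 1 / θ₁ + 1 / θ₂) (h34 : 1 / θ = 1 / θ₃ + 1 / θ₄)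
    (hf : ∀ η, AEStronglyMeasurable (fun t => f t η) (timeMeasure T))
    (hg : ∀ η, AEStronglyMeasurable (fun t => g t η) (timeMeasure T))
    (hfgood : ∀ᵐ t ∂timeMeasure T, IsGoodFactor φ p p₁ p₂ (f t))
    (hL : AEMeasurable (fun t => normGradLp ∞ (f t)) (timeMeasure T))
    (hG : AEMeasurable (fun t => normLp p₁ (g t)) (timeMeasure T))
    (hglt : ∀ᵐ t ∂timeMeasure T, normLp p₁ (g t) < ∞) (q : ℤ) :
    normTimeLp θ p T (fun t => comm φ (f t) q (g t)) ≤ 8 * A ^ 3 *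
      (normTimeGradLp θ₁ ∞ T f * ∑' n : ℕ, (2 : ℝ≥0∞) ^ (-((q - 2 + n : ℤ) : ℝ)) *
          normTimeLp θ₂ p T (fun t => block φ (q - 2 + n) (g t)) +
        normTimeLp θ₃ p₁ T g *
          ∑' n : ℕ, normTimeLp θ₄ p₂ T (fun t => block φ (q - 2 + n) (f t))) := by
  have hθ0 : θ ≠ 0 := (zero_lt_one.trans_le hθ).ne'
  have hθ₂ : 1 ≤ θ₂ := one_le_right hθ h12
  have hθ₄ : 1 ≤ θ₄ := one_le_right hθ h34
  have hma : ∀ n : ℕ, AEMeasurable (fun t => normLp p₂ (block φ (q - 2 + n) (f t)))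
      (timeMeasure T) := fun n => aemeasurable_normLp_block hf _
  have hmb' : ∀ n : ℕ, AEMeasurable (fun t => normLp p (block φ (q - 2 + n) (g t)))
      (timeMeasure T) := fun n => aemeasurable_normLp_block hg _
  have hmb : ∀ n : ℕ, AEMeasurable (fun t => (2 : ℝ≥0∞) ^ (-((q - 2 + n : ℤ) : ℝ)) *
      normLp p (block φ (q - 2 + n) (g t))) (timeMeasure T) := fun n => (hmb' n).const_mul _
  set a : ℝ → ℝ≥0∞ := fun t => ∑' n : ℕ, normLp p₂ (block φ (q - 2 + n) (f t))
  set b : ℝ → ℝ≥0∞ := fun t => ∑' n : ℕ, (2 : ℝ≥0∞) ^ (-((q - 2 + n : ℤ) : ℝ)) *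
      normLp p (block φ (q - 2 + n) (g t))
  have ha : AEMeasurable a (timeMeasure T) := AEMeasurable.tsum hma
  have hb : AEMeasurable b (timeMeasure T) := AEMeasurable.tsum hmb
  have hpt : ∀ᵐ t ∂timeMeasure T, ‖normLp p (comm φ (f t) q (g t))‖ₑ ≤
      ‖8 * (A : ℝ≥0∞) ^ 3 * (normGradLp ∞ (f t) * b t + normLp p₁ (g t) * a t)‖ₑ := by
    filter_upwards [hfgood, hglt] with t h1 h2
    exact h1.normLp_comm_le hA h2 q
  refine (eLpNorm_mono_enorm_ae hpt).trans ?_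
  have hsum : AEMeasurable (fun t => normGradLp ∞ (f t) * b t + normLp p₁ (g t) * a t)
      (timeMeasure T) := (hL.mul hb).add (hG.mul ha)
  refine (eLpNorm_const_mul_le hθ0 _ hsum).trans ?_
  gcongr
  refine (eLpNorm_add_le (f := fun t => normGradLp ∞ (f t) * b t)
    (g := fun t => normLp p₁ (g t) * a t) (hL.mul hb).aestronglyMeasurable
    (hG.mul ha).aestronglyMeasurable hθ).trans (add_le_add ?_ ?_)
  · refine (eLpNorm_mul_le hθ h12 hL hb).trans ?_
    refine mul_le_mul_right ((eLpNorm_tsum_le hθ₂ hmb).trans ?_) _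
    exact ENNReal.tsum_le_tsum fun n =>
      eLpNorm_const_mul_le (zero_lt_one.trans_le hθ₂).ne' _ (hmb' n)
  · refine (eLpNorm_mul_le hθ h34 hG ha).trans ?_
    exact mul_le_mul_right (eLpNorm_tsum_le hθ₄ hma) _

/-- A family of distributions that is measurable in time and has finite `L^θ_T(L^p)` norm belongs to
`L^θ_T(L^p)`. -/
lemma memTimeLp_of_normTimeLp_lt_top (hp : 1 ≤ p) (hθ : 1 ≤ θ) {K : ℝ → 𝓢'(Space N, ℂ)}
    (hK : ∀ η, AEStronglyMeasurable (fun t => K t η) (timeMeasure T))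
    (hm : AEMeasurable (fun t => normLp p (K t)) (timeMeasure T))
    (h : normTimeLp θ p T K < ∞) : MemTimeLp θ p T K := by
  have hθ0 : θ ≠ 0 := (zero_lt_one.trans_le hθ).ne'
  refine ⟨fun η => ⟨hK η, ?_⟩, hm.aestronglyMeasurable, h⟩
  obtain ⟨C, hC⟩ := exists_enorm_apply_le hp η
  have hle : ∀ᵐ t ∂timeMeasure T, ‖K t η‖ₑ ≤ ‖C * normLp p (K t)‖ₑ := by
    filter_upwards [ae_lt_top_of_eLpNorm_lt_top hθ0 hm h] with t ht
    exact hC _ ht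
  refine (eLpNorm_mono_enorm_ae hle).trans_lt ?_
  exact (eLpNorm_const_mul_le hθ0 _ hm).trans_lt (ENNReal.mul_lt_top ENNReal.coe_lt_top h)

end

/-- The commutator estimate in Chemin–Lerner spaces. -/
theorem exists_time_commutator_bound (φ : Cutoff N) {s : ℝ} (hs : -1 < s) {p r : ℝ≥0∞}
    (hp : 1 ≤ p) (hr : 1 ≤ r) : ∃ C : ℝ≥0, ∀ p₁ p₂ : ℝ≥0∞, 1 / p = 1 / p₁ + 1 / p₂ →
      ∀ θ θ₁ θ₂ θ₃ θ₄ : ℝ≥0∞, 1 ≤ θ →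
        1 / θ = 1 / θ₁ + 1 / θ₂ → 1 / θ = 1 / θ₃ + 1 / θ₄ → ∀ (T : ℝ) (f g : ℝ → 𝓢'(Space N, ℂ)),
        MemTimeGradLp θ₁ ∞ T f → MemCheminLerner φ θ₄ T (s + 1) p₂ r f →
        MemTimeLp θ₃ p₁ T g → MemCheminLerner φ θ₂ T s p r g →
        ∃ c : ℤ → ℝ≥0∞, normSeq r c ≤ 1 ∧ ∀ q : ℤ,
          (∀ᵐ t ∂timeMeasure T, IsCommutator φ (f t) q (g t) (comm φ (f t) q (g t))) ∧
          MemTimeLp θ p T (fun t => comm φ (f t) q (g t)) ∧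
          normTimeLp θ p T (fun t => comm φ (f t) q (g t)) ≤
            C * c q * (2 : ℝ≥0∞) ^ (-(q * (s + 1)) : ℝ) *
              (normTimeGradLp θ₁ ∞ T f * normCheminLerner φ θ₂ T s p r g +
                normTimeLp θ₃ p₁ T g * normCheminLerner φ θ₄ T (s + 1) p₂ r f) := by
  obtain ⟨A, hA⟩ := exists_isKernelBound φ
  obtain ⟨W, hW⟩ := exists_sequence_bound hr hs
  refine ⟨8 * A ^ 3 * W, fun p₁ p₂ hpp θ θ₁ θ₂ θ₃ θ₄ hθ h12 h34 T f g hL hf hg hB => ?_⟩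
  have hfm := fun η => hf.1.aestronglyMeasurable η
  have hgm := fun η => hg.1.aestronglyMeasurable η
  have hr0 : r ≠ 0 := (zero_lt_one.trans_le hr).ne'
  have hgood : ∀ᵐ t ∂timeMeasure T, IsGoodFactor φ p p₁ p₂ (f t) :=
    ae_isGoodFactor hp hpp (one_le_left hθ h12) (one_le_right hθ h34) hfm hL.2
      (tsum_ne_top_of_normSeq_lt_top hr (by linarith)
        (fun q => normTimeLp θ₄ p₂ T fun t => block φ q (f t)) hf.2)
  have hglt := ae_lt_top_of_eLpNorm_lt_top
    (zero_lt_one.trans_le (one_le_left hθ h34)).ne' hg.2.1.aemeasurable hg.2.2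
  have hzero : ∀ (ρ π : ℝ≥0∞) (h : ℝ → 𝓢'(Space N, ℂ)) (q : ℤ), q ≤ -2 →
      normTimeLp ρ π T (fun t => block φ q (h t)) = 0 := fun ρ π h q hq => by
    simp only [normTimeLp, block_of_le φ hq, normLp_zero]
    exact eLpNorm_zero
  obtain ⟨c, hc, h⟩ := hW (fun q => normTimeLp θ₄ p₂ T fun t => block φ q (f t))
    (fun q => normTimeLp θ₂ p T fun t => block φ q (g t))
    (normTimeGradLp θ₁ ∞ T f) (normTimeLp θ₃ p₁ T g) (hzero _ _ f) (hzero _ _ g)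
    hL.2.2.ne hg.2.2.ne hf.2.ne hB.2.ne
  have hbound : ∀ q : ℤ, normTimeLp θ p T (fun t => comm φ (f t) q (g t)) ≤
      ((8 * A ^ 3 * W : ℝ≥0) : ℝ≥0∞) * c q * (2 : ℝ≥0∞) ^ (-(q * (s + 1)) : ℝ) *
        (normTimeGradLp θ₁ ∞ T f * normCheminLerner φ θ₂ T s p r g +
          normTimeLp θ₃ p₁ T g * normCheminLerner φ θ₄ T (s + 1) p₂ r f) := fun q => by
    refine (normTimeLp_comm_le hA hθ h12 h34 hfm hgm hgood hL.2.1.aemeasurable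
      hg.2.1.aemeasurable hglt q).trans ?_
    calc _ ≤ 8 * (A : ℝ≥0∞) ^ 3 * (W * c q * (2 : ℝ≥0∞) ^ (-(q * (s + 1)) : ℝ) *
            (normTimeGradLp θ₁ ∞ T f * normCheminLerner φ θ₂ T s p r g +
              normTimeLp θ₃ p₁ T g * normCheminLerner φ θ₄ T (s + 1) p₂ r f)) := by
          gcongr
          exact h q
      _ = _ := by push_cast; ring
  refine ⟨c, hc, fun q => ⟨?_, ?_, hbound q⟩⟩
  · filter_upwards [hgood, hglt] with t h1 h2
    exact h1.isCommutator_comm hA h2 q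
  · refine memTimeLp_of_normTimeLp_lt_top hp hθ (aestronglyMeasurable_comm hA hfm hgm hgood hglt q)
      (aemeasurable_normLp_comm hA hfm hgm hgood hglt q) ((hbound q).trans_lt ?_)
    have hcq : c q < ∞ := ((le_normSeq hr0 c q).trans hc).trans_lt ENNReal.one_lt_top
    exact ENNReal.mul_lt_top (ENNReal.mul_lt_top (ENNReal.mul_lt_top ENNReal.coe_lt_top hcq)
      (ENNReal.rpow_ne_top_of_ne_zero (by simp) (by simp)).lt_top)
      (ENNReal.add_lt_top.2 ⟨ENNReal.mul_lt_top hL.2.2 hB.2, ENNReal.mul_lt_top hg.2.2 hf.2⟩)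

end

end LittlewoodPaley

end

theorem mainTheorem5 (N : ℕ) (hN : 1 ≤ N) (φ : LittlewoodPaley.Cutoff N)
    (s : ℝ) (hs : -1 < s) (p r : ℝ≥0∞) (hp : 1 ≤ p) (hr : 1 ≤ r) :
    ∃ C : ℝ≥0, 0 < C ∧
      (∀ p₁ p₂ : ℝ≥0∞, 1 / p = 1 / p₁ + 1 / p₂ →
        ∀ f g : 𝓢'(LittlewoodPaley.Space N, ℂ),
          LittlewoodPaley.normGradLp ∞ f < ∞ →
          LittlewoodPaley.normBesov φ (s + 1) p₂ r f < ∞ →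
          LittlewoodPaley.normLp p₁ g < ∞ →
          LittlewoodPaley.normBesov φ s p r g < ∞ →
          ∃ c : ℤ → ℝ≥0∞, LittlewoodPaley.normSeq r c ≤ 1 ∧
            ∀ q : ℤ, ∃ K : 𝓢'(LittlewoodPaley.Space N, ℂ),
              LittlewoodPaley.IsCommutator φ f q g K ∧
              LittlewoodPaley.normLp p K ≤
                C * c q * (2 : ℝ≥0∞) ^ (-(q * (s + 1)) : ℝ) *
                  (LittlewoodPaley.normGradLp ∞ f * LittlewoodPaley.normBesov φ s p r g +
                    LittlewoodPaley.normLp p₁ g *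
                      LittlewoodPaley.normBesov φ (s + 1) p₂ r f)) ∧
      (∀ p₁ p₂ : ℝ≥0∞, 1 / p = 1 / p₁ + 1 / p₂ →
        ∀ θ θ₁ θ₂ θ₃ θ₄ : ℝ≥0∞, 1 ≤ θ →
          1 / θ = 1 / θ₁ + 1 / θ₂ → 1 / θ = 1 / θ₃ + 1 / θ₄ →
        ∀ T : ℝ, 0 < T →
        ∀ f g : ℝ → 𝓢'(LittlewoodPaley.Space N, ℂ),
          LittlewoodPaley.MemTimeGradLp θ₁ ∞ T f →
          LittlewoodPaley.MemCheminLerner φ θ₄ T (s + 1) p₂ r f →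
          LittlewoodPaley.MemTimeLp θ₃ p₁ T g →
          LittlewoodPaley.MemCheminLerner φ θ₂ T s p r g →
          ∃ c : ℤ → ℝ≥0∞, LittlewoodPaley.normSeq r c ≤ 1 ∧
            ∀ q : ℤ, ∃ K : ℝ → 𝓢'(LittlewoodPaley.Space N, ℂ),
              (∀ᵐ t ∂LittlewoodPaley.timeMeasure T,
                LittlewoodPaley.IsCommutator φ (f t) q (g t) (K t)) ∧
              LittlewoodPaley.MemTimeLp θ p T K ∧
              LittlewoodPaley.normTimeLp θ p T K ≤
                C * c q * (2 : ℝ≥0∞) ^ (-(q * (s + 1)) : ℝ) *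
                  (LittlewoodPaley.normTimeGradLp θ₁ ∞ T f *
                      LittlewoodPaley.normCheminLerner φ θ₂ T s p r g +
                    LittlewoodPaley.normTimeLp θ₃ p₁ T g *
                      LittlewoodPaley.normCheminLerner φ θ₄ T (s + 1) p₂ r f)) := by

  obtain ⟨C₁, h₁⟩ := LittlewoodPaley.exists_commutator_bound φ hs hp hr
  obtain ⟨C₂, h₂⟩ := LittlewoodPaley.exists_time_commutator_bound φ hs hp hr
  refine ⟨C₁ + C₂ + 1, by positivity, ?_, ?_⟩
  · intro p₁ p₂ hpp f g hL hf hg hB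
    obtain ⟨c, hc, h⟩ := h₁ p₁ p₂ hpp f g hL hf hg hB
    refine ⟨c, hc, fun q => ⟨_, (h q).1, (h q).2.trans ?_⟩⟩
    gcongr
    exact le_self_add.trans le_self_add
  · intro p₁ p₂ hpp θ θ₁ θ₂ θ₃ θ₄ hθ h12 h34 T _ f g hL hf hg hB
    obtain ⟨c, hc, h⟩ := h₂ p₁ p₂ hpp θ θ₁ θ₂ θ₃ θ₄ hθ h12 h34 T f g hL hf hg hB
    refine ⟨c, hc, fun q => ⟨_, (h q).1, (h q).2.1, (h q).2.2.trans ?_⟩⟩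
    gcongr
    exact le_add_self.trans le_self_add
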